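/- Let $n,m\ge 0$ and $r\ge 1$ be integers and let $M$ be a smooth $n$-dimensional manifold (Hausdorff, second countable, without boundary), with a smooth atlas of coordinate systems $(x^1,\dots,x^n)$ in which the differentials $dx^\alpha$ of the coordinates with index $\alpha\le m+1$ agree on overlaps, i.e. $\partial x'^\alpha/\partial x^\beta=\delta^\alpha_\beta$ for $\alpha\le m+1$ (for instance, $M$ is the domain of one coordinate system). A linear PDO of order $r$ with smooth coefficients, i.e. a smooth section of $\mathrm{Hom}(J^r(M,\mathbb R^{m+1}),\mathbb R^m)$, is written in the coordinates of the atlas as $$\mathcal L(h)_a=\sum_{j=0}^{r}\ \sum_{\alpha=1}^{m+1}\ \sum_{\beta_1,\dots,\beta_j=1}^{n}\Lambda_a^{\alpha\beta_1\dots\beta_j}\,\partial_{\beta_1\dots\beta_j}h_\alpha ,\qquad a=1,\dots,m,$$ with coefficients symmetric in $\beta_1,\dots,\beta_j$. It is *upper totally symmetric* (UTS) if its highest order coefficients $\Lambda_a^{\alpha\beta_1\dots\beta_r}$ are invariant under all permutations of the indices $\alpha\beta_1\dots\beta_r$ that again give an admissible index string (first index at most $m+1$, the others at most $n$). Let $\mathcal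 U$ be the space of UTS PDOs of order $r$ on $M$, with the strong Whitney $C^\infty$ topology on coefficients. Let $E_0\subset M$ be a (smooth, embedded, not necessarily closed) submanifold of codimension $k$ and $x_0\in E_0$. We say that $\mathcal L$ is *transversal* to $E_0$ at $x_0$ if $E_0$ can be given near $x_0$ by an equation $H=0$, with $H=(H^1,\dots,H^k)$ smooth near $x_0$ and $dH^1(x_0),\dots,dH^k(x_0)$ linearly independent, such that all of the $k$ matrices of size $m\times(m+1)$ $$T^\ell(x_0)=\Big(\sum_{\beta_1,\dots,\beta_r}\Lambda_a^{\alpha\beta_1\dots\beta_r}(x_0)\,\partial_{\beta_1}H^\ell(x_0)\cdots\partial_{\beta_r}H^\ell(x_0)\Big)_{a,\alpha},\qquad \ell=1,\dots,k,$$ have maximal rank $m$. A nonempty $E_0$ is a *characteristic submanifold* of $\mathcal L$ if $\mathcal L$ is not transversal to $E_0$ at any of its points. **Lemma.** Generic UTS PDOs have no characteristic submanifold of positive codimension: there is an open dense set $\mathcal G\subset\mathcal U$ such that no $\mathcal L\in\mathcal G$ has a characteristic submanifold of codimension $k$, for any $k\ge1$. -/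

import Mathlib

open Set Filter Topology
open scoped Manifold ContDiff

/-! ### Coordinates -/

/-- Iterated partial derivative `∂_{β₁} ⋯ ∂_{β_j} f (x)` of a real function `f` on `M` in the
coordinates given by the chart `e`. -/
noncomputable def coordDeriv {n : ℕ} {M : Type*} [TopologicalSpace M]
    (e : OpenPartialHomeomorph M (EuclideanSpace ℝ (Fin n))) (f : M → ℝ)
    {j : ℕ} (β : Fin j → Fin n) (x : M) : ℝ :=
  iteratedFDeriv ℝ j (fun z => f (e.symm z)) (e x)
    (fun i => EuclideanSpace.single (β i) (1 : ℝ))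

/-- First partial derivative `∂_β f (x)` in the coordinates given by the chart `e`. -/
noncomputable def partialDeriv {n : ℕ} {M : Type*} [TopologicalSpace M]
    (e : OpenPartialHomeomorph M (EuclideanSpace ℝ (Fin n))) (f : M → ℝ)
    (β : Fin n) (x : M) : ℝ :=
  fderiv ℝ (fun z => f (e.symm z)) (e x) (EuclideanSpace.single β (1 : ℝ))

/-- The coordinate systems in the atlas of `M` agree in their first `p` coordinates up to
additive (locally constant) terms: `∂x'^α / ∂x^β = δ^α_β` on overlaps for every `α` among the
first `p` indices, i.e. the differentials `dx^α` of the first `p` coordinates are globally defined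
on `M`. It holds trivially if the atlas consists of one chart. -/
def AdaptedAtlas (n p : ℕ) (M : Type*) [TopologicalSpace M]
    [ChartedSpace (EuclideanSpace ℝ (Fin n)) M] : Prop :=
  ∀ e ∈ atlas (EuclideanSpace ℝ (Fin n)) M, ∀ e' ∈ atlas (EuclideanSpace ℝ (Fin n)) M,
    ∀ x ∈ e.source ∩ e'.source, ∀ α β : Fin n, (α : ℕ) < p →
      partialDeriv e (fun y => e' y α) β x = if α = β then 1 else 0

/-! ### Linear partial differential operators with smooth coefficients -/

/-- The value at `x` of component `a` of
`∑_{j ≤ r} Λ^{a α_1 … α_j}_i ∂_{α_1 … α_j} f^i`, computed in the chart `e` with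
coefficients `Λ` (functions of the coordinates). -/
noncomputable def localExpr {n p q : ℕ} (r : ℕ) {M : Type*} [TopologicalSpace M]
    (e : OpenPartialHomeomorph M (EuclideanSpace ℝ (Fin n)))
    (Λ : (j : Fin (r + 1)) → Fin q → Fin p → (Fin j → Fin n) → EuclideanSpace ℝ (Fin n) → ℝ)
    (f : M → Fin p → ℝ) (x : M) (a : Fin q) : ℝ :=
  ∑ j : Fin (r + 1), ∑ i : Fin p, ∑ β : Fin j → Fin n,
    Λ j a i β (e x) * coordDeriv e (fun y => f y i) β x

/-- A linear partial differential operator of order (at most) `r` on `M` from `ℝ^p`-valued to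
`ℝ^q`-valued functions, i.e. a smooth section of `Hom(J^r(M, ℝ^p), ℝ^q)`: smooth coefficients
in every chart of the atlas, symmetric in the differentiation indices, which on overlaps of charts
define the same operator. The coefficients are functions of the coordinates, extended by zero
outside the domain of the coordinates. -/
@[ext]
structure LinearPDO (n r p q : ℕ) (M : Type*) [TopologicalSpace M]
    [ChartedSpace (EuclideanSpace ℝ (Fin n)) M] where
  coeff : atlas (EuclideanSpace ℝ (Fin n)) M → (j : Fin (r + 1)) → Fin q → Fin p →
    (Fin j → Fin n) → EuclideanSpace ℝ (Fin n) → ℝ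
  smooth : ∀ e j a i β, ContDiffOn ℝ ∞ (coeff e j a i β) e.1.target
  coeff_off : ∀ e j a i β, ∀ z ∉ e.1.target, coeff e j a i β z = 0
  symm : ∀ e (j : Fin (r + 1)) a i (β : Fin j → Fin n), ∀ π : Equiv.Perm (Fin j),
    coeff e j a i (β ∘ π) = coeff e j a i β
  compat : ∀ e e' : atlas (EuclideanSpace ℝ (Fin n)) M, ∀ x ∈ e.1.source ∩ e'.1.source,
    ∀ f : M → Fin p → ℝ, ContMDiff (𝓡 n) 𝓘(ℝ, Fin p → ℝ) r f →
      ∀ a, localExpr r e.1 (coeff e) f x a = localExpr r e'.1 (coeff e') f x a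

namespace LinearPDO

section

variable {n r p q : ℕ} {M : Type*} [TopologicalSpace M]
  [ChartedSpace (EuclideanSpace ℝ (Fin n)) M]

/-- The map `f ↦ L f` on `C^r` functions given by the operator. -/
noncomputable def apply (L : LinearPDO n r p q M) (f : M → Fin p → ℝ) (x : M) : Fin q → ℝ :=
  localExpr r (chartAt (EuclideanSpace ℝ (Fin n)) x)
    (L.coeff ⟨chartAt _ x, chart_mem_atlas _ x⟩) f x

/-- The basic strong Whitney neighbourhood of order `s` of `L₀` given by charts `e i`, sets
`K i` and numbers `ε i`: all operators `L` such that, for every `i`, the coefficients of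
`L - L₀` in the chart `e i` and their derivatives up to order `s` are smaller than `ε i`
on `K i`. -/
def whitneyBall (L₀ : LinearPDO n r p q M) (s : ℕ) {ι : Type}
    (e : ι → atlas (EuclideanSpace ℝ (Fin n)) M) (K : ι → Set M) (ε : ι → ℝ) :
    Set (LinearPDO n r p q M) :=
  {L | ∀ i, ∀ x ∈ K i, ∀ j a b β, ∀ l ≤ s,
    ‖iteratedFDeriv ℝ l (fun z => L.coeff (e i) j a b β z - L₀.coeff (e i) j a b β z)
      ((e i).1 x)‖ < ε i}

/-- The strong (Whitney) `C^∞` topology on the space of smooth sections of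
`Hom(J^r(M, ℝ^p), ℝ^q)`: `U` is open if with every `L₀` it contains a neighbourhood
`whitneyBall L₀ s e K ε`, for some order `s` and some locally finite family of compact sets
`K i`, each contained in the domain of the chart `e i`, with positive `ε i`. -/
instance whitneyTopology : TopologicalSpace (LinearPDO n r p q M) where
  IsOpen U := ∀ L₀ ∈ U, ∃ (s : ℕ) (ι : Type) (e : ι → atlas (EuclideanSpace ℝ (Fin n)) M)
    (K : ι → Set M) (ε : ι → ℝ), LocallyFinite K ∧
      (∀ i, IsCompact (K i) ∧ K i ⊆ (e i).1.source ∧ 0 < ε i) ∧ whitneyBall L₀ s e K ε ⊆ U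
  isOpen_univ := fun _ _ =>
    ⟨0, Empty, Empty.elim, Empty.elim, Empty.elim, locallyFinite_of_finite _,
      fun i => i.elim, subset_univ _⟩
  isOpen_inter := by
    rintro U V hU hV L₀ ⟨h₁, h₂⟩
    obtain ⟨s, ι, e, K, ε, hK, h, hb⟩ := hU L₀ h₁
    obtain ⟨s', ι', e', K', ε', hK', h', hb'⟩ := hV L₀ h₂
    refine ⟨max s s', ι ⊕ ι', Sum.elim e e', Sum.elim K K', Sum.elim ε ε',
      hK.sumElim hK', ?_, ?_⟩
    · rintro (i | i)
      · exact h i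
      · exact h' i
    · intro L hL
      refine ⟨hb ?_, hb' ?_⟩
      · intro i x hx j a b β l hl
        exact hL (Sum.inl i) x hx j a b β l (hl.trans (le_max_left _ _))
      · intro i x hx j a b β l hl
        exact hL (Sum.inr i) x hx j a b β l (hl.trans (le_max_right _ _))
  isOpen_sUnion := by
    intro S hS L₀ hL₀
    obtain ⟨U, hU, h⟩ := hL₀
    obtain ⟨s, ι, e, K, ε, hK, h', hb⟩ := hS U hU L₀ h
    exact ⟨s, ι, e, K, ε, hK, h', hb.trans (subset_sUnion_of_mem hU)⟩

/-- Upper totally symmetric operators from `ℝ^{m+1}`-valued to `ℝ^m`-valued functions: in the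
charts of the atlas, the coefficients `Λ_a^{α β₁ … β_r}` of highest order take the same value at
any two index strings `α β₁ … β_r` and `α' β'₁ … β'_r` that are permutations of each other (the
first index of either string being one of the first `m + 1`). -/
def IsUTS {m : ℕ} (L : LinearPDO n r (m + 1) m M) : Prop :=
  ∀ (e : atlas (EuclideanSpace ℝ (Fin n)) M) (a : Fin m) (α α' : Fin (m + 1))
    (β β' : Fin r → Fin n),
    List.Perm ((α : ℕ) :: List.ofFn fun i => (β i : ℕ))
      ((α' : ℕ) :: List.ofFn fun i => (β' i : ℕ)) →
    L.coeff e (Fin.last r) a α β = L.coeff e (Fin.last r) a α' β'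

/-- The matrix `(Λ^{a α_1 … α_r}_i(x) ∂_{α_1}h(x) ⋯ ∂_{α_r}h(x))` in the chart `e`. -/
noncomputable def symbolMatrix (L : LinearPDO n r p q M)
    (e : atlas (EuclideanSpace ℝ (Fin n)) M) (h : M → ℝ) (x : M) : Matrix (Fin q) (Fin p) ℝ :=
  Matrix.of fun a i => ∑ β : Fin r → Fin n,
    L.coeff e (Fin.last r) a i β (e.1 x) * ∏ t : Fin r, partialDeriv e.1 h (β t) x

end

end LinearPDO

/-! ### Submanifolds, transversality and characteristic submanifolds -/

/-- `H` is a local equation `H = 0`, near the point `x₀`, of a submanifold `E₀` of codimension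
`k`: near `x₀` the map `H` is smooth, `E₀` is its zero set, and it is a submersion at `x₀`. -/
def IsLocalEquation {n : ℕ} {M : Type*} [TopologicalSpace M]
    [ChartedSpace (EuclideanSpace ℝ (Fin n)) M] (k : ℕ) (E₀ : Set M) (x₀ : M)
    (H : M → Fin k → ℝ) : Prop :=
  (∃ U : Set M, IsOpen U ∧ x₀ ∈ U ∧ ContMDiffOn (𝓡 n) 𝓘(ℝ, Fin k → ℝ) ∞ H U ∧
    ∀ x ∈ U, x ∈ E₀ ↔ H x = 0) ∧
  Function.Surjective (mfderiv (𝓡 n) 𝓘(ℝ, Fin k → ℝ) H x₀)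

/-- `E₀` is an (embedded, not necessarily closed) smooth submanifold of codimension `k`. -/
def IsSubmanifoldOfCodim {n : ℕ} {M : Type*} [TopologicalSpace M]
    [ChartedSpace (EuclideanSpace ℝ (Fin n)) M] (k : ℕ) (E₀ : Set M) : Prop :=
  ∀ x₀ ∈ E₀, ∃ H : M → Fin k → ℝ, IsLocalEquation (n := n) k E₀ x₀ H

namespace LinearPDO

section

variable {n r p q : ℕ} {M : Type*} [TopologicalSpace M]
  [ChartedSpace (EuclideanSpace ℝ (Fin n)) M]

/-- `L` is transversal at `x₀` to the codimension-`k` submanifold `E₀`: `E₀` is given near `x₀`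
by `H = 0` for some smooth submersion `H = (H¹, …, H^k)` such that the `k` symbol matrices of
`L` on `dH¹(x₀), …, dH^k(x₀)` all have maximal rank `q`. -/
def IsTransversalAt (L : LinearPDO n r p q M) (k : ℕ) (E₀ : Set M) (x₀ : M) : Prop :=
  ∃ H : M → Fin k → ℝ, IsLocalEquation (n := n) k E₀ x₀ H ∧
    ∀ l : Fin k, (L.symbolMatrix ⟨chartAt (EuclideanSpace ℝ (Fin n)) x₀, chart_mem_atlas _ x₀⟩
      (fun x => H x l) x₀).rank = q

/-- `E₀` is a (nonempty) submanifold of codimension `k` to which `L` is tangent, i.e. not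
transversal, at every point. -/
def IsCharacteristicSubmanifold (L : LinearPDO n r p q M) (k : ℕ) (E₀ : Set M) : Prop :=
  E₀.Nonempty ∧ IsSubmanifoldOfCodim (n := n) k E₀ ∧ ∀ x₀ ∈ E₀, ¬ L.IsTransversalAt k E₀ x₀

end

end LinearPDO

/-! ### A Jacobian criterion for algebraic dependence -/

section JacobianCriterion

open MvPolynomial

/-! Write `T(x, ξ)` for the symbol matrix, a polynomial in the covector `ξ`. Rank `m` is an open
condition, so if `T` has rank `m` at one conormal covector of `E₀` at a point, it has rank `m` on a
whole basis of conormal covectors, and the operator is transversal there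
(`isTransversalAt_of_rank_eq`). Along a characteristic submanifold the rank is therefore smaller
than `m` at every conormal covector.

Take the least size for which all minors of `T` vanish at the nonzero conormal covectors. Some minor
`D` of size one less is nonzero at such a covector. It is smaller than `m × m`, so it can be
bordered by one more row and by either of two more columns; this gives minors `f` and `g` that
vanish on an open piece of the conormal bundle. The conormal bundle is Lagrangian, so the iterated
Poisson brackets `{f, ·}^l g` vanish on it as well (`VanishesOn.bracket`,
`exists_isBad_of_rank_lt`). For `l = 0, …, 2n` these are `2n + 1` equations at a point `(x, ξ)` of a
space of dimension `2n`. If `∂f/∂ξ ≠ 0` they are independent conditions on the `2n`-jet of the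
coefficients, because the `l`-th bracket contains the derivatives of order `l` with the factor `(μ ·
∂f/∂ξ)^l D` (`IsBadAt.eq_zero_of_forall`).

If `∂f/∂ξ` vanishes on the conormal bundle, take a shortest iterated `ξ`-derivative of `f` or `g`
that does not vanish there, exchange the columns if it belongs to `g`, and let the derivative one
step shorter play the role of `f`. If all `ξ`-derivatives vanish, then `f` and `g` vanish
identically in `ξ` at a point `x`. For each fixed `ξ` this yields `n + 1` equations in the `n`
unknowns `x`, independent for general `ξ` (`eq_zero_of_forall_degenerateConditions`). In both cases
independence has to be tested with upper totally symmetric variations only; powers of linear forms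
supply enough of them, as they produce every value of a row of `T` at a given `ξ ≠ 0`
(`exists_uts_symbol_eq`).

All conditions are algebraic. In the family obtained from a polynomial symbol by adding all upper
totally symmetric polynomials of degree at most `2n`, a transcendence degree count
(`exists_ne_zero_eval_eq_zero_of_jacobian`) confines the parameters having a bad jet anywhere to a
proper algebraic subset. Since the `2n`-jets of this family at a point contain all admissible jets
near a given member, a parameter off that subset has jets which stay good under small admissible
changes (`exists_good_perturbation`, `IsGoodWith`).

The passage to `M` uses Weierstrass approximation with derivatives and cutoff functions in a chart;
the adapted atlas makes upper total symmetry independent of the chart (`UTS.sum_mul_prod`).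
Perturbations over a locally finite cover by compact sets are made successively, with a shrinking
tolerance that protects what was already achieved (`exists_forall_isGoodOn_mem_whitneyBall`).
Openness holds because goodness is uniform on compact sets and depends on `2n` derivatives only. -/

theorem Derivation.map_aeval_mvPolynomial {k A N ι : Type*} [Fintype ι] [CommRing k]
    [CommRing A] [Algebra k A] [AddCommGroup N] [Module A N] [Module k N] [IsScalarTower k A N]
    (d : Derivation k A N) (z : ι → A) (G : MvPolynomial ι k) :
    d (aeval z G) = ∑ i, aeval z (pderiv i G) • d (z i) := by
  classical
  induction G using MvPolynomial.induction_on with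
  | C a => simp
  | add p q hp hq => simp [hp, hq, add_smul, Finset.sum_add_distrib]
  | mul_X p j hp =>
    simp only [map_mul, Derivation.leibniz, hp, pderiv_X, aeval_X, smul_eq_mul, map_add,
      add_smul, Finset.sum_add_distrib, Finset.smul_sum, mul_smul]
    congr 1
    simp [Pi.single_apply]

/-- Select a maximal independent family among the differentials of the generators; by rank–nullity
the relations bound its size by `card ι - card γ`. Over the subfield `K` generated by the selected
`z`'s all differentials vanish, so `κ` is unramified, hence algebraic over `K`, and the selected
generators bound the transcendence degree. -/
theorem trdeg_add_le_card_of_relations {κ ι γ : Type} [Field κ] [Algebra ℝ κ]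
    [Fintype ι] [Fintype γ] (z : ι → κ) (hz : IntermediateField.adjoin ℝ (range z) = ⊤)
    (A : γ → ι → κ) (hA : LinearIndependent κ A)
    (h : ∀ j, ∑ i, A j i • KaehlerDifferential.D ℝ κ (z i) = 0) :
    Algebra.trdeg ℝ κ + Fintype.card γ ≤ Fintype.card ι := by
  classical
  set v : ι → Ω[κ⁄ℝ] := fun i => KaehlerDifferential.D ℝ κ (z i) with hv
  obtain ⟨τ, a, ha, hsp, hli⟩ := exists_linearIndependent' κ v
  have : Fintype τ := Fintype.ofInjective a ha
  -- the number of elements of `τ`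
  have hcard : Fintype.card τ + Fintype.card γ ≤ Fintype.card ι := by
    let φ : (ι → κ) →ₗ[κ] Ω[κ⁄ℝ] := Fintype.linearCombination κ v
    have hr : Module.finrank κ (LinearMap.range φ) = Fintype.card τ := by
      rw [show LinearMap.range φ = Submodule.span κ (range (v ∘ a)) by
        rw [hsp]; exact Fintype.range_linearCombination κ v]
      exact finrank_span_eq_card hli
    have hk : Fintype.card γ ≤ Module.finrank κ (LinearMap.ker φ) := by
      have : LinearIndependent κ (fun j => (⟨A j, by
          simpa [φ, Fintype.linearCombination_apply, hv] using h j⟩ : LinearMap.ker φ)) :=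
        LinearIndependent.of_comp (LinearMap.ker φ).subtype hA
      simpa using this.fintype_card_le_finrank
    have := LinearMap.finrank_range_add_finrank_ker φ
    rw [Module.finrank_fintype_fun_eq_card] at this
    omega
  let K := IntermediateField.adjoin ℝ (range (z ∘ a))
  have hD : ∀ i, KaehlerDifferential.D K κ (z i) = 0 := by
    intro i
    have h1 : v i ∈ Submodule.span κ (range (v ∘ a)) := by
      rw [hsp]; exact Submodule.subset_span ⟨i, rfl⟩
    have h2 : Submodule.span κ (range (v ∘ a)) ≤
        LinearMap.ker (KaehlerDifferential.map ℝ K κ κ) := by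
      rw [Submodule.span_le]
      rintro _ ⟨t, rfl⟩
      simp only [hv, Function.comp, SetLike.mem_coe, LinearMap.mem_ker, KaehlerDifferential.map_D]
      exact (KaehlerDifferential.D K κ).map_algebraMap
        (⟨z (a t), IntermediateField.subset_adjoin _ _ ⟨t, rfl⟩⟩ : K)
    have h3 := h2 h1
    simpa [hv] using h3
  have hD' : ∀ x : κ, KaehlerDifferential.D K κ x = 0 := by
    intro x
    have hx : x ∈ IntermediateField.adjoin ℝ (range z) := by rw [hz]; trivial
    induction hx using IntermediateField.adjoin_induction with
    | mem x hx => obtain ⟨i, rfl⟩ := hx; exact hD i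
    | algebraMap x =>
      rw [IsScalarTower.algebraMap_apply ℝ K κ]
      exact (KaehlerDifferential.D K κ).map_algebraMap _
    | add x y _ _ hx hy => simp [hx, hy]
    | inv x _ hx => rw [Derivation.leibniz_inv, hx, smul_zero]
    | mul x y _ _ hx hy => simp [hx, hy]
  have hur : Algebra.FormallyUnramified K κ := by
    constructor
    refine ⟨fun x y => ?_⟩
    have key : ∀ x : Ω[κ⁄K], x = 0 := by
      intro x
      have : x ∈ Submodule.span κ (range (KaehlerDifferential.D K κ)) := by
        rw [KaehlerDifferential.span_range_derivation]; trivial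
      refine (Submodule.span_le (p := ⊥)).2 ?_ this
      rintro _ ⟨y, rfl⟩
      exact hD' y
    rw [key x, key y]
  have hfin : Algebra.EssFiniteType ℝ κ := by
    have h1 : (⊤ : IntermediateField ℝ κ).FG := by
      rw [← hz]
      exact ⟨Finset.univ.image z, by simp⟩
    have := IntermediateField.essFiniteType_iff.2 h1
    exact (Algebra.EssFiniteType.iff_of_algEquiv IntermediateField.topEquiv).1 this
  have : Algebra.EssFiniteType K κ := Algebra.EssFiniteType.of_comp ℝ K κ
  have hsep : Algebra.IsSeparable K κ := (Algebra.FormallyUnramified.iff_isSeparable K κ).1 hur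
  have halg : Algebra.IsAlgebraic K κ := inferInstance
  have halg' : Algebra.IsAlgebraic (Algebra.adjoin ℝ (range (z ∘ a))) κ := by
    open IntermediateField.algebraAdjoinAdjoin in
    exact (IsFractionRing.comap_isAlgebraic_iff (K := K)).2 halg
  have h1 := Algebra.IsAlgebraic.trdeg_le_cardinalMk ℝ (range (z ∘ a))
  have h2 : Cardinal.mk (range (z ∘ a)) ≤ Fintype.card τ := by
    rw [← Cardinal.mk_fintype]
    exact Cardinal.mk_range_le
  calc Algebra.trdeg ℝ κ + Fintype.card γ ≤ (Fintype.card τ : Cardinal) + Fintype.card γ := by gcongr; exact h1.trans h2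
    _ ≤ _ := by exact_mod_cast hcard

/-- If polynomials `G j` (`j : γ`) in the variables `ι₁ ⊕ ι₂` vanish on a set `X` and have
linearly independent differentials at each of its points, and if `ι₂` has less elements than `γ`,
then the projection of `X` to the variables `ι₁` is contained in a proper algebraic subset. -/
theorem exists_ne_zero_eval_eq_zero_of_jacobian {ι₁ ι₂ γ : Type} [Fintype ι₁] [Fintype ι₂]
    [Fintype γ] (G : γ → MvPolynomial (ι₁ ⊕ ι₂) ℝ) (X : Set (ι₁ ⊕ ι₂ → ℝ))
    (hG : ∀ x ∈ X, ∀ j, eval x (G j) = 0)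
    (hJ : ∀ x ∈ X, ∀ b : γ → ℝ, (∀ i, ∑ j, b j * eval x (pderiv i (G j)) = 0) → b = 0)
    (hc : Fintype.card ι₂ < Fintype.card γ) :
    ∃ R : MvPolynomial ι₁ ℝ, R ≠ 0 ∧ ∀ x ∈ X, eval (fun i => x (Sum.inl i)) R = 0 := by
  classical
  by_contra! hcon
  let A : Matrix γ (ι₁ ⊕ ι₂) (MvPolynomial (ι₁ ⊕ ι₂) ℝ) :=
    Matrix.of fun j i => pderiv i (G j)
  -- The Gram determinant is a single polynomial. Over `ℝ` it is nonzero exactly when the rows are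
  -- independent; over another field its being nonzero still implies independence, which is the
  -- direction needed in `κ`.
  let J : MvPolynomial (ι₁ ⊕ ι₂) ℝ := (A * A.transpose).det
  have hJX : ∀ x ∈ X, eval x J ≠ 0 := by
    intro x hx h0
    let B : Matrix γ (ι₁ ⊕ ι₂) ℝ := Matrix.of fun j i => eval x (pderiv i (G j))
    have h1 : (B * B.transpose).det = 0 := by
      rw [← h0, RingHom.map_det]
      congr 1
      ext i j
      simp [B, A, Matrix.mul_apply]
    obtain ⟨b, hb, hb0⟩ := Matrix.exists_vecMul_eq_zero_iff.2 h1
    refine hb (hJ x hx b ?_)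
    have h2 : Matrix.vecMul b B = 0 := by
      have : (Matrix.vecMul b B) ⬝ᵥ (Matrix.vecMul b B) = 0 := by
        rw [← Matrix.mulVec_transpose, Matrix.dotProduct_mulVec, Matrix.mulVec_transpose,
          Matrix.vecMul_vecMul, hb0, zero_dotProduct]
      exact dotProduct_self_eq_zero.1 this
    intro i
    simpa [Matrix.vecMul, dotProduct, B] using congrFun h2 i
  let I : Ideal (MvPolynomial (ι₁ ⊕ ι₂) ℝ) := vanishingIdeal ℝ X
  have hI : ∀ p, p ∈ I ↔ ∀ x ∈ X, eval x p = 0 := fun p => by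
    simp [I, mem_vanishingIdeal_iff, MvPolynomial.aeval_eq_eval]
  let S₁ : Submonoid (MvPolynomial (ι₁ ⊕ ι₂) ℝ) :=
    (nonZeroDivisors (MvPolynomial ι₁ ℝ)).map (rename (R := ℝ) (Sum.inl : ι₁ → ι₁ ⊕ ι₂))
  -- A product `s * J ^ k` does not vanish on `X`: `s` is nonzero at some point of `X` by
  -- assumption, and `J` at every point. In the residue field of `P` the variables `ι₁` thus stay
  -- algebraically independent and the Jacobian keeps full rank, so no irreducible components are
  -- needed.
  obtain ⟨P, hP, hIP, hPd⟩ := I.exists_le_prime_disjoint (S₁ ⊔ Submonoid.powers J) (by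
    rw [Set.disjoint_left]
    intro p hp hpS
    obtain ⟨_, ⟨s, hs, rfl⟩, _, ⟨k, rfl⟩, rfl⟩ := Submonoid.mem_sup.1 hpS
    obtain ⟨x, hx, hxs⟩ := hcon s (nonZeroDivisors.ne_zero hs)
    have := (hI _).1 hp x hx
    simp only [map_mul, map_pow, mul_eq_zero, eval_rename] at this
    rcases this with h | h
    · exact hxs (by simpa [eval_rename, Function.comp_def] using h)
    · exact hJX x hx (eq_zero_of_pow_eq_zero h))
  let κ := FractionRing (MvPolynomial (ι₁ ⊕ ι₂) ℝ ⧸ P)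
  let π : MvPolynomial (ι₁ ⊕ ι₂) ℝ →ₐ[ℝ] κ :=
    (IsScalarTower.toAlgHom ℝ (MvPolynomial (ι₁ ⊕ ι₂) ℝ ⧸ P) κ).comp (Ideal.Quotient.mkₐ ℝ P)
  have hπ : ∀ p, π p = 0 ↔ p ∈ P := by
    intro p
    simp only [π, AlgHom.comp_apply, IsScalarTower.coe_toAlgHom', Ideal.Quotient.mkₐ_eq_mk]
    rw [FaithfulSMul.algebraMap_eq_zero_iff, Ideal.Quotient.eq_zero_iff_mem]
  let z : ι₁ ⊕ ι₂ → κ := fun i => π (MvPolynomial.X i)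
  have hπz : ∀ p, aeval z p = π p := fun p => by
    have : aeval z = π := by ext i; simp [z]
    rw [this]
  have hz : IntermediateField.adjoin ℝ (range z) = ⊤ := by
    rw [eq_top_iff]
    intro x _
    have hmem : ∀ p, π p ∈ IntermediateField.adjoin ℝ (range z) := fun p => by
      rw [← hπz]
      induction p using MvPolynomial.induction_on with
      | C a => simp only [aeval_C]; exact IntermediateField.algebraMap_mem _ a
      | add p q hp hq => rw [map_add]; exact add_mem hp hq
      | mul_X p j hp =>
        rw [map_mul, aeval_X]
        exact mul_mem hp (IntermediateField.subset_adjoin _ _ ⟨j, rfl⟩)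
    obtain ⟨p, q, -, rfl⟩ := IsFractionRing.div_surjective (A := MvPolynomial (ι₁ ⊕ ι₂) ℝ ⧸ P) x
    obtain ⟨p, rfl⟩ := Ideal.Quotient.mk_surjective p
    obtain ⟨q, rfl⟩ := Ideal.Quotient.mk_surjective q
    exact div_mem (hmem p) (hmem q)
  have hGP : ∀ j, π (G j) = 0 := fun j => (hπ _).2 (hIP ((hI _).2 fun x hx => hG x hx j))
  have hindep : LinearIndependent κ (fun j i => π (pderiv i (G j))) := by
    rw [Fintype.linearIndependent_iff]
    intro b hb
    have hdet : ((A.map π) * (A.map π).transpose).det ≠ 0 := by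
      intro h0
      have : π J = 0 := by
        rw [← h0, AlgHom.map_det]
        congr 1
        ext i j
        simp [Matrix.mul_apply]
      exact Set.disjoint_left.1 hPd ((hπ _).1 this)
        ((le_sup_right : _ ≤ S₁ ⊔ Submonoid.powers J) (Submonoid.mem_powers J))
    have h1 : Matrix.vecMul b (A.map π) = 0 := by
      ext i
      simpa [Matrix.vecMul, dotProduct, A] using congrFun hb i
    have h2 : Matrix.vecMul b ((A.map π) * (A.map π).transpose) = 0 := by
      rw [← Matrix.vecMul_vecMul, h1, Matrix.zero_vecMul]
    have h3 := Matrix.eq_zero_of_vecMul_eq_zero hdet h2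
    exact congrFun h3
  have hle := trdeg_add_le_card_of_relations z hz _ hindep (fun j => by
    have := (KaehlerDifferential.D ℝ κ).map_aeval_mvPolynomial z (G j)
    rw [hπz, hGP, map_zero] at this
    simpa [hπz] using this.symm)
  have halg : AlgebraicIndependent ℝ (fun i : ι₁ => z (Sum.inl i)) := by
    rw [algebraicIndependent_iff]
    intro p hp
    by_contra hp0
    have : π (rename Sum.inl p) = 0 := by
      rw [← hπz, aeval_rename]; exact hp
    exact Set.disjoint_left.1 hPd ((hπ _).1 this)
      ((le_sup_left : _ ≤ S₁ ⊔ Submonoid.powers J)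
        (Submonoid.mem_map_of_mem _ (mem_nonZeroDivisors_of_ne_zero hp0)))
  have hge := halg.cardinalMk_le_trdeg
  rw [Cardinal.mk_fintype] at hge
  have : (Fintype.card ι₁ : Cardinal) + Fintype.card γ ≤ (Fintype.card (ι₁ ⊕ ι₂) : ℕ) :=
    le_trans (by gcongr) hle
  have : Fintype.card ι₁ + Fintype.card γ ≤ Fintype.card (ι₁ ⊕ ι₂) := by exact_mod_cast this
  rw [Fintype.card_sum] at this
  omega

end JacobianCriterion

/-! ### The ring of polynomials in jets of symbols and covectors -/

namespace UTSJets

open MvPolynomial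

/-- Indices of the highest order coefficients of an operator. -/
abbrev SymbolIndex (n m r : ℕ) : Type := Fin m × Fin (m + 1) × (Fin r → Fin n)

/-- Variables: the derivatives of the highest order coefficients along words, and the components
of a covector. -/
abbrev JetVar (n m r : ℕ) : Type := (SymbolIndex n m r × List (Fin n)) ⊕ Fin n

abbrev JetRing (n m r : ℕ) : Type := MvPolynomial (JetVar n m r) ℝ

/-- Jets of symbols: values for all coefficients and all words of derivatives. -/
abbrev Jet (n m r : ℕ) : Type := SymbolIndex n m r → List (Fin n) → ℝ

variable {n m r : ℕ}

/-- The total derivative in the direction of the `k`-th coordinate. -/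
noncomputable def totalD (k : Fin n) : Derivation ℝ (JetRing n m r) (JetRing n m r) :=
  mkDerivation ℝ (Sum.elim (fun p => X (Sum.inl (p.1, k :: p.2))) 0)

/-- The derivative with respect to the `k`-th component of the covector. -/
noncomputable def covD (k : Fin n) : Derivation ℝ (JetRing n m r) (JetRing n m r) :=
  pderiv (Sum.inr k)

/-- The symbol matrix. -/
noncomputable def symb : Matrix (Fin m) (Fin (m + 1)) (JetRing n m r) :=
  Matrix.of fun a α => ∑ β : Fin r → Fin n,
    X (Sum.inl ((a, α, β), [])) * ∏ t, X (Sum.inr (β t))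

/-- Evaluation at a jet and a covector. -/
noncomputable def ev (y : Jet n m r) (ξ : Fin n → ℝ) : JetRing n m r →ₐ[ℝ] ℝ :=
  aeval (Sum.elim (fun p => y p.1 p.2) ξ)

/-- The Poisson bracket with `φ`. -/
noncomputable def bracket (φ p : JetRing n m r) : JetRing n m r :=
  ∑ k, (covD k φ * totalD k p - totalD k φ * covD k p)

/-- The variation of the jet in the direction of the homogeneous jet of order `j` given by
`q` times the `j`-th power of the linear form `μ`. -/
noncomputable def jetVariation (q : SymbolIndex n m r → ℝ) (μ : Fin n → ℝ) (j : ℕ) :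
    Derivation ℝ (JetRing n m r) (JetRing n m r) :=
  mkDerivation ℝ (Sum.elim
    (fun p => if p.2.length = j then C (q p.1 * (p.2.map μ).prod) else 0) 0)

section

variable (q : SymbolIndex n m r → ℝ) (μ : Fin n → ℝ)

@[simp] theorem totalD_inl (k : Fin n) (p) :
    totalD k (X (Sum.inl p) : JetRing n m r) = X (Sum.inl (p.1, k :: p.2)) := by
  simp [totalD, mkDerivation_X]

@[simp] theorem totalD_inr (k i : Fin n) : totalD k (X (Sum.inr i) : JetRing n m r) = 0 := by
  simp [totalD, mkDerivation_X]

@[simp] theorem covD_inl (k : Fin n) (p) : covD k (X (Sum.inl p) : JetRing n m r) = 0 := by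
  simp [covD, pderiv_X]

@[simp] theorem covD_inr (k i : Fin n) :
    covD k (X (Sum.inr i) : JetRing n m r) = if i = k then 1 else 0 := by
  classical
  simp [covD, pderiv_X, Pi.single_apply]

@[simp] theorem jetVariation_inl (j : ℕ) (p) :
    jetVariation q μ j (X (Sum.inl p) : JetRing n m r) =
      if p.2.length = j then C (q p.1 * (p.2.map μ).prod) else 0 := by
  simp [jetVariation, mkDerivation_X]

@[simp] theorem jetVariation_inr (j : ℕ) (i : Fin n) :
    jetVariation q μ j (X (Sum.inr i) : JetRing n m r) = 0 := by
  simp [jetVariation, mkDerivation_X]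

theorem jetVariation_covD (j : ℕ) (k : Fin n) (p : JetRing n m r) :
    jetVariation q μ j (covD k p) = covD k (jetVariation q μ j p) := by
  have : ⁅jetVariation q μ j, covD k⁆ = (0 : Derivation ℝ (JetRing n m r) (JetRing n m r)) := by
    refine derivation_ext fun i => ?_
    rcases i with p | i
    · simp only [Derivation.commutator_apply, covD_inl, jetVariation_inl, map_zero,
        Derivation.coe_zero, Pi.zero_apply]
      split_ifs <;> simp [covD]
    · simp only [Derivation.commutator_apply, covD_inr, jetVariation_inr, map_zero]
      split_ifs <;> simp
  have := Derivation.congr_fun this p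
  simpa [Derivation.commutator_apply, sub_eq_zero] using this

/-- A commutator of derivations is determined by the variables. There `totalD k` prepends the letter
`k` to the word, which costs one order and contributes the factor `μ k`. -/
theorem jetVariation_succ_totalD (j : ℕ) (k : Fin n) (p : JetRing n m r) :
    jetVariation q μ (j + 1) (totalD k p) =
      totalD k (jetVariation q μ (j + 1) p) + C (μ k) * jetVariation q μ j p := by
  have : ⁅jetVariation q μ (j + 1), totalD k⁆ =
      (C (μ k) : JetRing n m r) • jetVariation q μ j := by
    refine derivation_ext fun i => ?_
    rcases i with p | i
    · simp only [Derivation.commutator_apply, totalD_inl, jetVariation_inl, Derivation.smul_apply,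
        smul_eq_mul, List.length_cons, add_left_inj, List.map_cons, List.prod_cons]
      have h0 : ∀ c : Prop, [Decidable c] → ∀ a : ℝ,
          totalD k (if c then C a else 0 : JetRing n m r) = 0 := by
        intro c _ a
        split_ifs <;> simp [totalD]
      rw [h0]
      split_ifs with h1
      · simp only [map_mul]; ring
      · simp
    · simp [Derivation.commutator_apply]
  have := Derivation.congr_fun this p
  simp only [Derivation.commutator_apply, Derivation.smul_apply, smul_eq_mul] at this
  rw [← this]; ring

/-- A polynomial that does not involve derivatives of the coefficients. -/
def IsOrderZero (p : JetRing n m r) : Prop :=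
  ∀ (q : SymbolIndex n m r → ℝ) (μ : Fin n → ℝ) (j : ℕ), jetVariation q μ (j + 1) p = 0

theorem IsOrderZero.covD {p : JetRing n m r} (hp : IsOrderZero p) (k : Fin n) :
    IsOrderZero (UTSJets.covD k p) := fun q μ j => by
  rw [jetVariation_covD, hp q μ j, map_zero]

variable {q μ}

/-- Iterated brackets with `φ`. -/
noncomputable def bracketChain (φ g : JetRing n m r) (l : ℕ) : JetRing n m r := (bracket φ)^[l] g

theorem bracketChain_succ (φ g : JetRing n m r) (l : ℕ) :
    bracketChain φ g (l + 1) = bracket φ (bracketChain φ g l) :=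
  Function.iterate_succ_apply' _ _ _

theorem jetVariation_bracket {φ : JetRing n m r} (hφ : IsOrderZero φ) (p : JetRing n m r) (j : ℕ) :
    jetVariation q μ (j + 1) (bracket φ p) =
      ∑ k, (covD k φ * totalD k (jetVariation q μ (j + 1) p)
        + covD k φ * C (μ k) * jetVariation q μ j p
        - totalD k φ * covD k (jetVariation q μ (j + 1) p)
        - C (μ k) * jetVariation q μ j φ * covD k p) := by
  rw [bracket, map_sum]
  refine Finset.sum_congr rfl fun k _ => ?_
  rw [map_sub, Derivation.leibniz, Derivation.leibniz, jetVariation_succ_totalD,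
    jetVariation_succ_totalD, jetVariation_covD, jetVariation_covD, hφ q μ j]
  simp only [smul_eq_mul, map_zero]
  ring

/-- Every bracket with a polynomial of order zero raises the order in the jet variables by at most
one. This is the triangularity behind the independence of the chain. -/
theorem jetVariation_bracketChain_of_lt {φ g : JetRing n m r} (hφ : IsOrderZero φ)
    (hg : IsOrderZero g) (l : ℕ) : ∀ j, l < j → jetVariation q μ j (bracketChain φ g l) = 0 := by
  induction l with
  | zero =>
    intro j hj
    obtain ⟨j, rfl⟩ := Nat.exists_eq_succ_of_ne_zero hj.ne'
    exact hg q μ j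
  | succ l ih =>
    intro j hj
    obtain ⟨j, rfl⟩ := Nat.exists_eq_succ_of_ne_zero (Nat.ne_zero_of_lt hj)
    obtain ⟨j, rfl⟩ := Nat.exists_eq_succ_of_ne_zero (show j ≠ 0 by omega)
    rw [bracketChain_succ, Nat.succ_eq_add_one, jetVariation_bracket hφ,
      ih (j.succ + 1) (by omega), ih j.succ (by omega), hφ q μ j]
    simp

/-- At top order only the term in which `totalD` creates the new derivative survives, giving one
factor `μ · ∂φ/∂ξ` per bracket. The competing term, a variation of `φ` times a covector derivative
of the chain, can occur only in the first bracket as `φ` has order zero; the hypothesis `h` removes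
it. -/
theorem ev_jetVariation_bracketChain {φ g : JetRing n m r} (hφ : IsOrderZero φ)
    (hg : IsOrderZero g) {y : Jet n m r} {ξ : Fin n → ℝ}
    (h : ev y ξ (jetVariation q μ 0 φ) = 0 ∨ ∀ k, ev y ξ (covD k g) = 0) (l : ℕ) :
    ev y ξ (jetVariation q μ l (bracketChain φ g l)) =
      (∑ k, μ k * ev y ξ (covD k φ)) ^ l * ev y ξ (jetVariation q μ 0 g) := by
  induction l with
  | zero => simp [bracketChain]
  | succ l ih =>
    rw [bracketChain_succ, jetVariation_bracket hφ,
      jetVariation_bracketChain_of_lt hφ hg l (l + 1) (by omega)]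
    have h2 : ∀ k, ev y ξ (C (μ k) * jetVariation q μ l φ * covD k (bracketChain φ g l)) = 0 := by
      intro k
      rcases l with _ | l
      · rcases h with h | h
        · simp [h]
        · simp [bracketChain, h]
      · rw [hφ q μ l]; simp
    rw [map_sum, pow_succ, mul_assoc, mul_comm _ (ev y ξ _), ← mul_assoc, ← ih, Finset.mul_sum]
    refine Finset.sum_congr rfl fun k _ => ?_
    rw [map_sub, h2]
    simp [ev]
    ring

end

end UTSJets

/-! ### Variation of minors of the symbol matrix -/

namespace UTSJets

open MvPolynomial

variable {n m r : ℕ}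

/-- A minor of the symbol matrix. -/
noncomputable def minor {ρ : ℕ} (A : Fin ρ → Fin m) (B : Fin ρ → Fin (m + 1)) : JetRing n m r :=
  (symb.submatrix A B).det

theorem derivation_det_eq_zero {ρ : ℕ} (d : Derivation ℝ (JetRing n m r) (JetRing n m r))
    (N : Matrix (Fin ρ) (Fin ρ) (JetRing n m r)) (h : ∀ i j, d (N i j) = 0) : d N.det = 0 := by
  have hprod : ∀ (s : Finset (Fin ρ)) (u : Fin ρ → JetRing n m r), (∀ i, d (u i) = 0) →
      d (∏ i ∈ s, u i) = 0 := by
    intro s u hu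
    induction s using Finset.induction_on with
    | empty => simp
    | insert i s hi ih => rw [Finset.prod_insert hi, Derivation.leibniz, ih, hu]; simp
  rw [Matrix.det_apply, map_sum]
  refine Finset.sum_eq_zero fun σ _ => ?_
  rw [Units.smul_def, map_zsmul, hprod _ _ fun i => h _ _, smul_zero]

theorem jetVariation_symb_succ (q : SymbolIndex n m r → ℝ) (μ : Fin n → ℝ) (j : ℕ)
    (a : Fin m) (γ : Fin (m + 1)) : jetVariation q μ (j + 1) (symb a γ) = 0 := by
  have hprod : ∀ (s : Finset (Fin r)) (β : Fin r → Fin n),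
      jetVariation q μ (j + 1) (∏ t ∈ s, X (Sum.inr (β t)) : JetRing n m r) = 0 := by
    intro s β
    induction s using Finset.induction_on with
    | empty => simp
    | insert i s hi ih => rw [Finset.prod_insert hi, Derivation.leibniz, ih]; simp
  simp only [symb, Matrix.of_apply, map_sum]
  refine Finset.sum_eq_zero fun β _ => ?_
  rw [Derivation.leibniz, hprod, jetVariation_inl]
  simp

theorem jetVariation_symb_zero (q : SymbolIndex n m r → ℝ) (μ : Fin n → ℝ)
    (a : Fin m) (γ : Fin (m + 1)) : jetVariation q μ 0 (symb a γ) =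
      ∑ β : Fin r → Fin n, C (q (a, γ, β)) * ∏ t, X (Sum.inr (β t)) := by
  have hprod : ∀ (s : Finset (Fin r)) (β : Fin r → Fin n),
      jetVariation q μ 0 (∏ t ∈ s, X (Sum.inr (β t)) : JetRing n m r) = 0 := by
    intro s β
    induction s using Finset.induction_on with
    | empty => simp
    | insert i s hi ih => rw [Finset.prod_insert hi, Derivation.leibniz, ih]; simp
  simp only [symb, Matrix.of_apply, map_sum]
  refine Finset.sum_congr rfl fun β _ => ?_
  rw [Derivation.leibniz, hprod, jetVariation_inl]
  simp [mul_comm]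

theorem isOrderZero_minor {ρ : ℕ} (A : Fin ρ → Fin m) (B : Fin ρ → Fin (m + 1)) :
    IsOrderZero (minor A B : JetRing n m r) := fun q μ j =>
  derivation_det_eq_zero _ _ fun _ _ => jetVariation_symb_succ q μ j _ _

/-- The coefficient of the entry of the symbol matrix with index `(a, γ)` in the minor with rows
`a, A` and columns `α, B`. -/
noncomputable def cof {ρ : ℕ} (A : Fin ρ → Fin m) (B : Fin ρ → Fin (m + 1)) (α γ : Fin (m + 1)) :
    JetRing n m r :=
  ∑ j : Fin (ρ + 1), if (Fin.cons α B : Fin (ρ + 1) → Fin (m + 1)) j = γ then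
    (-1) ^ (j : ℕ) * minor A ((Fin.cons α B : Fin (ρ + 1) → Fin (m + 1)) ∘ j.succAbove) else 0

theorem cof_self {ρ : ℕ} (A : Fin ρ → Fin m) (B : Fin ρ → Fin (m + 1)) {α : Fin (m + 1)}
    (hα : α ∉ range B) : (cof A B α α : JetRing n m r) = minor A B := by
  rw [cof, Fin.sum_univ_succ]
  simp only [Fin.cons_zero, if_true, Fin.val_zero, pow_zero, one_mul, Fin.cons_succ]
  rw [Finset.sum_eq_zero fun j _ => if_neg fun h => hα ⟨j, h⟩, add_zero]
  congr 1

theorem cof_of_ne {ρ : ℕ} (A : Fin ρ → Fin m) (B : Fin ρ → Fin (m + 1)) {α γ : Fin (m + 1)}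
    (hα : γ ∉ range B) (hne : α ≠ γ) : (cof A B α γ : JetRing n m r) = 0 := by
  rw [cof, Fin.sum_univ_succ]
  simp only [Fin.cons_zero, if_neg hne, Fin.cons_succ, zero_add]
  exact Finset.sum_eq_zero fun j _ => if_neg fun h => hα ⟨j, h⟩

/-- Laplace expansion along the first row: as `a ∉ range A`, the complementary minors do not see the
row that is varied. -/
theorem jetVariation_minor_cons {ρ : ℕ} (A : Fin ρ → Fin m) (B : Fin ρ → Fin (m + 1)) {a : Fin m}
    (ha : a ∉ range A) (α : Fin (m + 1)) (q : SymbolIndex n m r → ℝ)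
    (hq : ∀ a' α β, a' ≠ a → q (a', α, β) = 0) (μ : Fin n → ℝ) :
    jetVariation q μ 0 (minor (Fin.cons a A) (Fin.cons α B)) =
      ∑ γ, cof A B α γ * jetVariation q μ 0 (symb a γ) := by
  have hA : ∀ B' : Fin ρ → Fin (m + 1), jetVariation q μ 0 (minor A B') = 0 := fun B' =>
    derivation_det_eq_zero _ _ fun i j => by
      rw [Matrix.submatrix_apply, jetVariation_symb_zero]
      refine Finset.sum_eq_zero fun β _ => ?_
      rw [hq _ _ _ fun h => ha ⟨i, h⟩]; simp
  rw [minor, Matrix.det_succ_row_zero, map_sum]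
  simp only [cof, Finset.sum_mul]
  rw [Finset.sum_comm]
  refine Finset.sum_congr rfl fun j _ => ?_
  have h1 : ((symb (n := n) (r := r)).submatrix (Fin.cons a A : Fin (ρ + 1) → Fin m)
      (Fin.cons α B : Fin (ρ + 1) → Fin (m + 1))).submatrix Fin.succ j.succAbove =
      symb.submatrix A ((Fin.cons α B : Fin (ρ + 1) → Fin (m + 1)) ∘ j.succAbove) := by
    ext i k; simp
  rw [h1]
  change jetVariation q μ 0 (_ * minor A _) = _
  rw [Derivation.leibniz, hA, Derivation.leibniz]
  have h2 : jetVariation q μ 0 ((-1 : JetRing n m r) ^ (j : ℕ)) = 0 := by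
    have : ((-1 : JetRing n m r) ^ (j : ℕ)) = C ((-1) ^ (j : ℕ)) := by simp
    rw [this]; simp [jetVariation]
  rw [h2]
  simp [Finset.sum_ite_eq]
  ring

/-! ### Upper totally symmetric perturbations -/

/-- Upper total symmetry of a family of highest order coefficients. -/
def UTS (q : SymbolIndex n m r → ℝ) : Prop :=
  ∀ (a : Fin m) (α α' : Fin (m + 1)) (β β' : Fin r → Fin n),
    List.Perm ((α : ℕ) :: List.ofFn fun i => (β i : ℕ))
      ((α' : ℕ) :: List.ofFn fun i => (β' i : ℕ)) → q (a, α, β) = q (a, α', β')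

/-- The symbol in row `a` given by the power of a linear form. -/
noncomputable def powSymbol (a : Fin m) (ℓ : ℕ → ℝ) : SymbolIndex n m r → ℝ := fun κ =>
  if κ.1 = a then ℓ κ.2.1 * ∏ t, ℓ (κ.2.2 t) else 0

/-- A coefficient is the product of `ℓ` over the whole index string, so every permutation preserves
it. Letting `ℓ` be a sequence on `ℕ` allows the same form to be evaluated at indices below `m + 1`
and below `n`. -/
theorem uts_powSymbol (a : Fin m) (ℓ : ℕ → ℝ) : UTS (powSymbol a ℓ : SymbolIndex n m r → ℝ) := by
  intro a' α α' β β' h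
  have := (h.map ℓ).prod_eq
  simp only [List.map_cons, List.prod_cons, List.map_ofFn, List.prod_ofFn, Function.comp] at this
  simp only [powSymbol, this]

/-- Pairing of a finite vector with a sequence. -/
noncomputable def pairing {k : ℕ} (v : Fin k → ℝ) : (ℕ → ℝ) →ₗ[ℝ] ℝ :=
  ∑ i, v i • LinearMap.proj (i : ℕ)

theorem pairing_apply {k : ℕ} (v : Fin k → ℝ) (ℓ : ℕ → ℝ) : pairing v ℓ = ∑ i, v i * ℓ i := by
  simp [pairing]

theorem pairing_single {k : ℕ} (v : Fin k → ℝ) (i : Fin k) :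
    pairing v (Pi.single (i : ℕ) 1) = v i := by
  simp [pairing_apply, Pi.single_apply, Fin.val_inj]

theorem jetVariation_powSymbol_symb (a : Fin m) (ℓ : ℕ → ℝ) (μ : Fin n → ℝ) (γ : Fin (m + 1)) :
    jetVariation (powSymbol a ℓ) μ 0 (symb a γ : JetRing n m r) =
      C (ℓ γ) * (∑ i : Fin n, C (ℓ i) * X (Sum.inr i)) ^ r := by
  rw [jetVariation_symb_zero, Fintype.sum_pow, Finset.mul_sum]
  refine Finset.sum_congr rfl fun β _ => ?_
  simp [powSymbol, Finset.prod_mul_distrib, mul_assoc]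

theorem ev_linearForm (y : Jet n m r) (ξ : Fin n → ℝ) (ℓ : ℕ → ℝ) :
    ev y ξ (∑ i : Fin n, C (ℓ i) * X (Sum.inr i)) = pairing ξ ℓ := by
  simp [ev, pairing_apply, mul_comm]

/-- The symbol matrices at a nonzero covector of upper totally symmetric symbols are arbitrary. -/
theorem exists_uts_symbol_eq {ξ : Fin n → ℝ} (hξ : ξ ≠ 0) (a : Fin m) (b : Fin (m + 1) → ℝ) :
    ∃ q : SymbolIndex n m r → ℝ, UTS q ∧ (∀ a' α β, a' ≠ a → q (a', α, β) = 0) ∧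
      ∀ γ, ∑ β : Fin r → Fin n, q (a, γ, β) * ∏ t, ξ (β t) = b γ := by
  let Q : Submodule ℝ (SymbolIndex n m r → ℝ) :=
    { carrier := {q | UTS q ∧ ∀ a' α β, a' ≠ a → q (a', α, β) = 0}
      add_mem' := fun {p q} hp hq =>
        ⟨fun a α α' β β' h => by simp [hp.1 a α α' β β' h, hq.1 a α α' β β' h],
          fun a' α β h => by simp [hp.2 a' α β h, hq.2 a' α β h]⟩
      zero_mem' := ⟨fun _ _ _ _ _ _ => rfl, fun _ _ _ _ => rfl⟩
      smul_mem' := fun c q hq =>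
        ⟨fun a α α' β β' h => by simp [hq.1 a α α' β β' h],
          fun a' α β h => by simp [hq.2 a' α β h]⟩ }
  let T : (SymbolIndex n m r → ℝ) →ₗ[ℝ] (Fin (m + 1) → ℝ) :=
    { toFun := fun q γ => ∑ β : Fin r → Fin n, q (a, γ, β) * ∏ t, ξ (β t)
      map_add' := fun p q => by ext γ; simp [add_mul, Finset.sum_add_distrib]
      map_smul' := fun c q => by ext γ; simp [Finset.mul_sum, mul_assoc] }
  suffices h : Q.map T = ⊤ by
    have hb : b ∈ Q.map T := by rw [h]; trivial
    obtain ⟨q, hq, rfl⟩ := hb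
    exact ⟨q, hq.1, hq.2, fun γ => rfl⟩
  have hpow : ∀ ℓ : ℕ → ℝ, (fun γ : Fin (m + 1) => ℓ γ * (pairing ξ ℓ) ^ r) ∈ Q.map T := by
    intro ℓ
    refine ⟨powSymbol a ℓ, ⟨uts_powSymbol a ℓ, fun a' α β h => by simp [powSymbol, h]⟩, ?_⟩
    ext γ
    simp only [T, LinearMap.coe_mk, AddHom.coe_mk, pairing_apply]
    rw [Fintype.sum_pow, Finset.mul_sum]
    refine Finset.sum_congr rfl fun β _ => ?_
    simp only [powSymbol, if_true, Finset.prod_mul_distrib]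
    ring
  have hpow' : ∀ ℓ : ℕ → ℝ, pairing ξ ℓ ≠ 0 → (fun γ : Fin (m + 1) => ℓ γ) ∈ Q.map T := by
    intro ℓ hℓ
    have := (Q.map T).smul_mem ((pairing ξ ℓ) ^ r)⁻¹ (hpow ℓ)
    convert this using 1
    ext γ
    have : (pairing ξ ℓ) ^ r ≠ 0 := pow_ne_zero _ hℓ
    simp only [Pi.smul_apply, smul_eq_mul]
    field_simp
  obtain ⟨i₀, hi₀⟩ := Function.ne_iff.1 hξ
  rw [eq_top_iff]
  intro c _
  let ℓ : ℕ → ℝ := fun k => if h : k < m + 1 then c ⟨k, h⟩ else 0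
  have hℓ : ∀ γ : Fin (m + 1), ℓ γ = c γ := fun γ => by simp only [ℓ, dif_pos γ.2]
  let e : ℕ → ℝ := Pi.single (i₀ : ℕ) 1
  have he : pairing ξ e ≠ 0 := by rw [pairing_single]; exact hi₀
  -- Powers of linear forms reach `ℓ` directly only if `ℓ` does not annihilate `ξ`. In general `ℓ`
  -- is a combination of `ℓ + s • e` and `e`, neither of which annihilates `ξ`.
  obtain ⟨s, hs⟩ : ∃ s : ℝ, pairing ξ (ℓ + s • e) ≠ 0 := by
    by_contra! h
    have h0 := h 0
    have h1 := h 1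
    simp only [zero_smul, add_zero, one_smul, map_add] at h0 h1
    exact he (by linarith)
  have := (Q.map T).sub_mem (hpow' _ hs) ((Q.map T).smul_mem s (hpow' _ he))
  convert this using 1
  ext γ
  simp [hℓ]

/-- A linear algebra fact used to see that the conditions are independent. -/
theorem eq_zero_of_forall_mul_add_mul {F : Type*} [AddCommGroup F] [Module ℝ F]
    (η ξ W d : F →ₗ[ℝ] ℝ) {ρ : ℝ} (hρ : ρ ≠ 0)
    (h : ∀ ℓ, ξ ℓ ≠ 0 → η ℓ * ξ ℓ + ρ * W ℓ * d ℓ = 0) {e ℓ₀ : F} (he : ξ e = 1) (hde : d e = 0)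
    (hξ : ξ ℓ₀ = 0) (hW : W ℓ₀ ≠ 0) : d = 0 ∧ η = 0 := by
  have key : ∀ b, ξ b = 0 → W b * d b = 0 := by
    intro b hb
    have ht : ∀ t : ℝ, t ≠ 0 → (η b + t * η e) * t + ρ * (W b + t * W e) * d b = 0 := by
      intro t ht
      have := h (b + t • e) (by simp [hb, he, ht])
      simpa [hb, he, hde] using this
    have h1 := ht 1 one_ne_zero
    have h2 := ht (-1) (by norm_num)
    have h3 := ht 2 (by norm_num)
    -- The relation is quadratic in `t`. The weights are those of Lagrange interpolation at `1, -1,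
    -- 2`, which recover its constant term.
    have : ρ * (W b * d b) = 0 := by linear_combination h1 + 1/3 * h2 - 1/3 * h3
    exact (mul_eq_zero.1 this).resolve_left hρ
  have h0 : d ℓ₀ = 0 := (mul_eq_zero.1 (key _ hξ)).resolve_left hW
  -- On the hyperplane `ξ = 0` the product of the linear forms `W` and `d` vanishes while `W` is not
  -- zero, so `d` vanishes there; it also vanishes on the complementary vector `e`.
  have hd : d = 0 := by
    ext b
    set b' := b - ξ b • e with hb'
    have hb0 : ξ b' = 0 := by simp [hb', he]
    have hdb : d b' = d b := by simp [hb', hde]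
    rw [LinearMap.zero_apply, ← hdb]
    by_contra hne
    have h1 := (mul_eq_zero.1 (key b' hb0)).resolve_right hne
    have h2 := key (b' + ℓ₀) (by simp [hb0, hξ])
    simp only [map_add, h1, h0, zero_add, add_zero] at h2
    exact (mul_ne_zero hW hne) h2
  refine ⟨hd, ?_⟩
  have hη : ∀ ℓ, ξ ℓ ≠ 0 → η ℓ = 0 := fun ℓ hℓ => by
    have := h ℓ hℓ
    rw [hd] at this
    simpa [hℓ] using this
  have hηe := hη e (by simp [he])
  ext b
  by_cases hb : ξ b = 0
  · have := hη (b + e) (by simp [hb, he])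
    simpa [hηe] using this
  · exact hη b hb

end UTSJets

/-! ### Bad jets -/

namespace UTSJets

open MvPolynomial

variable {n m r : ℕ}

/-- Rows and columns of a minor of the symbol matrix, together with one more row and two more
columns. -/
structure MinorData (m : ℕ) where
  size : Fin m
  rows : Fin size → Fin m
  cols : Fin size → Fin (m + 1)
  row : Fin m
  col₁ : Fin (m + 1)
  col₂ : Fin (m + 1)
  row_notMem : row ∉ range rows
  col₁_notMem : col₁ ∉ range cols
  col₂_notMem : col₂ ∉ range cols
  col_ne : col₁ ≠ col₂

namespace MinorData

instance : Finite (MinorData m) := by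
  let F : MinorData m → Σ ρ : Fin m, (Fin ρ → Fin m) × (Fin ρ → Fin (m + 1)) × Fin m ×
    Fin (m + 1) × Fin (m + 1) := fun c => ⟨c.size, c.rows, c.cols, c.row, c.col₁, c.col₂⟩
  refine Finite.of_injective F ?_
  rintro ⟨ρ, A, B, a, α, β, _, _, _, _⟩ ⟨ρ', A', B', a', α', β', _, _, _, _⟩ h
  simp only [F, Sigma.mk.injEq] at h
  obtain ⟨rfl, h⟩ := h
  simp only [heq_eq_eq, Prod.mk.injEq] at h
  obtain ⟨rfl, rfl, rfl, rfl, rfl⟩ := h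
  rfl

variable (c : MinorData m)

/-- The small minor. -/
noncomputable def det : JetRing n m r := minor c.rows c.cols

/-- The first bordered minor. -/
noncomputable def fst : JetRing n m r := minor (Fin.cons c.row c.rows) (Fin.cons c.col₁ c.cols)

/-- The second bordered minor. -/
noncomputable def snd : JetRing n m r := minor (Fin.cons c.row c.rows) (Fin.cons c.col₂ c.cols)

/-- Exchange of the two additional columns. -/
def swap : MinorData m where
  __ := c
  col₁ := c.col₂
  col₂ := c.col₁
  col₁_notMem := c.col₂_notMem
  col₂_notMem := c.col₁_notMem
  col_ne := c.col_ne.symm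

end MinorData

/-- Iterated derivatives with respect to the covector. -/
noncomputable def covDs (I : List (Fin n)) (p : JetRing n m r) : JetRing n m r :=
  I.foldr (fun k p => covD k p) p

theorem IsOrderZero.covDs {p : JetRing n m r} (hp : IsOrderZero p) (I : List (Fin n)) :
    IsOrderZero (UTSJets.covDs I p) := by
  induction I with
  | nil => exact hp
  | cons k I ih => exact ih.covD k

/-- Bad jets, first case, at the covector `ξ`. -/
structure IsBadAt (y : Jet n m r) (ξ : Fin n → ℝ) (c : MinorData m) (I : List (Fin n)) : Prop where
  ne_zero : ξ ≠ 0
  det_ne_zero : ev y ξ c.det ≠ 0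
  covD_ne_zero : ∃ k, ev y ξ (covD k (covDs I c.fst)) ≠ 0
  nil_or : I = [] ∨ ∀ k, ev y ξ (covD k c.snd) = 0
  chain : ∀ l ≤ 2 * n, ev y ξ (bracketChain (covDs I c.fst) c.snd l) = 0

/-- Bad jets, second case. -/
structure IsDegenerate (y : Jet n m r) (c : MinorData m) : Prop where
  fst_eq_zero : ∀ ξ, ev y ξ c.fst = 0
  snd_eq_zero : ∀ ξ, ev y ξ c.snd = 0
  exists_det_ne_zero : ∃ ξ, ξ ≠ 0 ∧ ev y ξ c.det ≠ 0

/-- Bad jets: those satisfying the conditions which the jets of an operator satisfy at a generic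
point of a characteristic submanifold. -/
def IsBad (y : Jet n m r) : Prop :=
  ∃ c : MinorData m, (∃ I ξ, IsBadAt y ξ c I) ∨ IsDegenerate y c

theorem ev_jetVariation_symb (y : Jet n m r) (ξ : Fin n → ℝ) (q : SymbolIndex n m r → ℝ)
    (μ : Fin n → ℝ) (a : Fin m) (γ : Fin (m + 1)) :
    ev y ξ (jetVariation q μ 0 (symb a γ)) = ∑ β : Fin r → Fin n, q (a, γ, β) * ∏ t, ξ (β t) := by
  rw [jetVariation_symb_zero]
  simp [ev]

/-- Independence of the conditions for bad jets of the first case. -/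
theorem IsBadAt.eq_zero_of_forall {y : Jet n m r} {ξ : Fin n → ℝ} {c : MinorData m}
    {I : List (Fin n)} (h : IsBadAt y ξ c I) (b : Fin (2 * n + 1) → ℝ)
    (hb : ∀ (q : SymbolIndex n m r → ℝ) (μ : Fin n → ℝ) (i : Fin (2 * n + 1)), UTS q →
      ∑ j : Fin (2 * n + 1), b j *
        ev y ξ (jetVariation q μ i (bracketChain (covDs I c.fst) c.snd j)) = 0) : b = 0 := by
  set φ : JetRing n m r := covDs I c.fst with hφdef
  have hφ : IsOrderZero φ := (isOrderZero_minor _ _).covDs I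
  have hg : IsOrderZero (c.snd : JetRing n m r) := isOrderZero_minor _ _
  obtain ⟨k₀, hk₀⟩ := h.covD_ne_zero
  -- Normalised so that each bracket contributes the factor `1`.
  let μ : Fin n → ℝ := Pi.single k₀ (ev y ξ (covD k₀ φ))⁻¹
  have hμ : ∑ k, μ k * ev y ξ (covD k φ) = 1 := by
    rw [Finset.sum_eq_single k₀]
    · simp only [μ, Pi.single_eq_same]; exact inv_mul_cancel₀ hk₀
    · intro k _ hk; simp [μ, hk]
    · simp
  -- A variation that, at `ξ`, changes only the entry in row `c.row` and column `c.col₂`. It leaves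
  -- `c.fst` unchanged, that column not being one of its columns, and changes `c.snd` by the small
  -- minor.
  obtain ⟨q, hq, hqa, hqT⟩ := exists_uts_symbol_eq (r := r) h.ne_zero c.row (Pi.single c.col₂ 1)
  have hT : ∀ γ, ev y ξ (jetVariation q μ 0 (symb c.row γ)) =
      (Pi.single c.col₂ (1 : ℝ) : Fin (m + 1) → ℝ) γ := by
    intro γ; rw [ev_jetVariation_symb, hqT]
  have hf0 : ev y ξ (jetVariation q μ 0 c.fst) = 0 := by
    rw [MinorData.fst, jetVariation_minor_cons _ _ c.row_notMem _ _ hqa, map_sum]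
    refine Finset.sum_eq_zero fun γ _ => ?_
    rw [map_mul, hT]
    by_cases hγ : γ = c.col₂
    · subst hγ
      rw [cof_of_ne _ _ c.col₂_notMem c.col_ne]; simp
    · simp [hγ]
  have hg0 : ev y ξ (jetVariation q μ 0 c.snd) = ev y ξ c.det := by
    rw [MinorData.snd, jetVariation_minor_cons _ _ c.row_notMem _ _ hqa, map_sum,
      Finset.sum_eq_single c.col₂]
    · rw [map_mul, hT, cof_self _ _ c.col₂_notMem]; simp [MinorData.det]
    · intro γ _ hγ
      rw [map_mul, hT]; simp [hγ]
    · simp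
  have hor : ev y ξ (jetVariation q μ 0 φ) = 0 ∨ ∀ k, ev y ξ (covD k c.snd) = 0 := by
    rcases h.nil_or with rfl | h'
    · exact Or.inl hf0
    · exact Or.inr h'
  have hdiag : ∀ l, ev y ξ (jetVariation q μ l (bracketChain φ c.snd l)) ≠ 0 := by
    intro l
    rw [ev_jetVariation_bracketChain hφ hg hor, hμ, one_pow, one_mul, hg0]
    exact h.det_ne_zero
  -- The matrix indexed by the order `i` of the variation and the place `j` in the chain is
  -- triangular with nonzero diagonal. The coefficients are eliminated downwards from `i = 2 * n`,
  -- `d` being the distance from the top.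
  have key : ∀ d : ℕ, ∀ i : Fin (2 * n + 1), 2 * n ≤ i + d → b i = 0 := by
    intro d
    induction d with
    | zero =>
      intro i hi
      have := hb q μ i hq
      rw [Finset.sum_eq_single i] at this
      · exact (mul_eq_zero.1 this).resolve_right (hdiag i)
      · intro j _ hj
        rw [jetVariation_bracketChain_of_lt hφ hg j i (by
          have := Fin.val_ne_of_ne hj; omega)]
        simp
      · simp
    | succ d ih =>
      intro i hi
      have := hb q μ i hq
      rw [Finset.sum_eq_single i] at this
      · exact (mul_eq_zero.1 this).resolve_right (hdiag i)
      · intro j _ hj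
        rcases lt_or_gt_of_ne hj with hlt | hlt
        · rw [jetVariation_bracketChain_of_lt hφ hg j i hlt]
          simp
        · rw [ih j (by have : (i : ℕ) < j := hlt; omega)]; simp
      · simp
  funext i
  exact key (2 * n) i (by omega)

/-- The conditions for degenerate jets at a covector whose component `i₀` is nonzero. -/
noncomputable def degenerateConditions (c : MinorData m) (i₀ : Fin n) :
    Option (Fin n) → JetRing n m r
  | none => c.fst
  | some i => if i = i₀ then c.snd else covD i c.snd

/-- Independence of the conditions for degenerate jets. -/
theorem eq_zero_of_forall_degenerateConditions (hr : 1 ≤ r) {y : Jet n m r} {ξ : Fin n → ℝ}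
    {c : MinorData m} {i₀ : Fin n} (hi₀ : ξ i₀ ≠ 0) (hdet : ev y ξ c.det ≠ 0) {ℓ₀ : ℕ → ℝ}
    (hξ : pairing ξ ℓ₀ = 0)
    (hℓ₀ : pairing (fun γ => ev y ξ (cof c.rows c.cols c.col₂ γ)) ℓ₀ ≠ 0)
    (b : Option (Fin n) → ℝ)
    (hb : ∀ (q : SymbolIndex n m r → ℝ), UTS q →
      ∑ j, b j * ev y ξ (jetVariation q 0 0 (degenerateConditions c i₀ j)) = 0) : b = 0 := by
  set v : Fin (m + 1) → ℝ := fun γ => ev y ξ (cof c.rows c.cols c.col₁ γ) with hv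
  set w : Fin (m + 1) → ℝ := fun γ => ev y ξ (cof c.rows c.cols c.col₂ γ) with hw
  let dw : Fin n → Fin (m + 1) → ℝ := fun i γ => ev y ξ (covD i (cof c.rows c.cols c.col₂ γ))
  have hq0 : ∀ ℓ, ∀ a' (α : Fin (m + 1)) (β : Fin r → Fin n), a' ≠ c.row →
      powSymbol c.row ℓ (a', α, β) = 0 := fun ℓ a' α β h => by simp [powSymbol, h]
  have hfst : ∀ ℓ, ev y ξ (jetVariation (powSymbol c.row ℓ) 0 0 c.fst) =
      pairing v ℓ * (pairing ξ ℓ) ^ r := by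
    intro ℓ
    rw [MinorData.fst, jetVariation_minor_cons _ _ c.row_notMem _ _ (hq0 ℓ), map_sum,
      pairing_apply v, Finset.sum_mul]
    refine Finset.sum_congr rfl fun γ _ => ?_
    rw [jetVariation_powSymbol_symb, map_mul, map_mul, map_pow, ev_linearForm]
    simp [hv, ev]; ring
  have hsnd' : ∀ ℓ, jetVariation (powSymbol c.row ℓ) 0 0 (c.snd : JetRing n m r) =
      ∑ γ, cof c.rows c.cols c.col₂ γ * (C (ℓ γ) * (∑ i : Fin n, C (ℓ i) * X (Sum.inr i)) ^ r) := by
    intro ℓ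
    rw [MinorData.snd, jetVariation_minor_cons _ _ c.row_notMem _ _ (hq0 ℓ)]
    refine Finset.sum_congr rfl fun γ _ => ?_
    rw [jetVariation_powSymbol_symb]
  have hsnd : ∀ ℓ, ev y ξ (jetVariation (powSymbol c.row ℓ) 0 0 c.snd) =
      pairing w ℓ * (pairing ξ ℓ) ^ r := by
    intro ℓ
    rw [hsnd', map_sum, pairing_apply w, Finset.sum_mul]
    refine Finset.sum_congr rfl fun γ _ => ?_
    rw [map_mul, map_mul, map_pow, ev_linearForm]
    simp [hw, ev]; ring
  have hlin : ∀ (ℓ : ℕ → ℝ) (i : Fin n),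
      covD i (∑ i : Fin n, C (ℓ i) * X (Sum.inr i) : JetRing n m r) = C (ℓ i) := by
    intro ℓ i
    rw [map_sum, Finset.sum_eq_single i]
    · rw [Derivation.leibniz, covD_inr]; simp [covD]
    · intro j _ hj
      rw [Derivation.leibniz, covD_inr]; simp [covD, hj]
    · simp
  have hdsnd : ∀ ℓ i, ev y ξ (jetVariation (powSymbol c.row ℓ) 0 0 (covD i c.snd)) =
      pairing (dw i) ℓ * (pairing ξ ℓ) ^ r + pairing w ℓ * (r * (pairing ξ ℓ) ^ (r - 1) * ℓ i) := by
    intro ℓ i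
    rw [jetVariation_covD, hsnd', map_sum, map_sum, pairing_apply w, pairing_apply (dw i),
      Finset.sum_mul, Finset.sum_mul, ← Finset.sum_add_distrib]
    refine Finset.sum_congr rfl fun γ _ => ?_
    rw [Derivation.leibniz, Derivation.leibniz, Derivation.leibniz_pow, hlin]
    have hC : covD i (C (ℓ γ) : JetRing n m r) = 0 := by simp [covD]
    have hE : ∀ x : ℝ, ev y ξ (C x) = x := fun x => by simp [ev]
    rw [hC]
    simp only [smul_eq_mul, map_add, map_mul, map_pow, ev_linearForm, nsmul_eq_mul, hE, mul_zero,
      add_zero, map_natCast, dw, hw]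
    ring
  -- the relation, divided by a power of `pairing ξ ℓ`
  let e : ℕ → ℝ := (ξ i₀)⁻¹ • Pi.single (i₀ : ℕ) 1
  -- The slot `i₀` is occupied by `c.snd` itself and not by a derivative. Hence `d'` vanishes on
  -- `e`, as the linear algebra lemma requires.
  let d' : Fin n → ℝ := fun i => if i = i₀ then 0 else b (some i)
  let η : (ℕ → ℝ) →ₗ[ℝ] ℝ :=
    b none • pairing v + b (some i₀) • pairing w + ∑ i, d' i • pairing (dw i)
  have hrel : ∀ ℓ, pairing ξ ℓ ≠ 0 →
      η ℓ * pairing ξ ℓ + r * pairing w ℓ * pairing d' ℓ = 0 := by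
    intro ℓ hℓ
    have h1 := hb _ (uts_powSymbol c.row ℓ)
    rw [Fintype.sum_option] at h1
    have h2 : ∀ i, b (some i) *
        ev y ξ (jetVariation (powSymbol c.row ℓ) 0 0 (degenerateConditions c i₀ (some i))) =
        (if i = i₀ then b (some i₀) * (pairing w ℓ * (pairing ξ ℓ) ^ r) else 0) +
        (d' i * pairing (dw i) ℓ * (pairing ξ ℓ) ^ r +
          d' i * ℓ i * (r * pairing w ℓ * (pairing ξ ℓ) ^ (r - 1))) := by
      intro i
      by_cases hi : i = i₀
      · subst hi
        simp [degenerateConditions, d', hsnd]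
      · simp only [degenerateConditions, d', hi, if_false, hdsnd]
        ring
    simp only [h2, Finset.sum_add_distrib, ← Finset.sum_mul] at h1
    simp only [degenerateConditions, hfst, Finset.sum_ite_eq', Finset.mem_univ, if_true] at h1
    rw [← pairing_apply d' ℓ] at h1
    obtain ⟨r', rfl⟩ : ∃ r', r = r' + 1 := ⟨r - 1, by omega⟩
    simp only [Nat.add_sub_cancel] at h1
    have h3 : (pairing ξ ℓ) ^ r' ≠ 0 := pow_ne_zero _ hℓ
    refine (mul_eq_zero.1 ?_).resolve_left h3
    rw [← h1]
    simp only [η, LinearMap.add_apply, LinearMap.smul_apply, LinearMap.sum_apply, smul_eq_mul]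
    ring
  obtain ⟨hd, hη⟩ := eq_zero_of_forall_mul_add_mul η (pairing ξ) (pairing w) (pairing d')
    (show (r : ℝ) ≠ 0 by positivity) hrel (e := e)
    (by rw [map_smul, pairing_single]; simp [hi₀])
    (by rw [map_smul, pairing_single]; simp [d']) hξ hℓ₀
  have hd0 : ∀ i, d' i = 0 := fun i => by rw [← pairing_single d' i, hd]; rfl
  have hη' : ∀ ℓ, b none * pairing v ℓ + b (some i₀) * pairing w ℓ = 0 := by
    intro ℓ
    have := LinearMap.congr_fun hη ℓ
    simpa [η, hd0] using this
  -- At the unit vectors of `c.col₁` and `c.col₂` the forms `v` and `w` take the values `(det, 0)`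
  -- and `(0, det)`, so the two remaining coefficients separate.
  have hb0 : b none = 0 := by
    have := hη' (Pi.single (c.col₁ : ℕ) 1)
    rw [pairing_single, pairing_single] at this
    simp only [hv, hw, cof_self _ _ c.col₁_notMem, cof_of_ne _ _ c.col₁_notMem c.col_ne.symm,
      map_zero, mul_zero, add_zero] at this
    exact (mul_eq_zero.1 this).resolve_right hdet
  have hb1 : b (some i₀) = 0 := by
    have := hη' (Pi.single (c.col₂ : ℕ) 1)
    rw [pairing_single, pairing_single] at this
    simp only [hv, hw, cof_self _ _ c.col₂_notMem, cof_of_ne _ _ c.col₂_notMem c.col_ne,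
      map_zero, mul_zero, zero_add] at this
    exact (mul_eq_zero.1 this).resolve_right hdet
  funext j
  rcases j with _ | i
  · exact hb0
  · by_cases hi : i = i₀
    · rw [hi]; exact hb1
    · simpa [d', hi] using hd0 i

/-- One of the two cofactor covectors is not proportional to `ξ`. -/
theorem exists_pairing_cof_ne_zero {y : Jet n m r} {ξ : Fin n → ℝ} {c : MinorData m}
    {i₀ : Fin n} (hi₀ : ξ i₀ ≠ 0) (hdet : ev y ξ c.det ≠ 0) :
    ∃ ℓ₀ : ℕ → ℝ, pairing ξ ℓ₀ = 0 ∧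
      (pairing (fun γ => ev y ξ (cof c.rows c.cols c.col₂ γ)) ℓ₀ ≠ 0 ∨
      pairing (fun γ => ev y ξ (cof c.rows c.cols c.col₁ γ)) ℓ₀ ≠ 0) := by
  by_contra! hcon
  set v : Fin (m + 1) → ℝ := fun γ => ev y ξ (cof c.rows c.cols c.col₁ γ) with hv
  set w : Fin (m + 1) → ℝ := fun γ => ev y ξ (cof c.rows c.cols c.col₂ γ) with hw
  let e : ℕ → ℝ := (ξ i₀)⁻¹ • Pi.single (i₀ : ℕ) 1
  have he : pairing ξ e = 1 := by rw [map_smul, pairing_single]; simp [hi₀]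
  -- Otherwise both cofactor forms would be multiples of `ξ`. This is impossible: their values on
  -- the unit vectors of `c.col₁` and `c.col₂` form the nonzero minor times an invertible matrix, so
  -- they are linearly independent.
  have h : ∀ ℓ, pairing w ℓ = pairing ξ ℓ * pairing w e ∧
      pairing v ℓ = pairing ξ ℓ * pairing v e := by
    intro ℓ
    have := hcon (ℓ - pairing ξ ℓ • e) (by simp [he])
    simp only [map_sub, map_smul, smul_eq_mul] at this
    exact ⟨by linarith [this.1], by linarith [this.2]⟩
  have h1 := h (Pi.single (c.col₁ : ℕ) 1)
  have h2 := h (Pi.single (c.col₂ : ℕ) 1)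
  simp only [pairing_single v, pairing_single w] at h1 h2
  simp only [hv, hw, cof_self _ _ c.col₁_notMem, cof_of_ne _ _ c.col₁_notMem c.col_ne.symm,
    cof_self _ _ c.col₂_notMem, cof_of_ne _ _ c.col₂_notMem c.col_ne, map_zero] at h1 h2
  rw [← hv, ← hw] at h1 h2
  have h3 : pairing ξ (Pi.single (c.col₁ : ℕ) 1) ≠ 0 := fun h0 => by
    rw [h0, zero_mul, zero_mul] at h1; exact hdet h1.2
  have h4 : pairing w e = 0 := (mul_eq_zero.1 h1.1.symm).resolve_left h3
  rw [h4, mul_zero] at h2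
  exact hdet h2.1

end UTSJets

/-! ### Polynomial symbols and their jets -/

namespace UTSJets

open MvPolynomial

/-! ### Iterated partial derivatives of polynomials along words. -/

section Pderivs

variable {σ : Type*}

/-- Iterated partial derivatives along a word. -/
noncomputable def pderivs (w : List σ) (p : MvPolynomial σ ℝ) : MvPolynomial σ ℝ :=
  w.foldr (fun k p => pderiv k p) p

@[simp] theorem pderivs_nil (p : MvPolynomial σ ℝ) : pderivs [] p = p := rfl

@[simp] theorem pderivs_cons (k : σ) (w : List σ) (p : MvPolynomial σ ℝ) :
    pderivs (k :: w) p = pderiv k (pderivs w p) := rfl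

theorem pderivs_append (w w' : List σ) (p : MvPolynomial σ ℝ) :
    pderivs (w ++ w') p = pderivs w (pderivs w' p) := by
  induction w with
  | nil => rfl
  | cons k w ih => simp [ih]

theorem pderivs_add (w : List σ) (p q : MvPolynomial σ ℝ) :
    pderivs w (p + q) = pderivs w p + pderivs w q := by
  induction w with
  | nil => rfl
  | cons k w ih => simp [ih]

theorem pderivs_smul (w : List σ) (c : ℝ) (p : MvPolynomial σ ℝ) :
    pderivs w (c • p) = c • pderivs w p := by
  induction w with
  | nil => rfl
  | cons k w ih => simp [ih]

theorem pderivs_sum {ι : Type*} (s : Finset ι) (w : List σ) (p : ι → MvPolynomial σ ℝ) :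
    pderivs w (∑ i ∈ s, p i) = ∑ i ∈ s, pderivs w (p i) := by
  induction w with
  | nil => rfl
  | cons k w ih => simp [ih]

theorem eq_C_of_totalDegree_eq_zero' {p : MvPolynomial σ ℝ} (h : p.totalDegree = 0) :
    ∃ c, p = C c := ⟨_, totalDegree_eq_zero_iff_eq_C.1 h⟩

theorem totalDegree_pderiv_le (k : σ) (p : MvPolynomial σ ℝ) :
    (pderiv k p).totalDegree ≤ p.totalDegree - 1 := by
  refine Finset.sup_le fun s hs => ?_
  rw [mem_support_iff, coeff_pderiv] at hs
  have h1 : s + Finsupp.single k 1 ∈ p.support := mem_support_iff.2 (left_ne_zero_of_mul hs)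
  have h2 := le_totalDegree h1
  rw [Finsupp.sum_add_index' (fun _ => rfl) (fun _ _ _ => rfl), Finsupp.sum_single_index rfl] at h2
  omega

theorem pderivs_eq_zero_of_totalDegree_lt (w : List σ) (p : MvPolynomial σ ℝ)
    (h : p.totalDegree < w.length) : pderivs w p = 0 := by
  have key : ∀ w : List σ, pderivs w p = 0 ∨
      (pderivs w p).totalDegree + w.length ≤ p.totalDegree := by
    intro w
    induction w with
    | nil => right; simp
    | cons k w ih =>
      rcases ih with ih | ih
      · left; simp [ih]
      · rcases Nat.eq_zero_or_pos (pderivs w p).totalDegree with h0 | h0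
        · obtain ⟨c, hc⟩ := eq_C_of_totalDegree_eq_zero' h0
          left; simp [hc]
        · right
          have := totalDegree_pderiv_le k (pderivs w p)
          simp only [pderivs_cons, List.length_cons]
          omega
  rcases key w with h' | h'
  · exact h'
  · omega

theorem eq_C_of_pderiv_eq_zero {p : MvPolynomial σ ℝ} (h : ∀ k, pderiv k p = 0) :
    ∃ c, p = C c := by
  refine ⟨coeff 0 p, ?_⟩
  classical
  ext s
  rw [coeff_C]
  split_ifs with hs
  · rw [hs]
  · obtain ⟨k, hk⟩ := Finsupp.ne_iff.1 (Ne.symm hs)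
    have h1 : s - Finsupp.single k 1 + Finsupp.single k 1 = s := by
      refine tsub_add_cancel_of_le ?_
      rw [Finsupp.single_le_iff]
      exact Nat.one_le_iff_ne_zero.2 hk
    have h2 := coeff_pderiv (i := k) p (s - Finsupp.single k 1)
    rw [h k, coeff_zero, h1] at h2
    exact (mul_eq_zero.1 h2.symm).resolve_right (by positivity)

/-- A polynomial all of whose derivatives vanish at a point is zero. -/
theorem eq_zero_of_forall_eval_pderivs (x : σ → ℝ) (p : MvPolynomial σ ℝ)
    (h : ∀ w, eval x (pderivs w p) = 0) : p = 0 := by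
  induction hN : p.totalDegree using Nat.strong_induction_on generalizing p with
  | _ N ih =>
    have hconst : ∃ c, p = C c := by
      rcases Nat.eq_zero_or_pos N with h0 | h0
      · exact eq_C_of_totalDegree_eq_zero' (hN.trans h0)
      · refine eq_C_of_pderiv_eq_zero fun k => ih (pderiv k p).totalDegree ?_ _ ?_ rfl
        · have := totalDegree_pderiv_le k p
          omega
        · intro w
          have := h (w ++ [k])
          rwa [pderivs_append] at this
    obtain ⟨c, rfl⟩ := hconst
    have := h []
    simp only [pderivs_nil, eval_C] at this
    rw [this, C_0]

end Pderivs

variable {n m r : ℕ}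

/-- Families of polynomial coefficients. -/
abbrev PolySymbol (n m r : ℕ) : Type := SymbolIndex n m r → MvPolynomial (Fin n) ℝ

/-- The jet of a polynomial symbol at a point. -/
noncomputable def polyJet (P : PolySymbol n m r) (x : Fin n → ℝ) : Jet n m r :=
  fun κ w => eval x (pderivs w (P κ))

theorem polyJet_add (P Q : PolySymbol n m r) (x : Fin n → ℝ) :
    polyJet (P + Q) x = polyJet P x + polyJet Q x := by
  funext κ w; simp [polyJet, pderivs_add]

/-- Upper total symmetry for polynomial symbols. -/
def PolyUTS (P : PolySymbol n m r) : Prop :=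
  ∀ (a : Fin m) (α α' : Fin (m + 1)) (β β' : Fin r → Fin n),
    List.Perm ((α : ℕ) :: List.ofFn fun i => (β i : ℕ))
      ((α' : ℕ) :: List.ofFn fun i => (β' i : ℕ)) → P (a, α, β) = P (a, α', β')

/-- Upper totally symmetric polynomial symbols of degree at most `s`. -/
def utsPoly (n m r s : ℕ) : Submodule ℝ (PolySymbol n m r) where
  carrier := {P | PolyUTS P ∧ ∀ κ, (P κ).totalDegree ≤ s}
  add_mem' := fun {P Q} hP hQ =>
    ⟨fun a α α' β β' h => by simp [hP.1 a α α' β β' h, hQ.1 a α α' β β' h],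
      fun κ => (totalDegree_add _ _).trans (max_le (hP.2 κ) (hQ.2 κ))⟩
  zero_mem' := ⟨fun _ _ _ _ _ _ => rfl, fun _ => by simp⟩
  smul_mem' := fun c P hP =>
    ⟨fun a α α' β β' h => by simp [hP.1 a α α' β β' h],
      fun κ => (totalDegree_smul_le _ _).trans (hP.2 κ)⟩

instance (s : ℕ) : Module.Finite ℝ (utsPoly n m r s) := by
  let F : utsPoly n m r s →ₗ[ℝ] (SymbolIndex n m r → restrictTotalDegree (Fin n) ℝ s) :=
    { toFun := fun P κ => ⟨P.1 κ, (mem_restrictTotalDegree _ _ _).2 (P.2.2 κ)⟩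
      map_add' := fun _ _ => rfl
      map_smul' := fun _ _ => rfl }
  refine Module.Finite.of_injective F fun P Q h => ?_
  ext1
  funext κ
  exact congrArg Subtype.val (congrFun h κ)

/-- Jets of smooth upper totally symmetric symbols. -/
structure IsAdmissible (y : Jet n m r) : Prop where
  perm : ∀ κ w w', List.Perm w w' → y κ w = y κ w'
  uts : ∀ w, UTS fun κ => y κ w

theorem pderivs_perm {w w' : List (Fin n)} (h : List.Perm w w') (p : MvPolynomial (Fin n) ℝ) :
    pderivs w p = pderivs w' p := by
  induction h with
  | nil => rfl
  | cons k _ ih => simp [ih]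
  | swap k l w =>
    simp only [pderivs_cons]
    ext s
    simp only [coeff_pderiv]
    classical
    by_cases hkl : k = l
    · subst hkl; ring
    · simp only [Finsupp.coe_add, Pi.add_apply, Finsupp.single_apply, if_neg hkl,
        if_neg (Ne.symm hkl), add_zero]
      rw [add_right_comm]
      ring
  | trans _ _ h1 h2 => exact h1.trans h2

theorem isAdmissible_polyJet {P : PolySymbol n m r} (hP : PolyUTS P) (x : Fin n → ℝ) :
    IsAdmissible (polyJet P x) :=
  ⟨fun κ w w' h => by simp only [polyJet, pderivs_perm h], fun w a α α' β β' h => by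
    simp only [polyJet, hP a α α' β β' h]⟩

/-- The homogeneous Taylor polynomial of degree `l` at `x` with derivatives `h`. -/
noncomputable def taylorPart (x : Fin n → ℝ) : ℕ → (List (Fin n) → ℝ) → MvPolynomial (Fin n) ℝ
  | 0, h => C (h [])
  | l + 1, h => C ((l + 1 : ℝ)⁻¹) *
      ∑ k, (X k - C (x k)) * taylorPart x l fun w => h (k :: w)

theorem totalDegree_taylorPart (x : Fin n → ℝ) (l : ℕ) (h : List (Fin n) → ℝ) :
    (taylorPart x l h).totalDegree ≤ l := by
  induction l generalizing h with
  | zero => simp [taylorPart]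
  | succ l ih =>
    refine (totalDegree_mul _ _).trans ?_
    rw [totalDegree_C, zero_add]
    refine totalDegree_finsetSum_le fun k _ => (totalDegree_mul _ _).trans ?_
    have h1 : (X k - C (x k) : MvPolynomial (Fin n) ℝ).totalDegree ≤ 1 :=
      (totalDegree_sub _ _).trans (by simp)
    have := ih fun w => h (k :: w)
    omega

/-- The product rule gives one term from the linear factor with index `k`. By symmetry of `h` in the
letters, the other terms reassemble into `l` copies of the right-hand side; the total `l + 1`
cancels the normalising factor. -/
theorem pderiv_taylorPart_succ (x : Fin n → ℝ) (l : ℕ) (h : List (Fin n) → ℝ)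
    (hh : ∀ w w', List.Perm w w' → h w = h w') (k : Fin n) :
    pderiv k (taylorPart x (l + 1) h) = taylorPart x l fun w => h (k :: w) := by
  induction l generalizing h k with
  | zero =>
    simp only [taylorPart, map_sum, Derivation.leibniz, pderiv_C, map_sub, sub_zero, smul_eq_mul]
    rw [Finset.sum_eq_single k]
    · simp
    · intro j _ hj; rw [pderiv_X_of_ne hj]; simp
    · simp
  | succ l ih =>
    have h1 : ∀ j, pderiv k (taylorPart x (l + 1) fun w => h (j :: w)) =
        taylorPart x l fun w => h (k :: j :: w) := by
      intro j
      rw [ih (fun w => h (j :: w)) (fun w w' hw => hh _ _ (hw.cons j)) k]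
      congr 1
      funext w
      exact hh _ _ (List.Perm.swap _ _ _)
    rw [taylorPart, pderiv_C_mul, map_sum]
    simp only [Derivation.leibniz, h1, map_sub, pderiv_C, sub_zero, smul_eq_mul]
    rw [Finset.sum_add_distrib, Finset.sum_eq_single (a := k) (f := fun j =>
      (taylorPart x (l + 1) fun w => h (j :: w)) * pderiv k (X j))]
    · have h2 : ∑ j, (X j - C (x j)) * (taylorPart x l fun w => h (k :: j :: w)) =
          C (l + 1 : ℝ) * taylorPart x (l + 1) fun w => h (k :: w) := by
        rw [taylorPart, ← mul_assoc, ← C_mul, mul_inv_cancel₀ (by positivity), C_1, one_mul]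
      rw [h2, pderiv_X_self, mul_one]
      have : C ((l + 1 : ℕ) + 1 : ℝ)⁻¹ * (C (l + 1 : ℝ) + C 1) = (1 : MvPolynomial (Fin n) ℝ) := by
        rw [← C_add, ← C_mul, ← C_1]
        congr 1
        push_cast
        exact inv_mul_cancel₀ (by positivity)
      rw [C_1] at this
      linear_combination (taylorPart x (l + 1) fun w => h (k :: w)) * this
    · intro j _ hj; rw [pderiv_X_of_ne hj]; simp
    · simp

theorem pderivs_taylorPart (x : Fin n → ℝ) (h : List (Fin n) → ℝ)
    (hh : ∀ w w', List.Perm w w' → h w = h w') (w : List (Fin n)) (l : ℕ) :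
    pderivs w (taylorPart x (l + w.length) h) = taylorPart x l fun u => h (u ++ w) := by
  induction w generalizing l with
  | nil => simp
  | cons k w ih =>
    rw [pderivs_cons, List.length_cons, ← add_assoc, add_right_comm, ih (l + 1),
      pderiv_taylorPart_succ _ _ _ (fun u u' hu => hh _ _ (hu.append_right w))]
    congr 1
    funext u
    exact hh _ _ List.perm_middle.symm

theorem eval_pderivs_taylorPart (x : Fin n → ℝ) (h : List (Fin n) → ℝ)
    (hh : ∀ w w', List.Perm w w' → h w = h w') (w : List (Fin n)) (l : ℕ) :
    eval x (pderivs w (taylorPart x l h)) = if l = w.length then h w else 0 := by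
  split_ifs with hl
  · subst hl
    have := pderivs_taylorPart x h hh w 0
    rw [zero_add] at this
    rw [this]
    simp [taylorPart]
  · rcases lt_or_gt_of_ne hl with hlt | hlt
    · rw [pderivs_eq_zero_of_totalDegree_lt _ _ ((totalDegree_taylorPart x l h).trans_lt hlt),
        map_zero]
    · obtain ⟨d, rfl⟩ : ∃ d, l = (d + 1) + w.length := ⟨l - w.length - 1, by omega⟩
      rw [pderivs_taylorPart x h hh]
      simp [taylorPart]

/-- Every admissible jet is, up to order `s`, the jet of an upper totally symmetric polynomial
symbol of degree at most `s`. -/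
theorem exists_utsPoly_polyJet_eq {y : Jet n m r} (hy : IsAdmissible y) (s : ℕ) (x : Fin n → ℝ) :
    ∃ P ∈ utsPoly n m r s, ∀ κ w, w.length ≤ s → polyJet P x κ w = y κ w := by
  refine ⟨fun κ => ∑ l ∈ Finset.range (s + 1), taylorPart x l (y κ), ⟨?_, ?_⟩, ?_⟩
  · intro a α α' β β' h
    have : y (a, α, β) = y (a, α', β') := funext fun w => hy.uts w a α α' β β' h
    simp only [this]
  · intro κ
    refine totalDegree_finsetSum_le fun l hl => (totalDegree_taylorPart x l _).trans ?_
    exact Nat.lt_succ_iff.1 (Finset.mem_range.1 hl)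
  · intro κ w hw
    simp only [polyJet, pderivs_sum, map_sum, eval_pderivs_taylorPart x (y κ) (hy.perm κ)]
    rw [Finset.sum_ite_eq' , if_pos (Finset.mem_range.2 (by omega))]

/-! ### Order of polynomials in jets -/

/-- Polynomials in the derivatives up to order `l`. -/
noncomputable def orderLE (n m r l : ℕ) : Subalgebra ℝ (JetRing n m r) :=
  Algebra.adjoin ℝ {p | (∃ κ w, List.length w ≤ l ∧ p = X (Sum.inl (κ, w))) ∨
    ∃ i, p = X (Sum.inr i)}

theorem orderLE_mono {l l' : ℕ} (h : l ≤ l') : orderLE n m r l ≤ orderLE n m r l' := by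
  refine Algebra.adjoin_mono ?_
  rintro p (⟨κ, w, hw, rfl⟩ | h')
  · exact Or.inl ⟨κ, w, hw.trans h, rfl⟩
  · exact Or.inr h'

theorem derivation_mem_orderLE {l l' : ℕ} (hl : l ≤ l')
    (d : Derivation ℝ (JetRing n m r) (JetRing n m r))
    (h1 : ∀ κ w, List.length w ≤ l → d (X (Sum.inl (κ, w))) ∈ orderLE n m r l')
    (h2 : ∀ i, d (X (Sum.inr i)) ∈ orderLE n m r l') {p : JetRing n m r}
    (hp : p ∈ orderLE n m r l) : d p ∈ orderLE n m r l' := by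
  induction hp using Algebra.adjoin_induction with
  | mem p hp =>
    rcases hp with ⟨κ, w, hw, rfl⟩ | ⟨i, rfl⟩
    · exact h1 κ w hw
    · exact h2 i
  | algebraMap c => rw [Derivation.map_algebraMap]; exact zero_mem _
  | add p q _ _ hp hq => rw [map_add]; exact add_mem hp hq
  | mul p q hp' hq' hp hq =>
    rw [Derivation.leibniz]
    exact add_mem (mul_mem (orderLE_mono hl hp') hq) (mul_mem (orderLE_mono hl hq') hp)

theorem covD_mem_orderLE {l : ℕ} (k : Fin n) {p : JetRing n m r} (hp : p ∈ orderLE n m r l) :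
    covD k p ∈ orderLE n m r l := by
  refine derivation_mem_orderLE le_rfl _ (fun κ w _ => ?_) (fun i => ?_) hp
  · rw [covD_inl]; exact zero_mem _
  · rw [covD_inr]; split_ifs
    · exact one_mem _
    · exact zero_mem _

theorem totalD_mem_orderLE {l : ℕ} (k : Fin n) {p : JetRing n m r} (hp : p ∈ orderLE n m r l) :
    totalD k p ∈ orderLE n m r (l + 1) := by
  refine derivation_mem_orderLE (Nat.le_succ l) _ (fun κ w hw => ?_) (fun i => ?_) hp
  · rw [totalD_inl]
    exact Algebra.subset_adjoin (Or.inl ⟨κ, k :: w, by simpa using hw, rfl⟩)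
  · rw [totalD_inr]; exact zero_mem _

theorem minor_mem_orderLE {ρ : ℕ} (A : Fin ρ → Fin m) (B : Fin ρ → Fin (m + 1)) :
    (minor A B : JetRing n m r) ∈ orderLE n m r 0 := by
  rw [minor, Matrix.det_apply]
  refine sum_mem fun σ _ => ?_
  rw [Units.smul_def]
  refine zsmul_mem (prod_mem fun i _ => ?_) _
  simp only [Matrix.submatrix_apply, symb, Matrix.of_apply]
  refine sum_mem fun β _ => mul_mem ?_ (prod_mem fun t _ => ?_)
  · exact Algebra.subset_adjoin (Or.inl ⟨_, _, le_rfl, rfl⟩)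
  · exact Algebra.subset_adjoin (Or.inr ⟨_, rfl⟩)

theorem covDs_mem_orderLE {l : ℕ} (I : List (Fin n)) {p : JetRing n m r}
    (hp : p ∈ orderLE n m r l) : covDs I p ∈ orderLE n m r l := by
  induction I with
  | nil => exact hp
  | cons k I ih => exact covD_mem_orderLE k ih

theorem bracketChain_mem_orderLE {φ g : JetRing n m r} (hφ : φ ∈ orderLE n m r 0)
    (hg : g ∈ orderLE n m r 0) (l : ℕ) : bracketChain φ g l ∈ orderLE n m r l := by
  induction l with
  | zero => exact hg
  | succ l ih =>
    rw [bracketChain_succ, bracket]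
    refine sum_mem fun k _ => sub_mem (mul_mem ?_ (totalD_mem_orderLE k ih)) (mul_mem ?_ ?_)
    · exact orderLE_mono (Nat.zero_le _) (covD_mem_orderLE k hφ)
    · exact orderLE_mono (Nat.succ_le_succ (Nat.zero_le _)) (totalD_mem_orderLE k hφ)
    · exact orderLE_mono (Nat.le_succ l) (covD_mem_orderLE k ih)

theorem ev_congr_of_mem_orderLE {l : ℕ} {y y' : Jet n m r}
    (h : ∀ κ w, List.length w ≤ l → y κ w = y' κ w) (ξ : Fin n → ℝ) {p : JetRing n m r}
    (hp : p ∈ orderLE n m r l) : ev y ξ p = ev y' ξ p := by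
  induction hp using Algebra.adjoin_induction with
  | mem p hp =>
    rcases hp with ⟨κ, w, hw, rfl⟩ | ⟨i, rfl⟩
    · simpa [ev] using h κ w hw
    · simp [ev]
  | algebraMap c => simp
  | add p q _ _ hp hq => simp [hp, hq]
  | mul p q _ _ hp hq => simp [hp, hq]

/-- The chain in the definition stops at `2 * n` brackets and each bracket costs one derivative, so
badness is a property of the `2n`-jet. This is why polynomials of degree at most `2 * n` suffice as
perturbations. -/
theorem IsBad.congr {y y' : Jet n m r} (h : ∀ κ w, List.length w ≤ 2 * n → y κ w = y' κ w)
    (hy : IsBad y) : IsBad y' := by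
  have h0 : ∀ ξ p, p ∈ orderLE n m r 0 → ev y' ξ p = ev y ξ p := fun ξ p hp =>
    (ev_congr_of_mem_orderLE h ξ (orderLE_mono (Nat.zero_le _) hp)).symm
  obtain ⟨c, hc⟩ := hy
  have hf : (c.fst : JetRing n m r) ∈ orderLE n m r 0 := minor_mem_orderLE _ _
  have hg : (c.snd : JetRing n m r) ∈ orderLE n m r 0 := minor_mem_orderLE _ _
  have hd : (c.det : JetRing n m r) ∈ orderLE n m r 0 := minor_mem_orderLE _ _
  refine ⟨c, ?_⟩
  rcases hc with ⟨I, ξ, hb⟩ | hb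
  · left
    refine ⟨I, ξ, hb.ne_zero, ?_, ?_, ?_, ?_⟩
    · rw [h0 _ _ hd]; exact hb.det_ne_zero
    · obtain ⟨k, hk⟩ := hb.covD_ne_zero
      exact ⟨k, by rwa [h0 _ _ (covD_mem_orderLE k (covDs_mem_orderLE I hf))]⟩
    · refine hb.nil_or.imp id fun h' k => ?_
      rw [h0 _ _ (covD_mem_orderLE k hg)]; exact h' k
    · intro l hl
      rw [← hb.chain l hl]
      exact (ev_congr_of_mem_orderLE h ξ (orderLE_mono hl
        (bracketChain_mem_orderLE (covDs_mem_orderLE I hf) hg l))).symm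
  · right
    refine ⟨fun ξ => ?_, fun ξ => ?_, ?_⟩
    · rw [h0 _ _ hf]; exact hb.fst_eq_zero ξ
    · rw [h0 _ _ hg]; exact hb.snd_eq_zero ξ
    · obtain ⟨ξ, hξ, h'⟩ := hb.exists_det_ne_zero
      exact ⟨ξ, hξ, by rwa [h0 _ _ hd]⟩

end UTSJets

/-! ### Generic polynomial perturbations have good jets -/

namespace UTSJets

open MvPolynomial

variable {n m r : ℕ}

/-- Polynomials in jets and covectors, at the jets of the members of an affine family of polynomial
symbols, as polynomials in the parameters, the point and the covector. -/
noncomputable def pull {ι : Type} {N : ℕ} (L : PolySymbol n m r) (b : Fin N → PolySymbol n m r)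
    (jp : Fin N → ι) (jx jξ : Fin n → ι) : JetRing n m r →ₐ[ℝ] MvPolynomial ι ℝ :=
  aeval (Sum.elim (fun p => rename jx (pderivs p.2 (L p.1)) +
    ∑ i, X (jp i) * rename jx (pderivs p.2 (b i p.1))) (fun k => X (jξ k)))

section pull

variable {ι : Type} {N : ℕ} {L : PolySymbol n m r} {b : Fin N → PolySymbol n m r}
  {jp : Fin N → ι} {jx jξ : Fin n → ι}

theorem polyJet_sum_smul (d : Fin N → ℝ) (x : Fin n → ℝ) (κ : SymbolIndex n m r)
    (w : List (Fin n)) :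
    polyJet (∑ i, d i • b i) x κ w = ∑ i, d i * polyJet (b i) x κ w := by
  simp [polyJet, Finset.sum_apply, pderivs_sum, pderivs_smul]

theorem eval_pull (z : ι → ℝ) (G : JetRing n m r) :
    eval z (pull L b jp jx jξ G) =
      ev (polyJet (L + ∑ i, z (jp i) • b i) (z ∘ jx)) (z ∘ jξ) G := by
  have : ((aeval z : MvPolynomial ι ℝ →ₐ[ℝ] ℝ).comp (pull L b jp jx jξ)) =
      ev (polyJet (L + ∑ i, z (jp i) • b i) (z ∘ jx)) (z ∘ jξ) := by
    refine MvPolynomial.algHom_ext fun v => ?_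
    rcases v with ⟨κ, w⟩ | k
    · simp only [AlgHom.comp_apply, pull, ev, aeval_X, Sum.elim_inl, polyJet_add, Pi.add_apply,
        polyJet_sum_smul, map_add, map_sum, map_mul, aeval_rename]
      simp [polyJet, MvPolynomial.aeval_eq_eval]
    · simp [pull, ev]
  have h := AlgHom.congr_fun this G
  simpa [MvPolynomial.aeval_eq_eval] using h

/-- The chain rule in the parameters: moving in a direction `d` whose polynomial has the homogeneous
jet `q μ^j` at the given point acts on jet polynomials as `jetVariation q μ j`. It turns
independence under jet variations into the rank condition of the Jacobian criterion. -/
theorem sum_mul_eval_pderiv_pull (hjp : Function.Injective jp) (hpx : ∀ i k, jp i ≠ jx k)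
    (hpξ : ∀ i k, jp i ≠ jξ k) (z : ι → ℝ) (d : Fin N → ℝ) (q : SymbolIndex n m r → ℝ)
    (μ : Fin n → ℝ) (j : ℕ)
    (hd : ∀ κ w, polyJet (∑ i, d i • b i) (z ∘ jx) κ w =
      if w.length = j then q κ * (w.map μ).prod else 0) (G : JetRing n m r) :
    ∑ i, d i * eval z (pderiv (jp i) (pull L b jp jx jξ G)) =
      ev (polyJet (L + ∑ i, z (jp i) • b i) (z ∘ jx)) (z ∘ jξ) (jetVariation q μ j G) := by
  classical
  have hren : ∀ i (p : MvPolynomial (Fin n) ℝ), pderiv (jp i) (rename jx p) = 0 := by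
    intro i p
    refine pderiv_eq_zero_of_notMem_vars fun h => ?_
    obtain ⟨k, -, hk⟩ := Finset.mem_image.1 (vars_rename jx p h)
    exact hpx i k hk.symm
  induction G using MvPolynomial.induction_on with
  | C a =>
    have h1 : pull L b jp jx jξ (C a) = C a := by simp [pull]
    have h2 : jetVariation q μ j (C a : JetRing n m r) = 0 := by simp [jetVariation]
    simp [h1, h2]
  | add p p' hp hp' =>
    simp only [map_add, mul_add, Finset.sum_add_distrib, hp, hp']
  | mul_X p v hp =>
    have hX : ∑ i, d i * eval z (pderiv (jp i) (pull L b jp jx jξ (X v))) =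
        ev (polyJet (L + ∑ i, z (jp i) • b i) (z ∘ jx)) (z ∘ jξ) (jetVariation q μ j (X v)) := by
      rcases v with ⟨κ, w⟩ | k
      · have h1 : ∀ i, eval z (pderiv (jp i) (pull L b jp jx jξ (X (Sum.inl (κ, w))))) =
            polyJet (b i) (z ∘ jx) κ w := by
          intro i
          simp only [pull, aeval_X, Sum.elim_inl, map_add, map_sum, Derivation.leibniz, hren,
            zero_add, smul_eq_mul]
          rw [Finset.sum_eq_single i]
          · rw [pderiv_X_self]; simp [polyJet, eval_rename]
          · intro i' _ hi'
            rw [pderiv_X_of_ne (hjp.ne hi')]; simp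
          · simp
        simp only [h1]
        rw [← polyJet_sum_smul, hd, jetVariation_inl]
        split_ifs <;> simp [ev]
      · have h1 : ∀ i, eval z (pderiv (jp i) (pull L b jp jx jξ (X (Sum.inr k)))) = 0 := by
          intro i
          simp only [pull, aeval_X, Sum.elim_inr]
          rw [pderiv_X_of_ne (hpξ i k).symm, map_zero]
        simp [h1]
    simp only [map_mul, Derivation.leibniz, map_add, smul_eq_mul, eval_pull]
    rw [← hX, ← hp, Finset.mul_sum, Finset.mul_sum, ← Finset.sum_add_distrib]
    exact Finset.sum_congr rfl fun i _ => by ring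

end pull

/-- Homogeneous jets are jets of polynomials. -/
theorem exists_sum_polyJet_eq {N : ℕ} {b : Fin N → PolySymbol n m r}
    (hb : ∀ P ∈ utsPoly n m r (2 * n), ∃ d : Fin N → ℝ, ∑ i, d i • b i = P)
    {q : SymbolIndex n m r → ℝ} (hq : UTS q) (μ : Fin n → ℝ) {j : ℕ} (hj : j ≤ 2 * n)
    (x : Fin n → ℝ) : ∃ d : Fin N → ℝ, ∀ κ w, polyJet (∑ i, d i • b i) x κ w =
      if w.length = j then q κ * (w.map μ).prod else 0 := by
  have hy : IsAdmissible (fun κ w => if w.length = j then q κ * (w.map μ).prod else 0 :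
      Jet n m r) := by
    refine ⟨fun κ w w' h => ?_, fun w a α α' β β' h => ?_⟩
    · simp only [h.length_eq, (h.map μ).prod_eq]
    · simp only [hq a α α' β β' h]
  obtain ⟨P, hP, hPy⟩ := exists_utsPoly_polyJet_eq hy (2 * n) x
  obtain ⟨d, rfl⟩ := hb P hP
  refine ⟨d, fun κ w => ?_⟩
  by_cases hw : w.length ≤ 2 * n
  · exact hPy κ w hw
  · rw [if_neg (by omega), polyJet, pderivs_eq_zero_of_totalDegree_lt _ _
      ((hP.2 κ).trans_lt (not_le.1 hw)), map_zero]

/-- Specialization of the jet variables. -/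
noncomputable def spec (y : Jet n m r) : JetRing n m r →ₐ[ℝ] MvPolynomial (Fin n) ℝ :=
  aeval (Sum.elim (fun p => C (y p.1 p.2)) X)

theorem eval_spec (y : Jet n m r) (ξ : Fin n → ℝ) (p : JetRing n m r) :
    eval ξ (spec y p) = ev y ξ p := by
  have : ((aeval ξ : MvPolynomial (Fin n) ℝ →ₐ[ℝ] ℝ).comp (spec y)) = ev y ξ := by
    refine MvPolynomial.algHom_ext fun v => ?_
    rcases v with ⟨κ, w⟩ | k <;> simp [spec, ev]
  have h := AlgHom.congr_fun this p
  simpa [MvPolynomial.aeval_eq_eval] using h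

theorem pderiv_spec (y : Jet n m r) (k : Fin n) (p : JetRing n m r) :
    pderiv k (spec y p) = spec y (covD k p) := by
  classical
  induction p using MvPolynomial.induction_on with
  | C a =>
    have : covD k (C a : JetRing n m r) = 0 := by simp [covD]
    rw [this]; simp [spec]
  | add p q hp hq => simp [hp, hq]
  | mul_X p v hp =>
    have hX : pderiv k (spec y (X v)) = spec y (covD k (X v)) := by
      rcases v with v | i
      · rw [covD_inl]; simp [spec]
      · rw [covD_inr]
        simp only [spec, aeval_X, Sum.elim_inr, pderiv_X, Pi.single_apply]
        split_ifs <;> simp_all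
    simp only [map_mul, Derivation.leibniz, map_add, smul_eq_mul, hp, hX]

theorem pderivs_spec (y : Jet n m r) (I : List (Fin n)) (p : JetRing n m r) :
    pderivs I (spec y p) = spec y (covDs I p) := by
  induction I with
  | nil => rfl
  | cons k I ih => rw [pderivs_cons, ih, pderiv_spec]; rfl

/-- If all derivatives of a polynomial in the covector vanish at one covector, then the polynomial
vanishes at all covectors. -/
theorem ev_eq_zero_of_forall_covDs {y : Jet n m r} {ξ : Fin n → ℝ} {p : JetRing n m r}
    (h : ∀ I, ev y ξ (covDs I p) = 0) (ξ' : Fin n → ℝ) : ev y ξ' p = 0 := by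
  rw [← eval_spec, eq_zero_of_forall_eval_pderivs ξ (spec y p) fun I => by
    rw [pderivs_spec, eval_spec, h I], map_zero]

theorem ev_covD_eq_zero {y : Jet n m r} {p : JetRing n m r} (h : ∀ ξ, ev y ξ p = 0)
    (k : Fin n) (ξ : Fin n → ℝ) : ev y ξ (covD k p) = 0 := by
  have : spec y p = 0 := MvPolynomial.funext fun ξ => by rw [eval_spec, h, map_zero]
  rw [← eval_spec, ← pderiv_spec, this, map_zero, map_zero]

section relations

variable {N : ℕ} (L : PolySymbol n m r) (b : Fin N → PolySymbol n m r)
  (hb : ∀ P ∈ utsPoly n m r (2 * n), ∃ d : Fin N → ℝ, ∑ i, d i • b i = P)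

include hb

/-- Elimination of the `2 * n` unknowns `(x, ξ)` from the `2 * n + 1` equations of the chain. Only
derivatives in the parameters are needed for the rank, since the parameters realise every upper
totally symmetric variation of order at most `2 * n`. -/
theorem exists_relation_of_isBadAt (c : MinorData m) (I : List (Fin n)) :
    ∃ R : MvPolynomial (Fin N) ℝ, R ≠ 0 ∧ ∀ (p : Fin N → ℝ) (x ξ : Fin n → ℝ),
      IsBadAt (polyJet (L + ∑ i, p i • b i) x) ξ c I → eval p R = 0 := by
  let jp : Fin N → Fin N ⊕ (Fin n ⊕ Fin n) := Sum.inl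
  let jx : Fin n → Fin N ⊕ (Fin n ⊕ Fin n) := fun k => Sum.inr (Sum.inl k)
  let jξ : Fin n → Fin N ⊕ (Fin n ⊕ Fin n) := fun k => Sum.inr (Sum.inr k)
  obtain ⟨R, hR0, hR⟩ := exists_ne_zero_eval_eq_zero_of_jacobian
    (ι₁ := Fin N) (ι₂ := Fin n ⊕ Fin n) (γ := Fin (2 * n + 1))
    (fun j => pull L b jp jx jξ (bracketChain (covDs I c.fst) c.snd j))
    {z | IsBadAt (polyJet (L + ∑ i, z (jp i) • b i) (z ∘ jx)) (z ∘ jξ) c I}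
    (fun z hz j => by
      rw [eval_pull]; exact IsBadAt.chain hz j (by omega))
    (fun z hz a ha => by
      refine IsBadAt.eq_zero_of_forall hz a fun q μ i hq => ?_
      obtain ⟨d, hd⟩ := exists_sum_polyJet_eq hb hq μ (show (i : ℕ) ≤ 2 * n by omega) (z ∘ jx)
      have key := sum_mul_eval_pderiv_pull (L := L) (jξ := jξ) Sum.inl_injective
        (fun _ _ => Sum.inl_ne_inr) (fun _ _ => Sum.inl_ne_inr) z d q μ i hd
      refine (Finset.sum_congr rfl fun j _ => congrArg (a j * ·) (key _).symm).trans ?_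
      simp only [Finset.mul_sum]
      rw [Finset.sum_comm]
      refine Finset.sum_eq_zero fun k _ => ?_
      have := ha (jp k)
      calc _ = d k * ∑ j, a j * eval z (pderiv (jp k)
            (pull L b jp jx jξ (bracketChain (covDs I c.fst) c.snd j))) := by
            rw [Finset.mul_sum]; exact Finset.sum_congr rfl fun j _ => by ring
        _ = 0 := by rw [this, mul_zero])
    (by simp; omega)
  refine ⟨R, hR0, fun p x ξ h => ?_⟩
  exact hR (Sum.elim p (Sum.elim x ξ)) h

/-- A degenerate jet satisfies its equations at every covector, so `ξ` is kept along with the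
parameters and only the `n` unknowns `x` are eliminated, from `n + 1` equations. -/
theorem exists_relation_of_isDegenerate_aux (hr : 1 ≤ r) (c : MinorData m) (i₀ : Fin n) :
    ∃ R : MvPolynomial (Fin N ⊕ Fin n) ℝ, R ≠ 0 ∧ ∀ (p : Fin N → ℝ) (x ξ : Fin n → ℝ),
      IsDegenerate (polyJet (L + ∑ i, p i • b i) x) c → ξ i₀ ≠ 0 →
      ev (polyJet (L + ∑ i, p i • b i) x) ξ c.det ≠ 0 →
      (∃ ℓ₀, pairing ξ ℓ₀ = 0 ∧ pairing (fun γ => ev (polyJet (L + ∑ i, p i • b i) x) ξ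
        (cof c.rows c.cols c.col₂ γ)) ℓ₀ ≠ 0) → eval (Sum.elim p ξ) R = 0 := by
  let jp : Fin N → (Fin N ⊕ Fin n) ⊕ Fin n := fun k => Sum.inl (Sum.inl k)
  let jξ : Fin n → (Fin N ⊕ Fin n) ⊕ Fin n := fun k => Sum.inl (Sum.inr k)
  let jx : Fin n → (Fin N ⊕ Fin n) ⊕ Fin n := Sum.inr
  obtain ⟨R, hR0, hR⟩ := exists_ne_zero_eval_eq_zero_of_jacobian
    (ι₁ := Fin N ⊕ Fin n) (ι₂ := Fin n) (γ := Option (Fin n))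
    (fun j => pull L b jp jx jξ (degenerateConditions c i₀ j))
    {z | IsDegenerate (polyJet (L + ∑ i, z (jp i) • b i) (z ∘ jx)) c ∧ (z ∘ jξ) i₀ ≠ 0 ∧
      ev (polyJet (L + ∑ i, z (jp i) • b i) (z ∘ jx)) (z ∘ jξ) c.det ≠ 0 ∧
      ∃ ℓ₀, pairing (z ∘ jξ) ℓ₀ = 0 ∧
        pairing (fun γ => ev (polyJet (L + ∑ i, z (jp i) • b i) (z ∘ jx)) (z ∘ jξ)
        (cof c.rows c.cols c.col₂ γ)) ℓ₀ ≠ 0}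
    (fun z hz j => by
      rw [eval_pull]
      rcases j with _ | i
      · exact hz.1.fst_eq_zero _
      · simp only [degenerateConditions]
        split_ifs
        · exact hz.1.snd_eq_zero _
        · exact ev_covD_eq_zero hz.1.snd_eq_zero _ _)
    (fun z hz a ha => by
      obtain ⟨-, h1, h2, ℓ₀, h3, h4⟩ := hz
      refine eq_zero_of_forall_degenerateConditions hr h1 h2 h3 h4 a fun q hq => ?_
      obtain ⟨d, hd⟩ := exists_sum_polyJet_eq hb hq 0 (Nat.zero_le _) (z ∘ jx)
      have key := sum_mul_eval_pderiv_pull (L := L) (jp := jp) (jξ := jξ)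
        (Sum.inl_injective.comp Sum.inl_injective)
        (fun _ _ => Sum.inl_ne_inr) (fun _ _ => Sum.inl_injective.ne Sum.inl_ne_inr) z d q 0 0 hd
      refine (Finset.sum_congr rfl fun j _ => congrArg (a j * ·) (key _).symm).trans ?_
      simp only [Finset.mul_sum]
      rw [Finset.sum_comm]
      refine Finset.sum_eq_zero fun k _ => ?_
      have := ha (jp k)
      calc _ = d k * ∑ j, a j * eval z (pderiv (jp k)
            (pull L b jp jx jξ (degenerateConditions c i₀ j))) := by
            rw [Finset.mul_sum]; exact Finset.sum_congr rfl fun j _ => by ring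
        _ = 0 := by rw [this, mul_zero])
    (by simp)
  refine ⟨R, hR0, fun p x ξ h h1 h2 h3 => ?_⟩
  have := hR (Sum.elim (Sum.elim p ξ) x) ⟨h, h1, h2, h3⟩
  rwa [show (fun i => Sum.elim (Sum.elim p ξ) x (Sum.inl i)) = Sum.elim p ξ from rfl] at this

end relations

theorem IsDegenerate.swap {y : Jet n m r} {c : MinorData m} (h : IsDegenerate y c) :
    IsDegenerate y c.swap :=
  ⟨h.snd_eq_zero, h.fst_eq_zero, h.exists_det_ne_zero⟩

/-- The auxiliary relations need `ξ i₀ ≠ 0`, a nonzero small minor and a cofactor form not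
proportional to `ξ`. Taking the product over all `i₀` and both orders of the two columns covers the
cases, and what is left is a nonempty Zariski open set of covectors. -/
theorem exists_relation_of_isDegenerate {N : ℕ} (L : PolySymbol n m r)
    (b : Fin N → PolySymbol n m r)
    (hb : ∀ P ∈ utsPoly n m r (2 * n), ∃ d : Fin N → ℝ, ∑ i, d i • b i = P)
    (hr : 1 ≤ r) (c : MinorData m) :
    ∃ R : MvPolynomial (Fin N ⊕ Fin n) ℝ, R ≠ 0 ∧ ∀ (p : Fin N → ℝ) (x ξ : Fin n → ℝ),
      IsDegenerate (polyJet (L + ∑ i, p i • b i) x) c → eval (Sum.elim p ξ) R = 0 := by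
  choose R hR0 hR using exists_relation_of_isDegenerate_aux L b hb hr c
  choose R' hR0' hR' using exists_relation_of_isDegenerate_aux L b hb hr c.swap
  refine ⟨∏ i, R i * R' i, Finset.prod_ne_zero_iff.2 fun i _ => mul_ne_zero (hR0 i) (hR0' i),
    fun p x ξ h => ?_⟩
  set y := polyJet (L + ∑ i, p i • b i) x with hy
  set S : MvPolynomial (Fin N ⊕ Fin n) ℝ := ∏ i, R i * R' i with hS
  let S' : MvPolynomial (Fin n) ℝ := aeval (Sum.elim (fun i => C (p i)) X) S
  have hS' : ∀ ξ, eval ξ S' = eval (Sum.elim p ξ) S := by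
    intro ξ
    have : ((aeval ξ : MvPolynomial (Fin n) ℝ →ₐ[ℝ] ℝ).comp
        (aeval (Sum.elim (fun i => C (p i)) X))) = aeval (Sum.elim p ξ) := by
      refine MvPolynomial.algHom_ext fun v => ?_
      rcases v with i | k <;> simp
    have h := AlgHom.congr_fun this S
    simpa only [AlgHom.comp_apply, MvPolynomial.aeval_eq_eval] using h
  obtain ⟨ξ₁, hξ₁, hdet⟩ := h.exists_det_ne_zero
  obtain ⟨i₀, hi₀⟩ := Function.ne_iff.1 hξ₁
  -- For the fixed degenerate jet the relation is a polynomial in `ξ` alone. It vanishes wherever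
  -- the second factor does not, and polynomials form a domain.
  have hprod : S' * (spec y c.det * X i₀) = 0 := by
    refine MvPolynomial.funext fun ξ => ?_
    rw [map_zero, map_mul, map_mul, eval_spec, eval_X, hS']
    by_cases h1 : ξ i₀ = 0
    · simp [h1]
    by_cases h2 : ev y ξ c.det = 0
    · simp [h2]
    refine mul_eq_zero_of_left ?_ _
    rw [hS, map_prod]
    refine Finset.prod_eq_zero (Finset.mem_univ i₀) ?_
    rw [map_mul]
    obtain ⟨ℓ₀, h3, h4 | h4⟩ := exists_pairing_cof_ne_zero (c := c) h1 h2
    · rw [hR i₀ p x ξ h h1 h2 ⟨ℓ₀, h3, h4⟩, zero_mul]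
    · rw [hR' i₀ p x ξ h.swap h1 h2 ⟨ℓ₀, h3, h4⟩, mul_zero]
  have hne : spec y c.det * X i₀ ≠ 0 := by
    refine mul_ne_zero (fun h0 => hdet ?_) (X_ne_zero i₀)
    rw [← eval_spec, h0, map_zero]
  rw [← hS', (mul_eq_zero.1 hprod).resolve_right hne, map_zero]

/-- Jets such that all admissible jets that are `ε`-close up to order `2 n` are not bad. -/
def IsGoodWith (ε : ℝ) (y : Jet n m r) : Prop :=
  ∀ y', IsAdmissible y' → (∀ κ w, List.length w ≤ 2 * n → |y' κ w - y κ w| < ε) → ¬ IsBad y'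

theorem sum_smul_mem_utsPoly {N : ℕ} {b : Fin N → PolySymbol n m r} {s : ℕ}
    (hb : ∀ i, b i ∈ utsPoly n m r s) (p : Fin N → ℝ) : ∑ i, p i • b i ∈ utsPoly n m r s :=
  sum_mem fun i _ => Submodule.smul_mem _ _ (hb i)

/-- Small polynomial perturbations of polynomial symbols have good jets at all points. -/
theorem exists_good_perturbation (hr : 1 ≤ r) {N : ℕ} {b : Fin N → PolySymbol n m r}
    (hbmem : ∀ i, b i ∈ utsPoly n m r (2 * n)) (hbli : LinearIndependent ℝ b)
    (hb : ∀ P ∈ utsPoly n m r (2 * n), ∃ d : Fin N → ℝ, ∑ i, d i • b i = P)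
    {L : PolySymbol n m r} (hL : PolyUTS L) {ε : ℝ} (hε : 0 < ε) :
    ∃ p : Fin N → ℝ, (∀ i, |p i| < ε) ∧
      ∀ x, ∃ ε' > 0, IsGoodWith ε' (polyJet (L + ∑ i, p i • b i) x) := by
  classical
  choose R hR0 hR using fun c I => exists_relation_of_isBadAt L b hb c I
  choose R' hR0' hR' using exists_relation_of_isDegenerate L b hb hr
  have := Fintype.ofFinite (MinorData m)
  -- Words longer than the degree of the minor kill it and cannot satisfy `covD_ne_zero`. So
  -- finitely many relations suffice and can be multiplied together.
  let T : MinorData m → Finset (List (Fin n)) := fun c =>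
    (List.finite_length_le (Fin n) (c.fst : JetRing n m r).totalDegree).toFinset
  let F : MvPolynomial (Fin N ⊕ Fin n) ℝ :=
    (∏ c, ∏ I ∈ T c, rename Sum.inl (R c I)) * ∏ c, R' c
  have hF0 : F ≠ 0 := by
    refine mul_ne_zero (Finset.prod_ne_zero_iff.2 fun c _ => Finset.prod_ne_zero_iff.2
      fun I _ => ?_) (Finset.prod_ne_zero_iff.2 fun c _ => hR0' c)
    exact fun h => hR0 c I (rename_injective _ Sum.inl_injective (by rw [h, map_zero]))
  -- A nonzero polynomial does not vanish on a product of infinite sets. The point supplies the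
  -- small parameters and, in its second half, a covector to be used in all degenerate relations.
  obtain ⟨z, hz, hzF⟩ : ∃ z : Fin N ⊕ Fin n → ℝ, (∀ i, z i ∈ Ioo (-ε) ε) ∧ eval z F ≠ 0 := by
    by_contra! hcon
    refine hF0 (funext_set (fun _ => Ioo (-ε) ε) (fun _ => Ioo_infinite (by linarith))
      fun z hz => ?_)
    rw [map_zero]
    exact hcon z fun i => hz i (mem_univ _)
  -- This is needed for all parameters, not only the chosen one: stability comes from applying it to
  -- nearby parameters.
  have hbad : ∀ (p : Fin N → ℝ) (x : Fin n → ℝ), IsBad (polyJet (L + ∑ i, p i • b i) x) →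
      eval (Sum.elim p fun k => z (Sum.inr k)) F = 0 := by
    rintro p x ⟨c, ⟨I, ξ, h⟩ | h⟩
    · have hI : I ∈ T c := by
        rw [Set.Finite.mem_toFinset, mem_ofPred_eq]
        by_contra hlt
        obtain ⟨k, hk⟩ := h.covD_ne_zero
        have h0 : ∀ J : List (Fin n), ∀ p : JetRing n m r, covDs J p = pderivs (J.map Sum.inr) p := by
          intro J p
          induction J with
          | nil => rfl
          | cons k J ih => rw [List.map_cons, pderivs_cons, ← ih]; rfl
        rw [h0, pderivs_eq_zero_of_totalDegree_lt _ _ (by simpa using hlt)] at hk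
        simp at hk
      have := hR c I p x ξ h
      refine mul_eq_zero_of_left ?_ _ |> (map_mul (eval _) _ _).trans
      rw [map_prod]
      refine Finset.prod_eq_zero (Finset.mem_univ c) ?_
      rw [map_prod]
      refine Finset.prod_eq_zero hI ?_
      rw [eval_rename]; exact this
    · refine mul_eq_zero_of_right _ ?_ |> (map_mul (eval _) _ _).trans
      rw [map_prod]
      exact Finset.prod_eq_zero (Finset.mem_univ c) (hR' c p x _ h)
  refine ⟨fun i => z (Sum.inl i), fun i => abs_lt.2 (hz _), fun x => ?_⟩
  set p : Fin N → ℝ := fun i => z (Sum.inl i) with hp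
  -- nonvanishing near `p`
  have hcont : Continuous fun p' : Fin N → ℝ =>
      eval (Sum.elim p' fun k => z (Sum.inr k)) F := by
    refine (MvPolynomial.continuous_eval F).comp (continuous_pi fun v => ?_)
    rcases v with i | k
    · exact continuous_apply i
    · exact continuous_const
  have hne : eval (Sum.elim p fun k => z (Sum.inr k)) F ≠ 0 := by
    convert hzF using 2
    congr 1
    funext v
    rcases v with i | k <;> rfl
  obtain ⟨η, hη, hball⟩ := Metric.eventually_nhds_iff.1 (hcont.continuousAt.eventually_ne hne)
  -- coordinates depend continuously on jets
  let W := {w : List (Fin n) // w.length ≤ 2 * n}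
  have : Finite W := List.finite_length_le (Fin n) (2 * n)
  have := Fintype.ofFinite W
  let J : (Fin N → ℝ) →ₗ[ℝ] (SymbolIndex n m r × W → ℝ) :=
    { toFun := fun d v => polyJet (∑ i, d i • b i) x v.1 v.2.1
      map_add' := fun d d' => by
        funext v
        simp [polyJet_sum_smul, add_mul, Finset.sum_add_distrib]
      map_smul' := fun t d => by
        funext v
        simp [polyJet_sum_smul, Finset.mul_sum, mul_assoc] }
  -- A polynomial of degree at most `2 * n` is determined by its `2n`-jet at `x`.
  have hJ : LinearMap.ker J = ⊥ := by
    rw [LinearMap.ker_eq_bot']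
    intro d hd
    have h0 : ∑ i, d i • b i = 0 := by
      funext κ
      refine eq_zero_of_forall_eval_pderivs x _ fun w => ?_
      by_cases hw : w.length ≤ 2 * n
      · exact congrFun hd (κ, ⟨w, hw⟩)
      · rw [pderivs_eq_zero_of_totalDegree_lt _ _
          (((sum_smul_mem_utsPoly hbmem d).2 κ).trans_lt (not_le.1 hw)), map_zero]
    exact funext (Fintype.linearIndependent_iff.1 hbli d h0)
  obtain ⟨g, hg⟩ := J.exists_leftInverse_of_injective hJ
  have hgc : Continuous g := g.continuous_of_finiteDimensional
  obtain ⟨ε', hε', hgε⟩ := Metric.continuous_iff.1 hgc 0 η hη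
  refine ⟨ε', hε', fun y' hy' hclose hbad' => ?_⟩
  set y := polyJet (L + ∑ i, p i • b i) x with hy
  have hLp : PolyUTS (L + ∑ i, p i • b i) := fun a α α' β β' h => by
    simp only [Pi.add_apply, hL a α α' β β' h, (sum_smul_mem_utsPoly hbmem p).1 a α α' β β' h]
  have hyadm := isAdmissible_polyJet hLp x
  have hdiff : IsAdmissible (fun κ w => y' κ w - y κ w) :=
    ⟨fun κ w w' h => by simp only [hy'.perm κ w w' h, hyadm.perm κ w w' h, hy],
      fun w a α α' β β' h => by simp only [hy'.uts w a α α' β β' h, hyadm.uts w a α α' β β' h, hy]⟩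
  -- Up to order `2 * n`, the nearby jet `y'` is the jet at `x` of the member `p + d` of the same
  -- family, with `d` small. If `y'` were bad, the relation `F` would vanish at `p + d`, too close
  -- to `p`.
  obtain ⟨P, hP, hPy⟩ := exists_utsPoly_polyJet_eq hdiff (2 * n) x
  obtain ⟨d, rfl⟩ := hb P hP
  have hJd : J d = fun v => y' v.1 v.2.1 - y v.1 v.2.1 := by
    funext v
    exact hPy v.1 v.2.1 v.2.2
  have hd : ‖d‖ < η := by
    have h1 : g (J d) = d := LinearMap.congr_fun hg d
    have h2 := hgε (J d) (by
      rw [dist_zero_right, pi_norm_lt_iff hε']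
      intro v
      rw [hJd, Real.norm_eq_abs]
      exact hclose v.1 v.2.1 v.2.2)
    rwa [h1, map_zero, dist_zero_right] at h2
  refine hball (y := p + d) (by simpa using hd) (hbad (p + d) x (hbad'.congr fun κ w hw => ?_))
  have h1 : L + ∑ i, (p + d) i • b i = (L + ∑ i, p i • b i) + ∑ i, d i • b i := by
    simp only [Pi.add_apply, add_smul, Finset.sum_add_distrib, add_assoc]
  rw [h1, polyJet_add, Pi.add_apply, Pi.add_apply, hPy κ w hw, ← hy]
  ring

end UTSJets

/-! ### Jets of smooth symbols along conormal covectors -/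

namespace UTSJets

open MvPolynomial

variable {n m r : ℕ}

/-- The iterated partial derivative along a word. -/
noncomputable def wderiv : List (Fin n) → (EuclideanSpace ℝ (Fin n) → ℝ) →
    EuclideanSpace ℝ (Fin n) → ℝ
  | [], f => f
  | k :: w, f => fun z => fderiv ℝ (wderiv w f) z (EuclideanSpace.single k (1 : ℝ))

theorem ContDiffOn.wderiv {Ω : Set (EuclideanSpace ℝ (Fin n))} (hΩ : IsOpen Ω)
    {f : EuclideanSpace ℝ (Fin n) → ℝ} (hf : ContDiffOn ℝ ∞ f Ω) (w : List (Fin n)) :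
    ContDiffOn ℝ ∞ (wderiv w f) Ω := by
  induction w with
  | nil => exact hf
  | cons k w ih =>
    exact (ih.fderiv_of_isOpen hΩ (m := ∞) (by simp)).clm_apply contDiffOn_const

theorem wderiv_congr_of_eqOn {Ω : Set (EuclideanSpace ℝ (Fin n))} (hΩ : IsOpen Ω)
    {f g : EuclideanSpace ℝ (Fin n) → ℝ} (hfg : EqOn f g Ω) (w : List (Fin n)) :
    EqOn (wderiv w f) (wderiv w g) Ω := by
  induction w with
  | nil => exact hfg
  | cons k w ih =>
    intro z hz
    simp only [wderiv]
    rw [(ih.eventuallyEq_of_mem (hΩ.mem_nhds hz)).fderiv_eq]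

theorem wderiv_perm {Ω : Set (EuclideanSpace ℝ (Fin n))} (hΩ : IsOpen Ω)
    {f : EuclideanSpace ℝ (Fin n) → ℝ} (hf : ContDiffOn ℝ ∞ f Ω) {w w' : List (Fin n)}
    (h : w.Perm w') : EqOn (wderiv w f) (wderiv w' f) Ω := by
  induction h with
  | nil => exact fun _ _ => rfl
  | cons k _ ih =>
    intro z hz
    simp only [wderiv]
    rw [(ih.eventuallyEq_of_mem (hΩ.mem_nhds hz)).fderiv_eq]
  | trans _ _ h₁ h₂ => exact h₁.trans h₂
  | swap k l w =>
    intro z hz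
    have hg := (ContDiffOn.wderiv hΩ hf w).contDiffAt (hΩ.mem_nhds hz)
    have hd : DifferentiableAt ℝ (fderiv ℝ (wderiv w f)) z :=
      ((hg.fderiv_right (m := ∞) (by simp)).differentiableAt (by simp))
    have hs := hg.isSymmSndFDerivAt (by simp; exact ENat.LEInfty.out)
    simp only [wderiv]
    rw [fderiv_clm_apply hd (by fun_prop), fderiv_clm_apply hd (by fun_prop)]
    simpa using hs.eq _ _

/-- The jet of a family of functions at a point. -/
noncomputable def smoothJet (c : SymbolIndex n m r → EuclideanSpace ℝ (Fin n) → ℝ)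
    (z : EuclideanSpace ℝ (Fin n)) : Jet n m r :=
  fun κ w => wderiv w (c κ) z

theorem fderiv_apply_eq_sum (f : EuclideanSpace ℝ (Fin n) → ℝ) (z v : EuclideanSpace ℝ (Fin n)) :
    fderiv ℝ f z v = ∑ k, wderiv [k] f z * v k := by
  conv_lhs => rw [← (EuclideanSpace.basisFun (Fin n) ℝ).sum_repr v]
  simp [wderiv, mul_comm]

theorem isAdmissible_smoothJet {Ω : Set (EuclideanSpace ℝ (Fin n))} (hΩ : IsOpen Ω)
    {c : SymbolIndex n m r → EuclideanSpace ℝ (Fin n) → ℝ} (hc : ∀ κ, ContDiffOn ℝ ∞ (c κ) Ω)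
    (huts : ∀ z, UTS fun κ => c κ z) {z : EuclideanSpace ℝ (Fin n)} (hz : z ∈ Ω) :
    IsAdmissible (smoothJet c z) where
  perm κ w w' h := wderiv_perm hΩ (hc κ) h hz
  uts w := by
    intro a α α' β β' h
    have : c (a, α, β) = c (a, α', β') := funext fun z => huts z a α α' β β' h
    simp only [smoothJet, this]

/-! ### Differentiating jet polynomials along a map into the cotangent space. -/

section ChainRule

variable {Ω : Set (EuclideanSpace ℝ (Fin n))}
  {c : SymbolIndex n m r → EuclideanSpace ℝ (Fin n) → ℝ}
  {F : Type*} [NormedAddCommGroup F] [NormedSpace ℝ F]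

/-- Both sides obey the product rule, so the variables decide; this justifies the name total
derivative. Strict differentiability is the form required by the Lagrange multiplier theorem. -/
theorem hasStrictFDerivAt_ev (hΩ : IsOpen Ω) (hc : ∀ κ, ContDiffOn ℝ ∞ (c κ) Ω)
    {P : F → EuclideanSpace ℝ (Fin n)} {P' : F →L[ℝ] EuclideanSpace ℝ (Fin n)}
    {ζ : F → Fin n → ℝ} {ζ' : Fin n → F →L[ℝ] ℝ} {u : F}
    (hP : HasStrictFDerivAt P P' u) (hζ : ∀ i, HasStrictFDerivAt (fun u => ζ u i) (ζ' i) u)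
    (hu : P u ∈ Ω) (p : JetRing n m r) :
    HasStrictFDerivAt (fun u => ev (smoothJet c (P u)) (ζ u) p)
      (∑ k, ev (smoothJet c (P u)) (ζ u) (totalD k p) • (EuclideanSpace.proj k ∘L P') +
        ∑ i, ev (smoothJet c (P u)) (ζ u) (covD i p) • ζ' i) u := by
  induction p using MvPolynomial.induction_on with
  | C a =>
    simp only [ev, algHom_C, totalD, covD, derivation_C, map_zero, zero_smul,
      Finset.sum_const_zero, add_zero]
    exact hasStrictFDerivAt_const _ _
  | add p q hp hq =>
    simp only [map_add, add_smul, Finset.sum_add_distrib]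
    refine (hp.fun_add hq).congr_fderiv ?_
    abel
  | mul_X p i hp =>
    have hX : HasStrictFDerivAt (fun u => ev (smoothJet c (P u)) (ζ u) (X i))
      (∑ k, ev (smoothJet c (P u)) (ζ u) (totalD k (X i)) • (EuclideanSpace.proj k ∘L P') +
        ∑ j, ev (smoothJet c (P u)) (ζ u) (covD j (X i)) • ζ' j) u := by
      rcases i with ⟨κ, w⟩ | i
      · have h1 : ContDiffAt ℝ ∞ (wderiv w (c κ)) (P u) :=
          (ContDiffOn.wderiv hΩ (hc κ) w).contDiffAt (hΩ.mem_nhds hu)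
        have h2 := (h1.hasStrictFDerivAt (by simp)).comp u hP
        simp only [ev, aeval_X, Sum.elim_inl, totalD_inl, covD_inl, map_zero, zero_smul,
          Finset.sum_const_zero, add_zero]
        refine h2.congr_fderiv ?_
        ext v
        rw [ContinuousLinearMap.comp_apply, fderiv_apply_eq_sum (wderiv w (c κ))]
        simp [wderiv, smoothJet]
      · simp only [ev, aeval_X, Sum.elim_inr, totalD_inr, covD_inr, map_zero, zero_smul,
          Finset.sum_const_zero, zero_add]
        refine (hζ i).congr_fderiv ?_
        simp
    simp only [map_mul, Derivation.leibniz, smul_eq_mul, map_add]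
    refine (hp.fun_mul hX).congr_fderiv ?_
    simp only [add_smul, Finset.sum_add_distrib, smul_add, Finset.smul_sum, mul_smul]
    abel

end ChainRule

/-- The covector `∑ λ_l dH^l`. -/
noncomputable def conormal {k : ℕ} (H : EuclideanSpace ℝ (Fin n) → Fin k → ℝ)
    (u : EuclideanSpace ℝ (Fin n) × (Fin k → ℝ)) (i : Fin n) : ℝ :=
  ∑ l, u.2 l * wderiv [i] (fun z => H z l) u.1

section Conormal

variable {Ω U : Set (EuclideanSpace ℝ (Fin n))}
  {c : SymbolIndex n m r → EuclideanSpace ℝ (Fin n) → ℝ} {k : ℕ}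
  {H : EuclideanSpace ℝ (Fin n) → Fin k → ℝ}

theorem hasStrictFDerivAt_conormal (hU : IsOpen U) (hH : ContDiffOn ℝ ∞ H U)
    {u : EuclideanSpace ℝ (Fin n) × (Fin k → ℝ)} (hu : u.1 ∈ U) (i : Fin n) :
    HasStrictFDerivAt (fun u => conormal H u i)
      (∑ l, (u.2 l • (fderiv ℝ (wderiv [i] (fun z => H z l)) u.1 ∘L
        ContinuousLinearMap.fst ℝ _ _) + wderiv [i] (fun z => H z l) u.1 •
          (ContinuousLinearMap.proj (φ := fun _ : Fin k => ℝ) l ∘L ContinuousLinearMap.snd ℝ _ _))) u := by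
  have key : ∀ l : Fin k, HasStrictFDerivAt
      (fun u : EuclideanSpace ℝ (Fin n) × (Fin k → ℝ) =>
        u.2 l * wderiv [i] (fun z => H z l) u.1)
      (u.2 l • (fderiv ℝ (wderiv [i] (fun z => H z l)) u.1 ∘L
        ContinuousLinearMap.fst ℝ _ _) + wderiv [i] (fun z => H z l) u.1 •
          (ContinuousLinearMap.proj (φ := fun _ : Fin k => ℝ) l ∘L ContinuousLinearMap.snd ℝ _ _)) u := by
    intro l
    have hl : ContDiffOn ℝ ∞ (fun z => H z l) U := contDiffOn_pi.1 hH l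
    have h1 : ContDiffAt ℝ ∞ (wderiv [i] (fun z => H z l)) u.1 :=
      (ContDiffOn.wderiv hU hl [i]).contDiffAt (hU.mem_nhds hu)
    have h2 := (h1.hasStrictFDerivAt (by simp)).comp u hasStrictFDerivAt_fst
    have h3 := (ContinuousLinearMap.proj (R := ℝ) (φ := fun _ : Fin k => ℝ) l ∘L
      ContinuousLinearMap.snd ℝ (EuclideanSpace ℝ (Fin n)) _).hasStrictFDerivAt (x := u)
    exact h3.fun_mul h2
  exact HasStrictFDerivAt.fun_sum fun l _ => key l

/-- `p` vanishes at the conormal covectors of `H = 0` belonging to `W`. -/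
def VanishesOn (c : SymbolIndex n m r → EuclideanSpace ℝ (Fin n) → ℝ)
    (H : EuclideanSpace ℝ (Fin n) → Fin k → ℝ)
    (W : Set (EuclideanSpace ℝ (Fin n) × (Fin k → ℝ))) (p : JetRing n m r) : Prop :=
  ∀ u ∈ W, H u.1 = 0 → ev (smoothJet c u.1) (conormal H u) p = 0

variable (hΩ : IsOpen Ω) (hc : ∀ κ, ContDiffOn ℝ ∞ (c κ) Ω) (hU : IsOpen U)
  (hH : ContDiffOn ℝ ∞ H U) (hUΩ : U ⊆ Ω) (hsurj : ∀ z ∈ U, Function.Surjective (fderiv ℝ H z))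
  {W : Set (EuclideanSpace ℝ (Fin n) × (Fin k → ℝ))} (hW : IsOpen W) (hWU : ∀ u ∈ W, u.1 ∈ U)

include hΩ hc hU hH hUΩ hsurj hW hWU

/-- The conormal bundle is parametrised by `{H = 0} × ℝ^k`. A function vanishing on it has a
differential that annihilates the tangent directions `(τ, σ)` with `dH τ = 0`; the sum over `j` is
the Hessian term from moving the conormal covector along `τ`. -/
theorem VanishesOn.derivative_eq_zero {p : JetRing n m r} (hp : VanishesOn c H W p)
    {u : EuclideanSpace ℝ (Fin n) × (Fin k → ℝ)} (hu : u ∈ W) (hHu : H u.1 = 0)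
    (τ : Fin n → ℝ) (hτ : ∀ l, ∑ i, wderiv [i] (fun z => H z l) u.1 * τ i = 0)
    (σ : Fin k → ℝ) :
    ∑ i, ev (smoothJet c u.1) (conormal H u) (totalD i p) * τ i +
      ∑ i, ev (smoothJet c u.1) (conormal H u) (covD i p) *
        ∑ l, (u.2 l * ∑ j, wderiv [j, i] (fun z => H z l) u.1 * τ j +
          wderiv [i] (fun z => H z l) u.1 * σ l) = 0 := by
  have huU := hWU u hu
  have hHd : HasStrictFDerivAt H (fderiv ℝ H u.1) u.1 :=
    (hH.contDiffAt (hU.mem_nhds huU)).hasStrictFDerivAt (by simp)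
  have hf := hHd.comp u (hasStrictFDerivAt_fst (𝕜 := ℝ) (F := Fin k → ℝ))
  have hφ := hasStrictFDerivAt_ev (P := Prod.fst) hΩ hc (hasStrictFDerivAt_fst (𝕜 := ℝ))
    (fun i => hasStrictFDerivAt_conormal hU hH huU i) (hUΩ huU) p
  -- A constant function is extremal at every point, so Lagrange multipliers show its differential
  -- to be a multiple of `dH` without parametrising the level set.
  have hext : IsLocalExtrOn (fun u => ev (smoothJet c u.1) (conormal H u) p)
      {v | (H ∘ Prod.fst) v = (H ∘ Prod.fst) u} u := by
    left
    filter_upwards [mem_nhdsWithin_of_mem_nhds (hW.mem_nhds hu), self_mem_nhdsWithin] with v hv hv'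
    have : H v.1 = 0 := by simpa [hHu] using hv'
    rw [hp u hu hHu, hp v hv this]
  obtain ⟨Λ, Λ₀, h0, h⟩ := hext.exists_linear_map_of_hasStrictFDerivAt hf hφ
  -- Surjectivity of `dH` excludes the degenerate multiplier.
  have hΛ₀ : Λ₀ ≠ 0 := by
    rintro rfl
    apply h0
    have : Λ = 0 := by
      ext v
      obtain ⟨τ, hτ⟩ := hsurj _ huU (Pi.single v 1)
      simpa [hτ] using h (τ, 0)
    simp [this]
  have hker : fderiv ℝ H u.1 (WithLp.toLp 2 τ) = 0 := by
    ext l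
    have h1 : fderiv ℝ (fun z => H z l) u.1 (WithLp.toLp 2 τ) =
        fderiv ℝ H u.1 (WithLp.toLp 2 τ) l := by
      rw [fderiv_pi (h := fun l => differentiableAt_pi.1 hHd.differentiableAt l)]
      rfl
    rw [← h1, fderiv_apply_eq_sum]
    simpa using hτ l
  have h1 := h (WithLp.toLp 2 τ, σ)
  simp only [ContinuousLinearMap.comp_apply, ContinuousLinearMap.coe_fst', hker, map_zero,
    zero_add, smul_eq_mul, mul_eq_zero, hΛ₀, false_or] at h1
  simp only [add_apply, sum_apply,
    smul_apply, ContinuousLinearMap.comp_apply,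
    ContinuousLinearMap.coe_fst', ContinuousLinearMap.coe_snd', smul_eq_mul,
    fderiv_apply_eq_sum (wderiv _ _)] at h1
  simpa [wderiv] using h1

/-- The conormal bundle is Lagrangian. Fibre directions show that `∂p/∂ξ` and `∂q/∂ξ` are tangent to
`H = 0`. Differentiating `p` along `∂q/∂ξ` and `q` along `∂p/∂ξ` and subtracting leaves the bracket,
as the Hessian terms agree by symmetry of second derivatives. -/
theorem VanishesOn.bracket {p q : JetRing n m r} (hp : VanishesOn c H W p)
    (hq : VanishesOn c H W q) : VanishesOn c H W (bracket p q) := by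
  intro u hu hHu
  have huU := hWU u hu
  have dp := VanishesOn.derivative_eq_zero hΩ hc hU hH hUΩ hsurj hW hWU hp hu hHu
  have dq := VanishesOn.derivative_eq_zero hΩ hc hU hH hUΩ hsurj hW hWU hq hu hHu
  have tang : ∀ p : JetRing n m r, VanishesOn c H W p → ∀ l,
      ∑ i, wderiv [i] (fun z => H z l) u.1 *
        ev (smoothJet c u.1) (conormal H u) (covD i p) = 0 := by
    intro p hp l
    have := VanishesOn.derivative_eq_zero hΩ hc hU hH hUΩ hsurj hW hWU hp hu hHu 0 (by simp)
      (Pi.single l 1)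
    simpa [Pi.single_apply, mul_comm] using this
  have h1 := dp (fun i => ev (smoothJet c u.1) (conormal H u) (covD i q)) (tang q hq) 0
  have h2 := dq (fun i => ev (smoothJet c u.1) (conormal H u) (covD i p)) (tang p hp) 0
  simp only [Pi.zero_apply, mul_zero, add_zero] at h1 h2
  have hsymm : ∀ i j l, wderiv [i, j] (fun z => H z l) u.1 =
      wderiv [j, i] (fun z => H z l) u.1 := fun i j l =>
    wderiv_perm hU (contDiffOn_pi.1 hH l) (List.Perm.swap _ _ _) huU
  have h3 : ∑ i, ev (smoothJet c u.1) (conormal H u) (covD i p) * ∑ l, u.2 l *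
        ∑ j, wderiv [j, i] (fun z => H z l) u.1 *
          ev (smoothJet c u.1) (conormal H u) (covD j q) =
      ∑ i, ev (smoothJet c u.1) (conormal H u) (covD i q) * ∑ l, u.2 l *
        ∑ j, wderiv [j, i] (fun z => H z l) u.1 *
          ev (smoothJet c u.1) (conormal H u) (covD j p) := by
    have e : ∀ p q : JetRing n m r,
        ∑ i, ev (smoothJet c u.1) (conormal H u) (covD i p) * ∑ l, u.2 l *
          ∑ j, wderiv [j, i] (fun z => H z l) u.1 *
            ev (smoothJet c u.1) (conormal H u) (covD j q) =
        ∑ i, ∑ j, ∑ l, u.2 l * wderiv [j, i] (fun z => H z l) u.1 *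
          (ev (smoothJet c u.1) (conormal H u) (covD i p) *
            ev (smoothJet c u.1) (conormal H u) (covD j q)) := by
      intro p q
      refine Finset.sum_congr rfl fun i _ => ?_
      rw [Finset.sum_comm, Finset.mul_sum]
      refine Finset.sum_congr rfl fun l _ => ?_
      simp only [Finset.mul_sum]
      refine Finset.sum_congr rfl fun j _ => ?_
      ring
    rw [e, e, Finset.sum_comm]
    refine Finset.sum_congr rfl fun i _ => Finset.sum_congr rfl fun j _ =>
      Finset.sum_congr rfl fun l _ => ?_
    rw [hsymm]
    ring
  simp only [UTSJets.bracket, map_sum, map_sub, map_mul, Finset.sum_sub_distrib]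
  have e1 : ∑ i, ev (smoothJet c u.1) (conormal H u) (covD i p) *
      ev (smoothJet c u.1) (conormal H u) (totalD i q) =
      ∑ i, ev (smoothJet c u.1) (conormal H u) (totalD i q) *
      ev (smoothJet c u.1) (conormal H u) (covD i p) :=
    Finset.sum_congr rfl fun i _ => mul_comm _ _
  linarith

theorem VanishesOn.bracketChain {p q : JetRing n m r} (hp : VanishesOn c H W p)
    (hq : VanishesOn c H W q) (l : ℕ) : VanishesOn c H W (bracketChain p q l) := by
  induction l with
  | zero => exact hq
  | succ l ih =>
    rw [bracketChain_succ]
    exact VanishesOn.bracket hΩ hc hU hH hUΩ hsurj hW hWU hp ih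

omit hΩ hc hUΩ hW hWU in
theorem conormal_ne_zero {u : EuclideanSpace ℝ (Fin n) × (Fin k → ℝ)} (hu : u.1 ∈ U)
    (hu2 : u.2 ≠ 0) : conormal H u ≠ 0 := by
  intro h
  obtain ⟨v, hv⟩ := hsurj _ hu u.2
  have hHd : DifferentiableAt ℝ H u.1 :=
    (hH.contDiffAt (hU.mem_nhds hu)).differentiableAt (by simp)
  have h1 : ∀ l, ∑ i, wderiv [i] (fun z => H z l) u.1 * v i = u.2 l := by
    intro l
    rw [← hv, ← fderiv_apply_eq_sum, fderiv_pi (h := fun l => differentiableAt_pi.1 hHd l)]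
    rfl
  have h2 : ∑ i, conormal H u i * v i = ∑ l, u.2 l * u.2 l := by
    simp only [conormal, Finset.sum_mul]
    rw [Finset.sum_comm]
    refine Finset.sum_congr rfl fun l _ => ?_
    conv_rhs => rw [← h1 l, Finset.mul_sum]
    exact Finset.sum_congr rfl fun i _ => by rw [h1 l]; ring
  rw [h] at h2
  simp only [Pi.zero_apply, zero_mul, Finset.sum_const_zero] at h2
  apply hu2
  ext l
  have := (Finset.sum_eq_zero_iff_of_nonneg fun l _ => mul_self_nonneg (u.2 l)).1 h2.symm l
    (Finset.mem_univ _)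
  simpa using this

omit hΩ hc hU hH hUΩ hsurj hW hWU in
theorem det_submatrix_eq_zero_of_rank_lt {T : Matrix (Fin m) (Fin (m + 1)) ℝ} (hT : T.rank < m)
    (A : Fin m → Fin m) (B : Fin m → Fin (m + 1)) : (T.submatrix A B).det = 0 := by
  by_cases hA : Function.Injective A
  · have hA' : Function.Bijective A := Finite.injective_iff_bijective.1 hA
    have hdep : ¬ LinearIndependent ℝ T.row := by
      intro h
      have := h.rank_matrix
      simp at this
      omega
    obtain ⟨g, hg, i, hi⟩ := Fintype.not_linearIndependent_iff.1 hdep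
    refine Matrix.exists_vecMul_eq_zero_iff.1 ⟨g ∘ A, ?_, ?_⟩
    · obtain ⟨j, rfl⟩ := hA'.2 i
      exact fun h => hi (congrFun h j)
    · ext b
      have := congrFun hg (B b)
      simp only [Finset.sum_apply, Pi.smul_apply, Matrix.row, smul_eq_mul, Pi.zero_apply] at this
      simp only [Matrix.vecMul, dotProduct, Function.comp_apply, Matrix.submatrix_apply,
        Pi.zero_apply]
      rw [← this]
      exact (Equiv.ofBijective A hA').sum_comp fun j => g j * T j (B b)
  · simp only [Function.Injective, not_forall] at hA
    obtain ⟨i, j, hij, hne⟩ := hA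
    exact Matrix.det_zero_of_row_eq hne (by ext b; simp [hij])

omit hW hWU in
/-- If the symbol does not have maximal rank at any conormal covector of `H = 0`, then there are
bad jets. -/
theorem exists_isBad_of_rank_lt (hk : 1 ≤ k) {z₀ : EuclideanSpace ℝ (Fin n)} (hz₀ : z₀ ∈ U)
    (hHz₀ : H z₀ = 0) (hrank : ∀ u : EuclideanSpace ℝ (Fin n) × (Fin k → ℝ), u.1 ∈ U →
      H u.1 = 0 → (symb.map (ev (smoothJet c u.1) (conormal H u))).rank < m) :
    ∃ z ∈ U, H z = 0 ∧ IsBad (smoothJet c z) := by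
  classical
  have evminor : ∀ (u : EuclideanSpace ℝ (Fin n) × (Fin k → ℝ)) (ρ : ℕ) (A : Fin ρ → Fin m)
      (B : Fin ρ → Fin (m + 1)), ev (smoothJet c u.1) (conormal H u) (minor A B) =
        ((symb.map (ev (smoothJet c u.1) (conormal H u))).submatrix A B).det := by
    intro u ρ A B
    rw [minor, AlgHom.map_det]
    rfl
  -- The least size with this property is at most `m` by the rank assumption, and positive because
  -- the empty minor is `1` and nonzero conormal covectors exist for `k ≥ 1`.
  let Q : ℕ → Prop := fun ρ => ∀ (A : Fin ρ → Fin m) (B : Fin ρ → Fin (m + 1))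
    (u : EuclideanSpace ℝ (Fin n) × (Fin k → ℝ)), u.1 ∈ U → H u.1 = 0 → u.2 ≠ 0 →
      ev (smoothJet c u.1) (conormal H u) (minor A B) = 0
  have hQm : Q m := fun A B u hu hHu _ => by
    rw [evminor]
    exact det_submatrix_eq_zero_of_rank_lt (hrank u hu hHu) A B
  have hQ0 : ¬ Q 0 := by
    intro h
    have : Nonempty (Fin k) := ⟨⟨0, hk⟩⟩
    have := h Fin.elim0 Fin.elim0 (z₀, 1) hz₀ hHz₀ one_ne_zero
    simp [minor] at this
  have hex : ∃ ρ, Q ρ := ⟨m, hQm⟩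
  obtain ⟨ρ, hρ⟩ : ∃ ρ, Nat.find hex = ρ + 1 := Nat.exists_eq_succ_of_ne_zero fun h =>
    hQ0 (h ▸ Nat.find_spec hex)
  have hQρ : Q (ρ + 1) := hρ ▸ Nat.find_spec hex
  have hnQ : ¬ Q ρ := Nat.find_min hex (by omega)
  have hρm : ρ < m := by
    have := Nat.find_min' hex hQm
    omega
  simp only [Q, not_forall] at hnQ
  obtain ⟨A, B, u₁, hu₁, hHu₁, hu₁2, hD⟩ := hnQ
  obtain ⟨a, ha⟩ : ∃ a, a ∉ range A := by
    by_contra! h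
    have := Fintype.card_le_of_surjective A h
    simp at this
    omega
  -- With `ρ < m` chosen columns out of `m + 1`, at least two are left.
  obtain ⟨α, β, hα, hβ, hαβ⟩ : ∃ α β, α ∉ range B ∧ β ∉ range B ∧ α ≠ β := by
    have h1 : 1 < (Finset.univ.image B)ᶜ.card := by
      have h2 : (Finset.univ.image B).card ≤ ρ := by
        simpa using Finset.card_image_le (s := Finset.univ) (f := B)
      rw [Finset.card_compl]
      simp only [Fintype.card_fin]
      omega
    obtain ⟨α, hα, β, hβ, h⟩ := Finset.one_lt_card.1 h1
    exact ⟨α, β, by simpa using hα, by simpa using hβ, h⟩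
  let d : MinorData m := ⟨⟨ρ, hρm⟩, A, B, a, α, β, ha, hα, hβ, hαβ⟩
  let W : Set (EuclideanSpace ℝ (Fin n) × (Fin k → ℝ)) :=
    {u | u.1 ∈ U ∧ u.2 ≠ 0 ∧ ev (smoothJet c u.1) (conormal H u) d.det ≠ 0}
  have hWU : ∀ u ∈ W, u.1 ∈ U := fun u hu => hu.1
  have hW : IsOpen W := by
    rw [isOpen_iff_mem_nhds]
    rintro u ⟨h1, h2, h3⟩
    have hcont : ContinuousAt (fun u : EuclideanSpace ℝ (Fin n) × (Fin k → ℝ) =>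
        ev (smoothJet c u.1) (conormal H u) d.det) u :=
      (hasStrictFDerivAt_ev (P := Prod.fst) hΩ hc (hasStrictFDerivAt_fst (𝕜 := ℝ))
        (fun i => hasStrictFDerivAt_conormal hU hH h1 i) (hUΩ h1) d.det).continuousAt
    filter_upwards [continuousAt_fst.preimage_mem_nhds (hU.mem_nhds h1),
      continuousAt_snd.eventually_ne h2, hcont.eventually_ne h3] with v h4 h5 h6
    exact ⟨h4, h5, h6⟩
  have hu₁W : u₁ ∈ W := ⟨hu₁, hu₁2, hD⟩
  have hf : VanishesOn c H W d.fst := fun u hu hHu =>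
    hQρ (Fin.cons a A) (Fin.cons α B) u hu.1 hHu hu.2.1
  have hg : VanishesOn c H W d.snd := fun u hu hHu =>
    hQρ (Fin.cons a A) (Fin.cons β B) u hu.1 hHu hu.2.1
  -- Vanishing of all covector derivatives at one covector means vanishing in all of the fibre, the
  -- degenerate case. Otherwise a shortest word with a nonvanishing derivative drives the bracket
  -- chain.
  by_cases hall : ∀ I, VanishesOn c H W (covDs I d.fst) ∧ VanishesOn c H W (covDs I d.snd)
  · refine ⟨u₁.1, hu₁, hHu₁, d, Or.inr ⟨?_, ?_, _,
      conormal_ne_zero hU hH hsurj hu₁ hu₁2, hD⟩⟩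
    · exact ev_eq_zero_of_forall_covDs fun I => (hall I).1 u₁ hu₁W hHu₁
    · exact ev_eq_zero_of_forall_covDs fun I => (hall I).2 u₁ hu₁W hHu₁
  · have hex2 : ∃ ℓ, ∃ I : List (Fin n), I.length = ℓ ∧
        ¬ (VanishesOn c H W (covDs I d.fst) ∧ VanishesOn c H W (covDs I d.snd)) := by
      rw [not_forall] at hall
      obtain ⟨I, hI⟩ := hall
      exact ⟨_, I, rfl, hI⟩
    obtain ⟨I, hIl, hI⟩ := Nat.find_spec hex2
    have hmin : ∀ J : List (Fin n), J.length < I.length →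
        VanishesOn c H W (covDs J d.fst) ∧ VanishesOn c H W (covDs J d.snd) := by
      intro J hJ
      by_contra h
      exact Nat.find_min hex2 (hIl ▸ hJ) ⟨J, rfl, h⟩
    rcases I with _ | ⟨j, I⟩
    · exact absurd ⟨hf, hg⟩ hI
    -- Stated for arbitrary minor data with the same small minor, so that it applies to `d` or to
    -- `d.swap` according to which bordered minor has the nonvanishing derivative.
    have key : ∀ d' : MinorData m, d'.det = d.det (n := n) (r := r) →
        (∀ J : List (Fin n), J.length < (j :: I).length →
          VanishesOn c H W (covDs J d'.fst) ∧ VanishesOn c H W (covDs J d'.snd)) →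
        ¬ VanishesOn c H W (covDs (j :: I) d'.fst) → ∃ z ∈ U, H z = 0 ∧ IsBad (smoothJet c z) := by
      intro d' hd' hmin' hn
      simp only [VanishesOn, not_forall] at hn
      obtain ⟨u, hu, hHu, hne⟩ := hn
      refine ⟨u.1, hu.1, hHu, d', Or.inl ⟨I, conormal H u,
        conormal_ne_zero hU hH hsurj hu.1 hu.2.1, hd' ▸ hu.2.2, ⟨j, hne⟩, ?_, ?_⟩⟩
      -- If `I` is not empty, one-letter words are shorter than `j :: I`, so by minimality the first
      -- derivatives of the second minor vanish; this is the alternative in `nil_or`.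
      · rcases I with _ | ⟨i, I⟩
        · exact Or.inl rfl
        · exact Or.inr fun i => (hmin' [i] (by simp)).2 u hu hHu
      · intro l _
        exact VanishesOn.bracketChain hΩ hc hU hH hUΩ hsurj hW hWU (hmin' I (by simp)).1
          (hmin' [] (by simp)).2 l u hu hHu
    rw [not_and_or] at hI
    rcases hI with hI | hI
    · exact key d rfl hmin hI
    · exact key d.swap rfl (fun J hJ => (hmin J hJ).symm) hI

end Conormal

end UTSJets

/-! ### Polynomial approximation of smooth functions together with their derivatives -/

namespace UTSJets

open MvPolynomial MeasureTheory
open scoped Convolution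

variable {n : ℕ}

theorem norm_iteratedFDeriv_le_sum {f : EuclideanSpace ℝ (Fin n) → ℝ} (l : ℕ)
    (z : EuclideanSpace ℝ (Fin n)) :
    ‖iteratedFDeriv ℝ l f z‖ ≤ ∑ β : Fin l → Fin n,
      |iteratedFDeriv ℝ l f z fun i => EuclideanSpace.single (β i) (1 : ℝ)| := by
  refine ContinuousMultilinearMap.opNorm_le_bound (Finset.sum_nonneg fun _ _ => abs_nonneg _)
    fun v => ?_
  have hv : v = fun i => ∑ k, v i k • EuclideanSpace.single k (1 : ℝ) := by
    funext i
    conv_lhs => rw [← (EuclideanSpace.basisFun (Fin n) ℝ).sum_repr (v i)]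
    simp
  conv_lhs => rw [hv]
  rw [ContinuousMultilinearMap.map_sum, Finset.sum_mul]
  refine (norm_sum_le _ _).trans (Finset.sum_le_sum fun β _ => ?_)
  rw [ContinuousMultilinearMap.map_smul_univ, norm_smul, mul_comm, Real.norm_eq_abs,
    norm_prod]
  gcongr with i
  exact PiLp.norm_apply_le (v i) (β i)

theorem wderiv_cons (k : Fin n) (w : List (Fin n)) (f : EuclideanSpace ℝ (Fin n) → ℝ)
    (z : EuclideanSpace ℝ (Fin n)) :
    wderiv (k :: w) f z = fderiv ℝ (wderiv w f) z (EuclideanSpace.single k (1 : ℝ)) := rfl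

theorem wderiv_ofFn {Ω : Set (EuclideanSpace ℝ (Fin n))} (hΩ : IsOpen Ω)
    {f : EuclideanSpace ℝ (Fin n) → ℝ} (hf : ContDiffOn ℝ ∞ f Ω) {l : ℕ} (β : Fin l → Fin n) :
    ∀ z ∈ Ω, wderiv (List.ofFn β) f z =
      iteratedFDeriv ℝ l f z fun i => EuclideanSpace.single (β i) (1 : ℝ) := by
  induction l with
  | zero => intro z _; simp [wderiv]
  | succ l ih =>
    intro z hz
    rw [List.ofFn_succ, iteratedFDeriv_succ_apply_left, wderiv_cons]
    have h1 : wderiv (List.ofFn fun i => β (Fin.succ i)) f =ᶠ[𝓝 z] fun z =>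
        iteratedFDeriv ℝ l f z fun i => EuclideanSpace.single (β i.succ) (1 : ℝ) := by
      filter_upwards [hΩ.mem_nhds hz] with y hy
      exact ih (fun i => β i.succ) y hy
    rw [h1.fderiv_eq]
    have h2 : DifferentiableAt ℝ (iteratedFDeriv ℝ l f) z :=
      (hf.contDiffAt (hΩ.mem_nhds hz)).differentiableAt_iteratedFDeriv
        (by exact_mod_cast ENat.natCast_lt_top l)
    have h3 := (ContinuousMultilinearMap.apply ℝ (fun _ : Fin l => EuclideanSpace ℝ (Fin n)) ℝ
      fun i => EuclideanSpace.single (β i.succ) (1 : ℝ)).hasFDerivAt.comp z h2.hasFDerivAt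
    have h4 := h3.fderiv
    have h5 : (fun z => iteratedFDeriv ℝ l f z
        fun i => EuclideanSpace.single (β i.succ) (1 : ℝ)) =
        (ContinuousMultilinearMap.apply ℝ (fun _ : Fin l => EuclideanSpace ℝ (Fin n)) ℝ
      fun i => EuclideanSpace.single (β i.succ) (1 : ℝ)) ∘ iteratedFDeriv ℝ l f := rfl
    rw [h5, h4]
    rfl

theorem abs_wderiv_le {Ω : Set (EuclideanSpace ℝ (Fin n))} (hΩ : IsOpen Ω)
    {f : EuclideanSpace ℝ (Fin n) → ℝ} (hf : ContDiffOn ℝ ∞ f Ω) (w : List (Fin n))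
    {z : EuclideanSpace ℝ (Fin n)} (hz : z ∈ Ω) :
    |wderiv w f z| ≤ ‖iteratedFDeriv ℝ w.length f z‖ := by
  have h := wderiv_ofFn hΩ hf w.get z hz
  rw [List.ofFn_get] at h
  rw [h]
  simpa using (iteratedFDeriv ℝ w.length f z).le_opNorm
    fun i => EuclideanSpace.single (w.get i) (1 : ℝ)

theorem wderiv_add {Ω : Set (EuclideanSpace ℝ (Fin n))} (hΩ : IsOpen Ω)
    {f g : EuclideanSpace ℝ (Fin n) → ℝ} (hf : ContDiffOn ℝ ∞ f Ω) (hg : ContDiffOn ℝ ∞ g Ω)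
    (w : List (Fin n)) :
    ∀ z ∈ Ω, wderiv w (fun z => f z + g z) z = wderiv w f z + wderiv w g z := by
  induction w with
  | nil => exact fun _ _ => rfl
  | cons k w ih =>
    intro z hz
    have h : wderiv w (fun z => f z + g z) =ᶠ[𝓝 z] fun z => wderiv w f z + wderiv w g z := by
      filter_upwards [hΩ.mem_nhds hz] with y hy using ih y hy
    simp only [wderiv]
    rw [h.fderiv_eq, fderiv_fun_add]
    · rfl
    · exact ((ContDiffOn.wderiv hΩ hf w).contDiffAt (hΩ.mem_nhds hz)).differentiableAt (by simp)
    · exact ((ContDiffOn.wderiv hΩ hg w).contDiffAt (hΩ.mem_nhds hz)).differentiableAt (by simp)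

theorem wderiv_neg (f : EuclideanSpace ℝ (Fin n) → ℝ) (w : List (Fin n)) :
    wderiv w (fun z => - f z) = fun z => - wderiv w f z := by
  induction w with
  | nil => rfl
  | cons k w ih =>
    ext z
    simp only [wderiv]
    rw [ih, fderiv_fun_neg]
    rfl

theorem wderiv_sub {Ω : Set (EuclideanSpace ℝ (Fin n))} (hΩ : IsOpen Ω)
    {f g : EuclideanSpace ℝ (Fin n) → ℝ} (hf : ContDiffOn ℝ ∞ f Ω) (hg : ContDiffOn ℝ ∞ g Ω)
    (w : List (Fin n)) {z : EuclideanSpace ℝ (Fin n)} (hz : z ∈ Ω) :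
    wderiv w (fun z => f z - g z) z = wderiv w f z - wderiv w g z := by
  simp only [sub_eq_add_neg]
  rw [wderiv_add hΩ hf hg.neg w z hz, wderiv_neg]

theorem wderiv_zero (w : List (Fin n)) :
    wderiv w (fun _ => 0 : EuclideanSpace ℝ (Fin n) → ℝ) = fun _ => 0 := by
  induction w with
  | nil => rfl
  | cons k w ih => ext z; simp [wderiv, ih]

/-- Polynomial functions on Euclidean space. -/
noncomputable def polyFun (P : MvPolynomial (Fin n) ℝ) (z : EuclideanSpace ℝ (Fin n)) : ℝ :=
  eval z.ofLp P

theorem contDiff_polyFun (P : MvPolynomial (Fin n) ℝ) : ContDiff ℝ ∞ (polyFun P) := by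
  induction P using MvPolynomial.induction_on with
  | C a =>
    have : polyFun (C a : MvPolynomial (Fin n) ℝ) = fun _ => a := by ext z; simp [polyFun]
    rw [this]
    exact contDiff_const
  | add P Q hP hQ =>
    have : polyFun (P + Q) = fun z => polyFun P z + polyFun Q z := by ext z; simp [polyFun]
    rw [this]
    exact hP.add hQ
  | mul_X P i hP =>
    have : polyFun (P * X i) = fun z => polyFun P z * z i := by ext z; simp [polyFun]
    rw [this]
    exact hP.mul (EuclideanSpace.proj i : EuclideanSpace ℝ (Fin n) →L[ℝ] ℝ).contDiff

theorem fderiv_polyFun (P : MvPolynomial (Fin n) ℝ) (k : Fin n) (z : EuclideanSpace ℝ (Fin n)) :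
    fderiv ℝ (polyFun P) z (EuclideanSpace.single k (1 : ℝ)) = polyFun (pderiv k P) z := by
  have hd : ∀ P : MvPolynomial (Fin n) ℝ, DifferentiableAt ℝ (polyFun P) z := fun P =>
    (contDiff_polyFun P).contDiffAt.differentiableAt (by simp)
  induction P using MvPolynomial.induction_on with
  | C a =>
    have : polyFun (C a : MvPolynomial (Fin n) ℝ) = fun _ => a := by ext z; simp [polyFun]
    simp [this, polyFun]
  | add P Q hP hQ =>
    have : polyFun (P + Q) = fun z => polyFun P z + polyFun Q z := by ext z; simp [polyFun]
    rw [this, fderiv_fun_add (hd P) (hd Q), add_apply, hP, hQ]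
    simp [polyFun]
  | mul_X P i hP =>
    have : polyFun (P * X i) =
        fun z => polyFun P z * (EuclideanSpace.proj i : EuclideanSpace ℝ (Fin n) →L[ℝ] ℝ) z := by
      ext z; simp [polyFun]
    rw [this, fderiv_fun_mul (hd P) (ContinuousLinearMap.differentiableAt _),
      ContinuousLinearMap.fderiv]
    simp only [add_apply, smul_apply, hP]
    simp [polyFun, pderiv_X, Pi.single_apply, apply_ite, eq_comm]

theorem wderiv_polyFun (P : MvPolynomial (Fin n) ℝ) (w : List (Fin n)) :
    wderiv w (polyFun P) = polyFun (pderivs w P) := by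
  induction w with
  | nil => rfl
  | cons k w ih =>
    ext z
    simp only [wderiv, ih, fderiv_polyFun]
    rfl

theorem smoothJet_polyFun {m r : ℕ} (P : PolySymbol n m r) (z : EuclideanSpace ℝ (Fin n)) :
    smoothJet (fun κ => polyFun (P κ)) z = polyJet P z.ofLp := by
  ext κ w
  simp [smoothJet, wderiv_polyFun, polyFun, polyJet]

theorem wderiv_eq_zero_of_notMem_tsupport {f : EuclideanSpace ℝ (Fin n) → ℝ}
    {z : EuclideanSpace ℝ (Fin n)} (hz : z ∉ tsupport f) (w : List (Fin n)) :
    wderiv w f z = 0 := by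
  have h : EqOn f (fun _ => 0) (tsupport f)ᶜ := fun y hy => image_eq_zero_of_notMem_tsupport hy
  rw [wderiv_congr_of_eqOn (isClosed_tsupport f).isOpen_compl h w hz, wderiv_zero]

theorem hasCompactSupport_wderiv {f : EuclideanSpace ℝ (Fin n) → ℝ} (hf : HasCompactSupport f)
    (w : List (Fin n)) : HasCompactSupport (wderiv w f) :=
  HasCompactSupport.intro hf fun _ hz => wderiv_eq_zero_of_notMem_tsupport hz w

theorem contDiff_wderiv {f : EuclideanSpace ℝ (Fin n) → ℝ} (hf : ContDiff ℝ ∞ f)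
    (w : List (Fin n)) : ContDiff ℝ ∞ (wderiv w f) :=
  contDiffOn_univ.1 (ContDiffOn.wderiv isOpen_univ hf.contDiffOn w)

/-- All derivatives fall on the compactly supported factor, so one kernel approximates a function
and its derivatives simultaneously. -/
theorem wderiv_convolution {κ f : EuclideanSpace ℝ (Fin n) → ℝ} (hκ : Continuous κ)
    (hf : ContDiff ℝ ∞ f) (hfc : HasCompactSupport f) (w : List (Fin n)) :
    wderiv w (κ ⋆[ContinuousLinearMap.lsmul ℝ ℝ, volume] f) =
      κ ⋆[ContinuousLinearMap.lsmul ℝ ℝ, volume] wderiv w f := by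
  induction w with
  | nil => rfl
  | cons k w ih =>
    ext z
    have hs := contDiff_wderiv hf w
    have hc := hasCompactSupport_wderiv hfc w
    rw [wderiv_cons, ih, (hc.hasFDerivAt_convolution_right _ hκ.locallyIntegrable
      (hs.of_le (by simp)) z).fderiv, convolution_precompR_apply _ hκ.locallyIntegrable
      (hc.fderiv ℝ) (hs.continuous_fderiv (by simp))]
    rfl

/-- The convolution of a polynomial with a compactly supported function is a polynomial. -/
theorem exists_polyFun_eq_convolution (q : MvPolynomial (Fin n) ℝ)
    {f : EuclideanSpace ℝ (Fin n) → ℝ} (hf : Continuous f) (hfc : HasCompactSupport f) :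
    ∃ P : MvPolynomial (Fin n) ℝ,
      polyFun q ⋆[ContinuousLinearMap.lsmul ℝ ℝ, volume] f = polyFun P := by
  -- The polynomial `q (x - t)`, with `x` as outer and `t` as inner variables. Integration over `t`
  -- acts on its coefficients only.
  let Q : MvPolynomial (Fin n) (MvPolynomial (Fin n) ℝ) := aeval (fun i => X i - C (X i)) q
  have hQ : ∀ x t : EuclideanSpace ℝ (Fin n),
      polyFun q (x - t) = ∑ a ∈ Q.support, eval t.ofLp (coeff a Q) * ∏ i, x i ^ a i := by
    intro x t
    have h1 : polyFun q (x - t) = eval₂ (eval t.ofLp) x.ofLp Q := by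
      simp only [Q]
      clear Q
      induction q using MvPolynomial.induction_on with
      | C a => simp [polyFun]
      | add p q hp hq => simp_all [polyFun]
      | mul_X p i hp => simp_all [polyFun]
    rw [h1, eval₂_eq']
  refine ⟨∑ a ∈ Q.support, monomial a (∫ t, f t * eval t.ofLp (coeff a Q)), ?_⟩
  ext x
  rw [convolution_eq_swap]
  have hint : ∀ a ∈ Q.support, Integrable fun t : EuclideanSpace ℝ (Fin n) =>
      (f t * eval t.ofLp (coeff a Q)) * ∏ i, x i ^ a i := by
    intro a _
    refine Integrable.mul_const (Continuous.integrable_of_hasCompactSupport ?_ ?_) _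
    · exact hf.mul (contDiff_polyFun (coeff a Q)).continuous
    · exact hfc.mul_right
  calc ∫ t, (ContinuousLinearMap.lsmul ℝ ℝ) (polyFun q (x - t)) (f t)
      = ∫ t, ∑ a ∈ Q.support, (f t * eval t.ofLp (coeff a Q)) * ∏ i, x i ^ a i := by
        refine integral_congr_ae (Eventually.of_forall fun t => ?_)
        simp only [ContinuousLinearMap.lsmul_apply, smul_eq_mul, hQ, Finset.sum_mul]
        exact Finset.sum_congr rfl fun a _ => by ring
    _ = _ := by
        rw [integral_finsetSum _ hint]
        simp only [polyFun, map_sum, eval_monomial, integral_mul_const,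
          Finsupp.prod_fintype _ _ fun i => pow_zero _]

theorem exists_polyFun_near {g : EuclideanSpace ℝ (Fin n) → ℝ} (hg : Continuous g)
    {K : Set (EuclideanSpace ℝ (Fin n))} (hK : IsCompact K) {ε : ℝ} (hε : 0 < ε) :
    ∃ q : MvPolynomial (Fin n) ℝ, ∀ x ∈ K, |polyFun q x - g x| < ε := by
  let coord : Fin n → C(EuclideanSpace ℝ (Fin n), ℝ) := fun i => ⟨fun z => z i, by fun_prop⟩
  let A : Subalgebra ℝ C(EuclideanSpace ℝ (Fin n), ℝ) := (aeval (R := ℝ) coord).range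
  have hA : A.SeparatesPoints := by
    intro x y hxy
    obtain ⟨i, hi⟩ : ∃ i, x i ≠ y i := by
      by_contra! h
      exact hxy (by ext i; exact h i)
    exact ⟨coord i, ⟨coord i, ⟨X i, by simp⟩, rfl⟩, hi⟩
  obtain ⟨_, ⟨q, rfl⟩, h⟩ :=
    ContinuousMap.exists_mem_subalgebra_near_continuous_of_isCompact_of_separatesPoints hA
      ⟨g, hg⟩ hK hε
  refine ⟨q, fun x hx => ?_⟩
  have h2 : (aeval (R := ℝ) coord q) x = polyFun q x := by
    clear h
    induction q using MvPolynomial.induction_on with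
    | C a => simp [polyFun]
    | add p q hp hq => simp_all [polyFun]
    | mul_X p i hp => simp_all [polyFun, coord]
  simpa [h2] using h x hx

/-- Polynomials are approximate units for the convolution on compact sets. -/
theorem exists_polyFun_convolution_near {S : Set (EuclideanSpace ℝ (Fin n) → ℝ)} (hS : S.Finite)
    (hSc : ∀ h ∈ S, Continuous h ∧ HasCompactSupport h)
    {K : Set (EuclideanSpace ℝ (Fin n))} (hK : IsCompact K) {ε : ℝ} (hε : 0 < ε) :
    ∃ q : MvPolynomial (Fin n) ℝ, ∀ h ∈ S, ∀ x ∈ K,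
      |h x - (polyFun q ⋆[ContinuousLinearMap.lsmul ℝ ℝ, volume] h) x| < ε := by
  have h1 : ∀ᶠ δ in 𝓝[>] (0 : ℝ), ∀ h ∈ S, ∀ x y, dist x y < δ → dist (h x) (h y) < ε / 2 := by
    rw [eventually_all_finite hS]
    intro h hh
    obtain ⟨δ, hδ, hu⟩ := Metric.uniformContinuous_iff.1
      ((hSc h hh).2.uniformContinuous_of_continuous (hSc h hh).1) (ε / 2) (by positivity)
    filter_upwards [Ioo_mem_nhdsGT hδ] with δ' hδ' x y hxy using hu (hxy.trans hδ'.2)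
  obtain ⟨δ, hδ, hδ0 : 0 < δ⟩ := (h1.and self_mem_nhdsWithin).exists
  have h2 : ∀ᶠ η in 𝓝[>] (0 : ℝ), ∀ h ∈ S, η * ∫ t, |h t| < ε / 2 := by
    rw [eventually_all_finite hS]
    intro h hh
    have : Tendsto (fun η : ℝ => η * ∫ t, |h t|) (𝓝[>] 0) (𝓝 (0 * ∫ t, |h t|)) :=
      (continuous_id.mul continuous_const).continuousAt.tendsto.mono_left nhdsWithin_le_nhds
    rw [zero_mul] at this
    exact this.eventually_lt_const (by positivity)
  obtain ⟨η, hη, hη0 : 0 < η⟩ := (h2.and self_mem_nhdsWithin).exists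
  let φ : ContDiffBump (0 : EuclideanSpace ℝ (Fin n)) := ⟨δ / 2, δ, by positivity, by linarith⟩
  obtain ⟨T, hT, hTS⟩ : ∃ T : Set (EuclideanSpace ℝ (Fin n)), IsCompact T ∧
      ∀ h ∈ S, ∀ t ∉ T, h t = 0 :=
    ⟨⋃ h ∈ S, tsupport h, hS.isCompact_biUnion fun h hh => (hSc h hh).2, fun h hh t ht =>
      image_eq_zero_of_notMem_tsupport fun h' => ht (mem_biUnion hh h')⟩
  have hφc : Continuous (φ.normed volume) := φ.continuous_normed
  -- The kernel is evaluated at `x - t` with `x ∈ K` and `t` in a common support `T`, so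
  -- approximation on the compact set `K - T` is enough.
  obtain ⟨q, hq⟩ := exists_polyFun_near hφc ((hK.prod hT).image continuous_sub) hη0
  refine ⟨q, fun h hh x hx => ?_⟩
  obtain ⟨hc, hcs⟩ := hSc h hh
  have e1 : dist ((φ.normed volume ⋆[ContinuousLinearMap.lsmul ℝ ℝ, volume] h) x) (h x) ≤ ε / 2 :=
    φ.dist_normed_convolution_le hc.aestronglyMeasurable
      fun y hy => (hδ h hh _ _ (by simpa using hy)).le
  have hi : ∀ κ : EuclideanSpace ℝ (Fin n) → ℝ, Continuous κ →
      Integrable fun t => κ (x - t) * h t := fun κ hκ =>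
    (Continuous.mul (hκ.comp (continuous_const.sub continuous_id)) hc).integrable_of_hasCompactSupport
      hcs.mul_left
  have e2 : |(φ.normed volume ⋆[ContinuousLinearMap.lsmul ℝ ℝ, volume] h) x -
      (polyFun q ⋆[ContinuousLinearMap.lsmul ℝ ℝ, volume] h) x| ≤ η * ∫ t, |h t| := by
    rw [convolution_eq_swap, convolution_eq_swap]
    simp only [ContinuousLinearMap.lsmul_apply, smul_eq_mul]
    rw [← integral_sub (hi _ hφc) (hi _ (contDiff_polyFun q).continuous), ← integral_const_mul]
    refine (abs_integral_le_integral_abs).trans (integral_mono_of_nonneg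
      (Eventually.of_forall fun _ => abs_nonneg _)
      (((hc.integrable_of_hasCompactSupport hcs).abs).const_mul η)
      (Eventually.of_forall fun t => ?_))
    simp only
    rw [← sub_mul, abs_mul]
    by_cases ht : t ∈ T
    · gcongr
      rw [abs_sub_comm]
      exact (hq _ ⟨(x, t), ⟨hx, ht⟩, rfl⟩).le
    · simp [hTS h hh t ht]
  have e3 := hη h hh
  rw [Real.dist_eq, abs_sub_comm] at e1
  have := abs_sub_le (h x) ((φ.normed volume ⋆[ContinuousLinearMap.lsmul ℝ ℝ, volume] h) x)
    ((polyFun q ⋆[ContinuousLinearMap.lsmul ℝ ℝ, volume] h) x)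
  linarith

/-- The Weierstrass approximation theorem with derivatives. -/
theorem exists_polyFun_iteratedFDeriv_near {f : EuclideanSpace ℝ (Fin n) → ℝ}
    (hf : ContDiff ℝ ∞ f) (hfc : HasCompactSupport f) (s : ℕ)
    {K : Set (EuclideanSpace ℝ (Fin n))} (hK : IsCompact K) {ε : ℝ} (hε : 0 < ε) :
    ∃ P : MvPolynomial (Fin n) ℝ, ∀ l ≤ s, ∀ z ∈ K,
      ‖iteratedFDeriv ℝ l (fun z => f z - polyFun P z) z‖ < ε := by
  -- `c` exceeds the number of index strings of each length up to `s`, because the norm of a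
  -- derivative is bounded by the sum of its coordinate derivatives.
  obtain ⟨c, hc0, hc⟩ : ∃ c : ℝ, 0 < c ∧ ∀ l ≤ s, (Fintype.card (Fin l → Fin n) : ℝ) < c := by
    refine ⟨1 + ∑ l ∈ Finset.range (s + 1), (Fintype.card (Fin l → Fin n) : ℝ), by positivity,
      fun l hl => ?_⟩
    have := Finset.single_le_sum (f := fun l => (Fintype.card (Fin l → Fin n) : ℝ))
      (s := Finset.range (s + 1)) (fun _ _ => by positivity) (Finset.mem_range.2 (by omega : l < s + 1))
    linarith
  have hS : ((fun w => wderiv w f) '' {w | w.length ≤ s}).Finite :=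
    (List.finite_length_le (Fin n) s).image _
  obtain ⟨q, hq⟩ := exists_polyFun_convolution_near hS (by
    rintro _ ⟨w, _, rfl⟩
    exact ⟨(contDiff_wderiv hf w).continuous, hasCompactSupport_wderiv hfc w⟩) hK
    (ε := ε / c) (by positivity)
  obtain ⟨P, hP⟩ := exists_polyFun_eq_convolution q hf.continuous hfc
  refine ⟨P, fun l hl z hz => ?_⟩
  have hsm : ContDiff ℝ ∞ fun z => f z - polyFun P z := hf.sub (contDiff_polyFun P)
  refine (norm_iteratedFDeriv_le_sum l z).trans_lt ?_
  calc _ ≤ ∑ β : Fin l → Fin n, ε / c := by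
        refine Finset.sum_le_sum fun β _ => ?_
        rw [← wderiv_ofFn isOpen_univ hsm.contDiffOn β z (mem_univ z),
          wderiv_sub isOpen_univ hf.contDiffOn (contDiff_polyFun P).contDiffOn _ (mem_univ z),
          ← hP, wderiv_convolution (contDiff_polyFun q).continuous hf hfc]
        exact (hq _ ⟨_, by simpa using hl, rfl⟩ z hz).le
    _ = Fintype.card (Fin l → Fin n) * (ε / c) := by simp
    _ < c * (ε / c) := by
        have := hc l hl
        gcongr
    _ = ε := by field_simp

end UTSJets

/-! ### Derivatives in other coordinates -/

/-- The last elements of the parts form a strictly increasing map of `Fin k` to itself, hence the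
identity. A part with a second element would then meet the part in which that element is last. -/
theorem OrderedFinpartition.eq_atomic_of_length_eq {r : ℕ} (c : OrderedFinpartition r)
    (hc : c.length = r) : c = OrderedFinpartition.atomic r := by
  obtain ⟨k, size, pos, emb, mono, parts, disj, cover⟩ := c
  simp only at hc
  subst hc
  have hlast : ∀ m, emb m ⟨size m - 1, Nat.sub_one_lt_of_lt (pos m)⟩ = m := by
    have h := Subsingleton.elim (α := Fin k ≃o Fin k) (StrictMono.orderIsoOfSurjective _ parts
      (Finite.surjective_of_injective parts.injective)) (OrderIso.refl _)
    exact fun m => DFunLike.congr_fun h m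
  obtain rfl : size = fun _ => 1 := by
    funext m
    by_contra hm
    have h1 : 1 < size m := lt_of_le_of_ne (pos m) (Ne.symm hm)
    set i := emb m ⟨0, pos m⟩ with hi
    have him : i ≠ m := by
      intro h
      have := (mono m).injective ((hi.symm.trans h).trans (hlast m).symm)
      simp at this
      omega
    exact Set.disjoint_left.1 (disj (mem_univ i) (mem_univ m) him) ⟨_, hlast i⟩ ⟨_, hi.symm⟩
  simp only [OrderedFinpartition.ext_iff, OrderedFinpartition.atomic]
  refine ⟨trivial, HEq.rfl, heq_of_eq ?_⟩
  funext m i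
  rw [Subsingleton.elim i 0]
  exact hlast m

theorem OrderedFinpartition.length_lt_of_ne_atomic {r : ℕ} {c : OrderedFinpartition r}
    (hc : c ≠ OrderedFinpartition.atomic r) : c.length < r :=
  lt_of_le_of_ne c.length_le fun h => hc (c.eq_atomic_of_length_eq h)

theorem exists_perm_of_ofFn_perm {α : Type*} [DecidableEq α] {k : ℕ} {f g : Fin k → α}
    (h : (List.ofFn f).Perm (List.ofFn g)) : ∃ σ : Equiv.Perm (Fin k), g ∘ σ = f := by
  have hcard : ∀ c, Fintype.card {a // f a = c} = Fintype.card {a // g a = c} := by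
    intro c
    have := (h.map fun x => if x = c then 1 else 0).sum_eq
    rw [Fintype.card_subtype, Fintype.card_subtype, Finset.card_filter, Finset.card_filter]
    simpa only [List.map_ofFn, List.sum_ofFn, Function.comp_apply] using this
  refine ⟨Equiv.ofFiberEquiv fun c => Fintype.equivOfCardEq (hcard c), ?_⟩
  ext a
  exact Equiv.ofFiberEquiv_map _ a

/-! ### The Faà di Bruno formula for iterated derivatives. -/

section

variable {E F G : Type*} [NormedAddCommGroup E] [NormedSpace ℝ E] [NormedAddCommGroup F]
  [NormedSpace ℝ F] [NormedAddCommGroup G] [NormedSpace ℝ G]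

theorem iteratedFDeriv_comp_apply {g : F → G} {f : E → F} {x : E} {r : ℕ}
    (hg : ContDiffAt ℝ r g (f x)) (hf : ContDiffAt ℝ r f x) (v : Fin r → E) :
    iteratedFDeriv ℝ r (g ∘ f) x v = ∑ c : OrderedFinpartition r,
      iteratedFDeriv ℝ c.length g (f x) fun m => iteratedFDeriv ℝ (c.partSize m) f x (v ∘ c.emb m) := by
  rw [iteratedFDeriv_comp hg hf le_rfl, FormalMultilinearSeries.taylorComp, sum_apply]
  rfl

/-- If all derivatives of lower order of the outer function vanish, then only the highest order
derivative contributes. -/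
theorem iteratedFDeriv_comp_apply_of_forall_lt {g : F → G} {f : E → F} {x : E} {r : ℕ}
    (hg : ContDiffAt ℝ r g (f x)) (hf : ContDiffAt ℝ r f x)
    (h0 : ∀ j < r, iteratedFDeriv ℝ j g (f x) = 0) (v : Fin r → E) :
    iteratedFDeriv ℝ r (g ∘ f) x v =
      iteratedFDeriv ℝ r g (f x) fun i => fderiv ℝ f x (v i) := by
  rw [iteratedFDeriv_comp_apply hg hf, Finset.sum_eq_single (OrderedFinpartition.atomic r)]
  · change iteratedFDeriv ℝ r g (f x) (fun m : Fin r => iteratedFDeriv ℝ 1 f x fun _ => v m) = _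
    simp only [iteratedFDeriv_one_apply]
  · intro c _ hc
    rw [h0 _ (OrderedFinpartition.length_lt_of_ne_atomic hc)]
    rfl
  · simp

end

namespace UTSJets

variable {n : ℕ}

theorem contDiffAt_wderiv {f : EuclideanSpace ℝ (Fin n) → ℝ} {z : EuclideanSpace ℝ (Fin n)}
    (w : List (Fin n)) {k N : ℕ} (hk : k + w.length ≤ N) (hf : ContDiffAt ℝ N f z) :
    ContDiffAt ℝ k (wderiv w f) z := by
  induction w generalizing k with
  | nil => exact hf.of_le (by exact_mod_cast (by simpa using hk))
  | cons i w ih =>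
    have := ih (k := k + 1) (by simp at hk; omega)
    exact (this.fderiv_right (m := k) (by norm_cast)).clm_apply contDiffAt_const

theorem wderiv_ofFn_of_contDiffAt {f : EuclideanSpace ℝ (Fin n) → ℝ}
    {z : EuclideanSpace ℝ (Fin n)} {l N : ℕ} (hl : l ≤ N) (hf : ContDiffAt ℝ N f z)
    (β : Fin l → Fin n) :
    wderiv (List.ofFn β) f z =
      iteratedFDeriv ℝ l f z fun i => EuclideanSpace.single (β i) (1 : ℝ) := by
  induction l generalizing z with
  | zero => simp [wderiv]
  | succ l ih =>
    rw [List.ofFn_succ, iteratedFDeriv_succ_apply_left, wderiv_cons]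
    have h1 : wderiv (List.ofFn fun i => β (Fin.succ i)) f =ᶠ[𝓝 z] fun z =>
        iteratedFDeriv ℝ l f z fun i => EuclideanSpace.single (β i.succ) (1 : ℝ) := by
      filter_upwards [hf.eventually (by simp)] with y hy
      exact ih (by omega) hy fun i => β i.succ
    rw [h1.fderiv_eq]
    have h2 : DifferentiableAt ℝ (iteratedFDeriv ℝ l f) z :=
      hf.differentiableAt_iteratedFDeriv (by exact_mod_cast hl)
    have h3 := ((ContinuousMultilinearMap.apply ℝ (fun _ : Fin l => EuclideanSpace ℝ (Fin n)) ℝ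
      fun i => EuclideanSpace.single (β i.succ) (1 : ℝ)).hasFDerivAt.comp z h2.hasFDerivAt).fderiv
    exact DFunLike.congr_fun h3 _

theorem wderiv_perm_of_contDiffAt {f : EuclideanSpace ℝ (Fin n) → ℝ}
    {z : EuclideanSpace ℝ (Fin n)} {N : ℕ} {w w' : List (Fin n)} (h : w.Perm w')
    (hw : w.length ≤ N) (hf : ContDiffAt ℝ N f z) : wderiv w f z = wderiv w' f z := by
  induction h generalizing z with
  | nil => rfl
  | @cons k w w' hww ih =>
    have : wderiv w f =ᶠ[𝓝 z] wderiv w' f := by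
      filter_upwards [hf.eventually (by simp)] with y hy using ih (by simp at hw; omega) hy
    rw [wderiv_cons, wderiv_cons, this.fderiv_eq]
  | trans h₁ _ ih₁ ih₂ => exact (ih₁ hw hf).trans (ih₂ (by rwa [← h₁.length_eq]) hf)
  | swap k l w =>
    have hg : ContDiffAt ℝ 2 (wderiv w f) z :=
      contDiffAt_wderiv w (k := 2) (by simp at hw; omega) hf
    have hd : DifferentiableAt ℝ (fderiv ℝ (wderiv w f)) z :=
      ((hg.fderiv_right (m := 1) (by norm_num)).differentiableAt (by simp))
    have hs := hg.isSymmSndFDerivAt (by simp)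
    simp only [wderiv]
    rw [fderiv_clm_apply hd (by fun_prop), fderiv_clm_apply hd (by fun_prop)]
    simpa using hs.eq _ _

theorem iteratedFDeriv_single_comp_perm {f : EuclideanSpace ℝ (Fin n) → ℝ}
    {z : EuclideanSpace ℝ (Fin n)} {l N : ℕ} (hl : l ≤ N) (hf : ContDiffAt ℝ N f z)
    (β : Fin l → Fin n) (σ : Equiv.Perm (Fin l)) :
    (iteratedFDeriv ℝ l f z fun i => EuclideanSpace.single ((β ∘ σ) i) (1 : ℝ)) =
      iteratedFDeriv ℝ l f z fun i => EuclideanSpace.single (β i) (1 : ℝ) := by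
  rw [← wderiv_ofFn_of_contDiffAt hl hf, ← wderiv_ofFn_of_contDiffAt hl hf]
  exact wderiv_perm_of_contDiffAt (Equiv.Perm.ofFn_comp_perm σ β) (by simpa using hl) hf

/-! ### Coefficients of operators in other coordinates -/

/-- The contribution of a partition to the coefficients in new coordinates. -/
noncomputable def partCoeff {r : ℕ} (τ : EuclideanSpace ℝ (Fin n) → EuclideanSpace ℝ (Fin n))
    (c : OrderedFinpartition r) (β : Fin r → Fin n) (γ : Fin c.length → Fin n)
    (y : EuclideanSpace ℝ (Fin n)) : ℝ :=
  ∏ m, (iteratedFDeriv ℝ (c.partSize m) τ y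
    fun i => EuclideanSpace.single (β (c.emb m i)) (1 : ℝ)) (γ m)

/-- The coefficients of order `j` of `∂_β` in the coordinates `τ`. -/
noncomputable def chainCoeff {r : ℕ} (τ : EuclideanSpace ℝ (Fin n) → EuclideanSpace ℝ (Fin n))
    (j : ℕ) (γ : Fin j → Fin n) (β : Fin r → Fin n) (y : EuclideanSpace ℝ (Fin n)) : ℝ :=
  ∑ c : OrderedFinpartition r, if h : c.length = j then
    (j.factorial : ℝ)⁻¹ * ∑ π : Equiv.Perm (Fin j), partCoeff τ c β (γ ∘ π ∘ Fin.cast h) y else 0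

theorem chainCoeff_comp_perm {r : ℕ} (τ : EuclideanSpace ℝ (Fin n) → EuclideanSpace ℝ (Fin n))
    (j : ℕ) (γ : Fin j → Fin n) (β : Fin r → Fin n) (σ : Equiv.Perm (Fin j)) :
    chainCoeff τ j (γ ∘ σ) β = chainCoeff τ j γ β := by
  ext y
  refine Finset.sum_congr rfl fun c _ => ?_
  split_ifs with h
  · congr 1
    exact Fintype.sum_equiv (Equiv.mulLeft σ) _ _ fun π => rfl
  · rfl

/-- Faà di Bruno's formula with the partitions grouped by their number `j` of parts. The averaging
over permutations in `chainCoeff` makes the coefficients symmetric and is harmless because mixed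
partial derivatives commute. -/
theorem iteratedFDeriv_comp_eq_sum_chainCoeff {r : ℕ}
    {τ : EuclideanSpace ℝ (Fin n) → EuclideanSpace ℝ (Fin n)} {y : EuclideanSpace ℝ (Fin n)}
    (hτ : ContDiffAt ℝ r τ y) {g : EuclideanSpace ℝ (Fin n) → ℝ} (hg : ContDiffAt ℝ r g (τ y))
    (β : Fin r → Fin n) :
    (iteratedFDeriv ℝ r (g ∘ τ) y fun i => EuclideanSpace.single (β i) (1 : ℝ)) =
      ∑ j : Fin (r + 1), ∑ γ : Fin j → Fin n, chainCoeff τ j γ β y *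
        iteratedFDeriv ℝ j g (τ y) fun i => EuclideanSpace.single (γ i) (1 : ℝ) := by
  have h1 : ∀ j : Fin (r + 1), ∑ γ : Fin j → Fin n, chainCoeff τ j γ β y *
        (iteratedFDeriv ℝ j g (τ y) fun i => EuclideanSpace.single (γ i) (1 : ℝ)) =
      ∑ c : OrderedFinpartition r, if h : c.length = j then
        ∑ γ : Fin j → Fin n, partCoeff τ c β (γ ∘ Fin.cast h) y *
        (iteratedFDeriv ℝ j g (τ y) fun i => EuclideanSpace.single (γ i) (1 : ℝ)) else 0 := by
    intro j
    simp only [chainCoeff, Finset.sum_mul]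
    rw [Finset.sum_comm]
    refine Finset.sum_congr rfl fun c _ => ?_
    split_ifs with h
    · simp only [mul_assoc, ← Finset.mul_sum, Finset.sum_mul]
      rw [Finset.sum_comm]
      have : ∀ π : Equiv.Perm (Fin j), ∑ γ : Fin j → Fin n,
          partCoeff τ c β (γ ∘ π ∘ Fin.cast h) y *
            (iteratedFDeriv ℝ j g (τ y) fun i => EuclideanSpace.single (γ i) (1 : ℝ)) =
          ∑ γ : Fin j → Fin n, partCoeff τ c β (γ ∘ Fin.cast h) y *
            (iteratedFDeriv ℝ j g (τ y) fun i => EuclideanSpace.single (γ i) (1 : ℝ)) := by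
        intro π
        refine Fintype.sum_equiv (Equiv.arrowCongr π.symm (Equiv.refl _)) _ _ fun γ => ?_
        have h2 := iteratedFDeriv_single_comp_perm (Nat.lt_succ_iff.1 j.2) hg γ π
        rw [← h2]
        rfl
      simp only [this, Finset.sum_const, Finset.card_univ, Fintype.card_perm, Fintype.card_fin,
        nsmul_eq_mul]
      rw [inv_mul_cancel_left₀ (by positivity)]
    · simp
  simp only [h1]
  rw [Finset.sum_comm, iteratedFDeriv_comp_apply hg hτ]
  refine Finset.sum_congr rfl fun c _ => ?_
  rw [Finset.sum_eq_single (⟨c.length, Nat.lt_succ_iff.2 c.length_le⟩ : Fin (r + 1))]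
  · have hv : (fun m => iteratedFDeriv ℝ (c.partSize m) τ y
        ((fun i => EuclideanSpace.single (β i) (1 : ℝ)) ∘ c.emb m)) = fun m => ∑ k : Fin n,
        (iteratedFDeriv ℝ (c.partSize m) τ y
          fun i => EuclideanSpace.single (β (c.emb m i)) (1 : ℝ)) k •
          EuclideanSpace.single k (1 : ℝ) := by
      funext m
      conv_lhs => rw [← (EuclideanSpace.basisFun (Fin n) ℝ).sum_repr (iteratedFDeriv ℝ
        (c.partSize m) τ y ((fun i => EuclideanSpace.single (β i) (1 : ℝ)) ∘ c.emb m))]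
      simp [Function.comp_def]
    rw [hv, ContinuousMultilinearMap.map_sum, dif_pos rfl]
    refine Finset.sum_congr rfl fun γ _ => ?_
    rw [ContinuousMultilinearMap.map_smul_univ]
    rfl
  · intro j _ hj
    rw [dif_neg]
    exact fun h => hj (Fin.ext h.symm)
  · simp

/-- The coefficients of highest order of a symmetric homogeneous operator. -/
theorem sum_mul_chainCoeff_self {r : ℕ}
    {τ : EuclideanSpace ℝ (Fin n) → EuclideanSpace ℝ (Fin n)} {y : EuclideanSpace ℝ (Fin n)}
    {q : (Fin r → Fin n) → ℝ} (hq : ∀ β (π : Equiv.Perm (Fin r)), q (β ∘ π) = q β)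
    (γ : Fin r → Fin n) :
    ∑ β, q β * chainCoeff τ r γ β y = ∑ β, q β * ∏ t,
      (fderiv ℝ τ y (EuclideanSpace.single (β t) (1 : ℝ))) (γ t) := by
  -- Only the partition into singletons has `r` parts. The remaining average over permutations is
  -- absorbed by the symmetry of `q`.
  have h1 : ∀ β : Fin r → Fin n, chainCoeff τ r γ β y = (r.factorial : ℝ)⁻¹ *
      ∑ π : Equiv.Perm (Fin r), ∏ t,
        (fderiv ℝ τ y (EuclideanSpace.single (β t) (1 : ℝ))) (γ (π t)) := by
    intro β
    rw [chainCoeff, Finset.sum_eq_single (OrderedFinpartition.atomic r)]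
    · rw [dif_pos (show (OrderedFinpartition.atomic r).length = r from rfl)]
      congr 1
      refine Finset.sum_congr rfl fun π _ => ?_
      rw [partCoeff]
      refine Finset.prod_congr rfl fun t _ => ?_
      change (iteratedFDeriv ℝ 1 τ y fun _ => EuclideanSpace.single (β t) (1 : ℝ)) (γ (π t)) = _
      rw [iteratedFDeriv_one_apply]
    · intro c _ hc
      rw [dif_neg (OrderedFinpartition.length_lt_of_ne_atomic hc).ne]
    · simp
  simp only [h1, Finset.mul_sum]
  rw [Finset.sum_comm]
  have h2 : ∀ π : Equiv.Perm (Fin r), ∑ β, q β * ((r.factorial : ℝ)⁻¹ * ∏ t,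
      (fderiv ℝ τ y (EuclideanSpace.single (β t) (1 : ℝ))) (γ (π t))) =
      (r.factorial : ℝ)⁻¹ * ∑ β, q β * ∏ t,
      (fderiv ℝ τ y (EuclideanSpace.single (β t) (1 : ℝ))) (γ t) := by
    intro π
    rw [Finset.mul_sum]
    refine Fintype.sum_equiv (Equiv.arrowCongr π (Equiv.refl _)) _ _ fun β => ?_
    have e1 : (Equiv.arrowCongr π (Equiv.refl _)) β = β ∘ π.symm := rfl
    rw [e1, hq]
    have e2 : ∏ t, (fderiv ℝ τ y (EuclideanSpace.single (β t) (1 : ℝ))) (γ (π t)) =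
        ∏ t, (fderiv ℝ τ y (EuclideanSpace.single ((β ∘ π.symm) t) (1 : ℝ))) (γ t) := by
      refine Fintype.prod_equiv π _ _ fun t => ?_
      simp
    rw [e2]
    ring
  simp only [h2, Finset.sum_const, Finset.card_univ, Fintype.card_perm, Fintype.card_fin,
    nsmul_eq_mul]
  rw [mul_inv_cancel_left₀ (by positivity)]

theorem contDiffOn_chainCoeff {r : ℕ} {O : Set (EuclideanSpace ℝ (Fin n))} (hO : IsOpen O)
    {τ : EuclideanSpace ℝ (Fin n) → EuclideanSpace ℝ (Fin n)} (hτ : ContDiffOn ℝ ∞ τ O)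
    (j : ℕ) (γ : Fin j → Fin n) (β : Fin r → Fin n) :
    ContDiffOn ℝ ∞ (chainCoeff τ j γ β) O := by
  refine ContDiffOn.sum fun c _ => ?_
  split_ifs with h
  · refine contDiffOn_const.mul (ContDiffOn.sum fun π _ => contDiffOn_prod fun m _ => ?_)
    have h1 : ContDiffOn ℝ ∞ (iteratedFDeriv ℝ (c.partSize m) τ) O := by
      exact fun z hz => ((hτ.contDiffAt (hO.mem_nhds hz)).iteratedFDeriv_right
        (i := c.partSize m) (m := ∞) (by norm_cast)).contDiffWithinAt
    have h2 := ((ContinuousMultilinearMap.apply ℝ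
      (fun _ : Fin (c.partSize m) => EuclideanSpace ℝ (Fin n)) (EuclideanSpace ℝ (Fin n))
      fun i => EuclideanSpace.single (β (c.emb m i)) (1 : ℝ)).contDiff (n := ∞)).comp_contDiffOn h1
    exact (EuclideanSpace.proj (𝕜 := ℝ) ((γ ∘ π ∘ Fin.cast h) m)).contDiff.comp_contDiffOn h2
  · exact contDiffOn_const

end UTSJets

/-! ### Bounds for derivatives of products and compositions on compact sets -/

namespace UTSJets

section Bounds

variable {n : ℕ} {O : Set (EuclideanSpace ℝ (Fin n))} (hO : IsOpen O)

include hO in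
theorem exists_forall_norm_iteratedFDeriv_le {F : Type*} [NormedAddCommGroup F] [NormedSpace ℝ F]
    {ψ : EuclideanSpace ℝ (Fin n) → F} (hψ : ContDiffOn ℝ ∞ ψ O)
    {K : Set (EuclideanSpace ℝ (Fin n))} (hK : IsCompact K) (hKO : K ⊆ O) (s : ℕ) :
    ∃ D : ℝ, 1 ≤ D ∧ ∀ l ≤ s, ∀ z ∈ K, ‖iteratedFDeriv ℝ l ψ z‖ ≤ D := by
  have h1 : ∀ l : ℕ, ∃ D : ℝ, 0 ≤ D ∧ ∀ z ∈ K, ‖iteratedFDeriv ℝ l ψ z‖ ≤ D := by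
    intro l
    have hc : ContinuousOn (iteratedFDeriv ℝ l ψ) O :=
      (hψ.continuousOn_iteratedFDerivWithin (m := l) (by exact_mod_cast le_top)
        hO.uniqueDiffOn).congr fun z hz => (iteratedFDerivWithin_of_isOpen l hO hz).symm
    obtain ⟨D, hD⟩ := hK.exists_bound_of_continuousOn (hc.mono hKO)
    exact ⟨max D 0, le_max_right _ _, fun z hz => (hD z hz).trans (le_max_left _ _)⟩
  choose D hD0 hD using h1
  refine ⟨1 + ∑ l ∈ Finset.range (s + 1), D l, ?_, fun l hl z hz => ?_⟩
  · have := Finset.sum_nonneg fun l (_ : l ∈ Finset.range (s + 1)) => hD0 l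
    linarith
  · have := Finset.single_le_sum (f := D) (s := Finset.range (s + 1)) (fun l _ => hD0 l)
      (Finset.mem_range.2 (by omega : l < s + 1))
    linarith [hD l z hz]

-- Leibniz rule and composition estimate. The constant does not depend on `f`, so the size of a
-- perturbation can be chosen after it; bounds `D ≥ 1` are used so that `D ≤ D ^ j`.
include hO in
theorem exists_forall_norm_iteratedFDeriv_comp_mul_le
    {ψ : EuclideanSpace ℝ (Fin n) → EuclideanSpace ℝ (Fin n)} (hψ : ContDiffOn ℝ ∞ ψ O)
    {B : EuclideanSpace ℝ (Fin n) → ℝ} (hB : ContDiffOn ℝ ∞ B O)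
    {K : Set (EuclideanSpace ℝ (Fin n))} (hK : IsCompact K) (hKO : K ⊆ O) (s : ℕ) :
    ∃ C : ℝ, 0 ≤ C ∧ ∀ (f : EuclideanSpace ℝ (Fin n) → ℝ) (δ : ℝ), ContDiff ℝ ∞ f →
      (∀ l ≤ s, ∀ z ∈ K, ‖iteratedFDeriv ℝ l f (ψ z)‖ ≤ δ) →
      ∀ l ≤ s, ∀ z ∈ K, ‖iteratedFDeriv ℝ l (fun z => f (ψ z) * B z) z‖ ≤ C * δ := by
  obtain ⟨D, hD1, hD⟩ := exists_forall_norm_iteratedFDeriv_le hO hψ hK hKO s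
  obtain ⟨D', hD'1, hD'⟩ := exists_forall_norm_iteratedFDeriv_le hO hB hK hKO s
  let c : ℕ → ℝ := fun l => ∑ i ∈ Finset.range (l + 1),
    (l.choose i : ℝ) * (i.factorial * D ^ i) * D'
  have hc0 : ∀ l, 0 ≤ c l := fun l => Finset.sum_nonneg fun i _ => by positivity
  refine ⟨∑ l ∈ Finset.range (s + 1), c l, Finset.sum_nonneg fun l _ => hc0 l,
    fun f δ hf hδ l hl z hz => ?_⟩
  have hzO := hKO hz
  have hδ0 : 0 ≤ δ := (norm_nonneg _).trans (hδ 0 (Nat.zero_le _) z hz)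
  have h1 : ∀ i ≤ s, ‖iteratedFDerivWithin ℝ i (fun z => f (ψ z)) O z‖ ≤ i.factorial * δ * D ^ i := by
    intro i hi
    refine norm_iteratedFDerivWithin_comp_le (g := f) (f := ψ) (t := univ) (N := ∞)
      hf.contDiffOn hψ (by exact_mod_cast le_top)
      uniqueDiffOn_univ hO.uniqueDiffOn (mapsTo_univ _ _) hzO ?_ ?_
    · intro j hj
      rw [iteratedFDerivWithin_univ]
      exact hδ j (hj.trans hi) z hz
    · intro j hj1 hj
      rw [iteratedFDerivWithin_of_isOpen j hO hzO]
      exact (hD j (hj.trans hi) z hz).trans (le_self_pow₀ hD1 (by omega))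
  have h2 : ∀ i ≤ s, ‖iteratedFDerivWithin ℝ i B O z‖ ≤ D' := by
    intro i hi
    rw [iteratedFDerivWithin_of_isOpen i hO hzO]
    exact hD' i hi z hz
  rw [← iteratedFDerivWithin_of_isOpen l hO hzO]
  refine (norm_iteratedFDerivWithin_mul_le (N := ∞) (hf.comp_contDiffOn hψ) hB hO.uniqueDiffOn hzO
    (by exact_mod_cast le_top)).trans ?_
  calc _ ≤ ∑ i ∈ Finset.range (l + 1), (l.choose i : ℝ) * (i.factorial * δ * D ^ i) * D' := by
        refine Finset.sum_le_sum fun i hi => ?_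
        have hi' : i < l + 1 := Finset.mem_range.1 hi
        gcongr
        · exact h1 i (by omega)
        · exact h2 _ (by omega)
    _ = c l * δ := by
        rw [Finset.sum_mul]
        exact Finset.sum_congr rfl fun i _ => by ring
    _ ≤ _ := by
        gcongr
        exact Finset.single_le_sum (f := c) (fun l _ => hc0 l)
          (Finset.mem_range.2 (by omega : l < s + 1))

end Bounds

end UTSJets

/-! ### Coordinate changes and composition with charts -/

section Charts

variable {n : ℕ} {M : Type*} [TopologicalSpace M] [ChartedSpace (EuclideanSpace ℝ (Fin n)) M]
  [IsManifold (𝓡 n) ∞ M] {e e' : OpenPartialHomeomorph M (EuclideanSpace ℝ (Fin n))}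

theorem contDiffOn_transition (he : e ∈ atlas (EuclideanSpace ℝ (Fin n)) M)
    (he' : e' ∈ atlas (EuclideanSpace ℝ (Fin n)) M) :
    ContDiffOn ℝ ∞ (fun z => e' (e.symm z)) (e.target ∩ e.symm ⁻¹' e'.source) := by
  have h1 := contMDiffOn_symm_of_mem_maximalAtlas (I := 𝓡 n) (n := ∞)
    (IsManifold.subset_maximalAtlas he)
  have h2 := contMDiffOn_of_mem_maximalAtlas (I := 𝓡 n) (n := ∞)
    (IsManifold.subset_maximalAtlas he')
  exact contMDiffOn_iff_contDiffOn.1 (h2.comp' h1)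

omit [ChartedSpace (EuclideanSpace ℝ (Fin n)) M] [IsManifold (𝓡 n) ∞ M] in
theorem isOpen_transition_domain (e e' : OpenPartialHomeomorph M (EuclideanSpace ℝ (Fin n))) :
    IsOpen (e.target ∩ e.symm ⁻¹' e'.source) :=
  e.symm.isOpen_inter_preimage e'.open_source

theorem contDiffOn_comp_symm {F : Type*} [NormedAddCommGroup F] [NormedSpace ℝ F]
    {N : WithTop ℕ∞} (hN : N ≤ ∞) (he : e ∈ atlas (EuclideanSpace ℝ (Fin n)) M) {f : M → F}
    {U : Set M} (hf : ContMDiffOn (𝓡 n) 𝓘(ℝ, F) N f U) :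
    ContDiffOn ℝ N (fun z => f (e.symm z)) (e.target ∩ e.symm ⁻¹' U) := by
  have h1 := (contMDiffOn_symm_of_mem_maximalAtlas (I := 𝓡 n) (n := ∞)
    (IsManifold.subset_maximalAtlas he)).of_le hN
  exact contMDiffOn_iff_contDiffOn.1 (hf.comp' h1)

theorem contDiffAt_comp_symm {p : ℕ} {N : WithTop ℕ∞} (hN : N ≤ ∞)
    (he : e ∈ atlas (EuclideanSpace ℝ (Fin n)) M) {f : M → Fin p → ℝ}
    (hf : ContMDiff (𝓡 n) 𝓘(ℝ, Fin p → ℝ) N f) (i : Fin p) {z : EuclideanSpace ℝ (Fin n)}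
    (hz : z ∈ e.target) : ContDiffAt ℝ N (fun z => f (e.symm z) i) z := by
  have h := contDiffOn_comp_symm hN he (contMDiffOn_univ.2 hf)
  have h2 : ContDiffAt ℝ N (fun z => f (e.symm z)) z :=
    h.contDiffAt (by simpa using e.open_target.mem_nhds hz)
  exact contDiffAt_pi.1 h2 i

omit [ChartedSpace (EuclideanSpace ℝ (Fin n)) M] [IsManifold (𝓡 n) ∞ M] in
theorem symm_comp_eventuallyEq {α : Type*} (f : M → α) {x : M} (hx : x ∈ e.source)
    (hx' : x ∈ e'.source) :
    (fun z => f (e'.symm z)) ∘ (fun z => e' (e.symm z)) =ᶠ[𝓝 (e x)] fun z => f (e.symm z) := by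
  have : e.target ∩ e.symm ⁻¹' e'.source ∈ 𝓝 (e x) :=
    (isOpen_transition_domain e e').mem_nhds ⟨e.map_source hx, by simpa [e.left_inv hx] using hx'⟩
  filter_upwards [this] with z hz
  simp only [Function.comp_apply]
  rw [e'.left_inv hz.2]

end Charts

/-! ### Operators with compactly supported highest order coefficients in one chart -/

namespace LinearPDO

open UTSJets

variable {n m r : ℕ} {M : Type*} [TopologicalSpace M]

/-- Data of smooth coefficients with support in a compact subset of a chart. -/
structure SymbolData (e₀ : OpenPartialHomeomorph M (EuclideanSpace ℝ (Fin n)))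
    (T : Set (EuclideanSpace ℝ (Fin n)))
    (q : SymbolIndex n m r → EuclideanSpace ℝ (Fin n) → ℝ) : Prop where
  isCompact : IsCompact T
  subset : T ⊆ e₀.target
  smooth : ∀ κ, ContDiff ℝ ∞ (q κ)
  eq_zero : ∀ κ, ∀ z ∉ T, q κ z = 0
  uts : ∀ z, UTS fun κ => q κ z

open Classical in
/-- The coefficients in the chart `e` of the operator with coefficients `q` in the chart `e₀`. -/
noncomputable def symbolCoeff (e₀ : OpenPartialHomeomorph M (EuclideanSpace ℝ (Fin n)))
    (q : SymbolIndex n m r → EuclideanSpace ℝ (Fin n) → ℝ)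
    (e : OpenPartialHomeomorph M (EuclideanSpace ℝ (Fin n))) (j : ℕ) (a : Fin m)
    (α : Fin (m + 1)) (γ : Fin j → Fin n) (z : EuclideanSpace ℝ (Fin n)) : ℝ :=
  if z ∈ e.target ∩ e.symm ⁻¹' e₀.source then ∑ β : Fin r → Fin n,
    q (a, α, β) (e₀ (e.symm z)) * chainCoeff (fun z => e (e₀.symm z)) j γ β (e₀ (e.symm z)) else 0

section

variable {e₀ e : OpenPartialHomeomorph M (EuclideanSpace ℝ (Fin n))}
  {T : Set (EuclideanSpace ℝ (Fin n))}
  {q : SymbolIndex n m r → EuclideanSpace ℝ (Fin n) → ℝ}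

theorem SymbolData.comp_perm (hq : SymbolData e₀ T q) (a : Fin m) (α : Fin (m + 1)) (β : Fin r → Fin n)
    (π : Equiv.Perm (Fin r)) (z : EuclideanSpace ℝ (Fin n)) :
    q (a, α, β ∘ π) z = q (a, α, β) z := by
  refine hq.uts z a α α (β ∘ π) β (List.Perm.cons _ ?_)
  exact Equiv.Perm.ofFn_comp_perm π fun i => (β i : ℕ)

theorem symbolCoeff_of_mem {z : EuclideanSpace ℝ (Fin n)}
    (hz : z ∈ e.target ∩ e.symm ⁻¹' e₀.source) (j : ℕ) (a : Fin m) (α : Fin (m + 1))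
    (γ : Fin j → Fin n) : symbolCoeff e₀ q e j a α γ z = ∑ β : Fin r → Fin n,
      q (a, α, β) (e₀ (e.symm z)) *
        chainCoeff (fun z => e (e₀.symm z)) j γ β (e₀ (e.symm z)) := if_pos hz

theorem symbolCoeff_eq_zero (hq : SymbolData e₀ T q) {z : EuclideanSpace ℝ (Fin n)}
    (hz : e.symm z ∉ e₀.symm '' T) (j : ℕ) (a : Fin m) (α : Fin (m + 1)) (γ : Fin j → Fin n) :
    symbolCoeff e₀ q e j a α γ z = 0 := by
  rw [symbolCoeff]
  split_ifs with h
  · refine Finset.sum_eq_zero fun β _ => ?_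
    rw [hq.eq_zero, zero_mul]
    exact fun h' => hz ⟨_, h', e₀.left_inv h.2⟩
  · rfl

theorem symbolCoeff_eventuallyEq_zero [T2Space M] (hq : SymbolData e₀ T q) {x : M}
    (hxe : x ∈ e.source) (hx : x ∉ e₀.symm '' T) (j : ℕ) (a : Fin m) (α : Fin (m + 1))
    (γ : Fin j → Fin n) : symbolCoeff e₀ q e j a α γ =ᶠ[𝓝 (e x)] fun _ => 0 := by
  have hT : IsClosed (e₀.symm '' T) :=
    (hq.isCompact.image_of_continuousOn (e₀.continuousOn_symm.mono hq.subset)).isClosed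
  have hV : IsOpen (e.target ∩ e.symm ⁻¹' (e₀.symm '' T)ᶜ) :=
    e.symm.isOpen_inter_preimage hT.isOpen_compl
  filter_upwards [hV.mem_nhds ⟨e.map_source hxe, by simpa [e.left_inv hxe] using hx⟩] with z hz
  exact symbolCoeff_eq_zero hq hz.2 j a α γ

variable [ChartedSpace (EuclideanSpace ℝ (Fin n)) M] [IsManifold (𝓡 n) ∞ M] (he₀ : e₀ ∈ atlas (EuclideanSpace ℝ (Fin n)) M)
  (he : e ∈ atlas (EuclideanSpace ℝ (Fin n)) M)

include he₀ he

theorem contDiffOn_chainCoeff_transition (j : ℕ) (γ : Fin j → Fin n) (β : Fin r → Fin n) :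
    ContDiffOn ℝ ∞ (fun z => chainCoeff (fun z => e (e₀.symm z)) j γ β (e₀ (e.symm z)))
      (e.target ∩ e.symm ⁻¹' e₀.source) := by
  refine (contDiffOn_chainCoeff (isOpen_transition_domain e₀ e) (contDiffOn_transition he₀ he)
    j γ β).comp (contDiffOn_transition he he₀) ?_
  rintro z ⟨h1, h2⟩
  refine ⟨e₀.map_source h2, ?_⟩
  rw [mem_preimage, e₀.left_inv h2]
  exact e.map_target h1

/-- On the overlap this is a smooth composite. At the other points it vanishes nearby, since the
image of the compact set `T` is closed in the Hausdorff space `M`. -/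
theorem contDiffOn_symbolCoeff [T2Space M] (hq : SymbolData e₀ T q) (j : ℕ) (a : Fin m)
    (α : Fin (m + 1)) (γ : Fin j → Fin n) :
    ContDiffOn ℝ ∞ (symbolCoeff e₀ q e j a α γ) e.target := by
  intro z hz
  refine ContDiffAt.contDiffWithinAt ?_
  by_cases h : e.symm z ∈ e₀.source
  · have hO := isOpen_transition_domain e e₀
    have h1 : ContDiffOn ℝ ∞ (fun z => ∑ β : Fin r → Fin n, q (a, α, β) (e₀ (e.symm z)) *
        chainCoeff (fun z => e (e₀.symm z)) j γ β (e₀ (e.symm z)))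
        (e.target ∩ e.symm ⁻¹' e₀.source) := ContDiffOn.sum fun β _ =>
      ((hq.smooth _).comp_contDiffOn (contDiffOn_transition he he₀)).mul
        (contDiffOn_chainCoeff_transition he₀ he j γ β)
    refine (h1.contDiffAt (hO.mem_nhds ⟨hz, h⟩)).congr_of_eventuallyEq ?_
    filter_upwards [hO.mem_nhds ⟨hz, h⟩] with y hy using symbolCoeff_of_mem hy j a α γ
  · have h2 : e.symm z ∉ e₀.symm '' T := by
      rintro ⟨y, hy, hyz⟩
      exact h (hyz ▸ e₀.map_target (hq.subset hy))
    have h3 := symbolCoeff_eventuallyEq_zero (e := e) hq (e.map_target hz) h2 j a α γ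
    rw [e.right_inv hz] at h3
    exact contDiffAt_const.congr_of_eventuallyEq h3

/-- The right-hand side does not mention `e`, which yields the compatibility on overlaps for
`ofSymbol`. -/
theorem localExpr_symbolCoeff {f : M → Fin (m + 1) → ℝ}
    (hf : ContMDiff (𝓡 n) 𝓘(ℝ, Fin (m + 1) → ℝ) r f) {x : M} (hx : x ∈ e.source) (a : Fin m) :
    localExpr r e (fun j a α γ => symbolCoeff e₀ q e j a α γ) f x a =
      open Classical in if x ∈ e₀.source then ∑ α, ∑ β : Fin r → Fin n,
        q (a, α, β) (e₀ x) * coordDeriv e₀ (fun y => f y α) β x else 0 := by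
  classical
  by_cases hx0 : x ∈ e₀.source
  · have hmem : e x ∈ e.target ∩ e.symm ⁻¹' e₀.source :=
      ⟨e.map_source hx, by simpa [e.left_inv hx] using hx0⟩
    have hmem0 : e₀ x ∈ e₀.target ∩ e₀.symm ⁻¹' e.source :=
      ⟨e₀.map_source hx0, by simpa [e₀.left_inv hx0] using hx⟩
    rw [if_pos hx0, localExpr, Finset.sum_comm]
    refine Finset.sum_congr rfl fun α _ => ?_
    have h1 : ∀ β : Fin r → Fin n, coordDeriv e₀ (fun y => f y α) β x =
        ∑ j : Fin (r + 1), ∑ γ : Fin j → Fin n,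
          chainCoeff (fun z => e (e₀.symm z)) j γ β (e₀ x) *
            coordDeriv e (fun y => f y α) γ x := by
      intro β
      have hτ : ContDiffAt ℝ r (fun z => e (e₀.symm z)) (e₀ x) :=
        ((contDiffOn_transition he₀ he).contDiffAt
          ((isOpen_transition_domain e₀ e).mem_nhds hmem0)).of_le (by exact_mod_cast le_top)
      have hg : ContDiffAt ℝ r (fun z => f (e.symm z) α) (e (e₀.symm (e₀ x))) := by
        rw [e₀.left_inv hx0]
        exact contDiffAt_comp_symm (by exact_mod_cast le_top) he hf α (e.map_source hx)
      have h2 := iteratedFDeriv_comp_eq_sum_chainCoeff hτ hg β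
      rw [((symm_comp_eventuallyEq (fun y => f y α) hx0 hx).iteratedFDeriv ℝ r).eq_of_nhds] at h2
      rw [coordDeriv, h2]
      simp only [coordDeriv, e₀.left_inv hx0]
    simp only [h1, Finset.mul_sum]
    rw [Finset.sum_comm]
    refine Finset.sum_congr rfl fun j _ => ?_
    rw [Finset.sum_comm]
    refine Finset.sum_congr rfl fun γ _ => ?_
    rw [symbolCoeff_of_mem hmem, Finset.sum_mul, e.left_inv hx]
    exact Finset.sum_congr rfl fun β _ => by ring
  · rw [if_neg hx0, localExpr]
    refine Finset.sum_eq_zero fun j _ => Finset.sum_eq_zero fun α _ =>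
      Finset.sum_eq_zero fun γ _ => ?_
    rw [symbolCoeff, if_neg, zero_mul]
    rintro ⟨_, h⟩
    exact hx0 (by simpa [e.left_inv hx] using h)

end

section

variable [ChartedSpace (EuclideanSpace ℝ (Fin n)) M] [IsManifold (𝓡 n) ∞ M] [T2Space M]

/-- The operator with the given homogeneous coefficients in the chart `e₀`. -/
noncomputable def ofSymbol (e₀ : atlas (EuclideanSpace ℝ (Fin n)) M)
    {T : Set (EuclideanSpace ℝ (Fin n))}
    {q : SymbolIndex n m r → EuclideanSpace ℝ (Fin n) → ℝ} (hq : SymbolData e₀.1 T q) :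
    LinearPDO n r (m + 1) m M where
  coeff e j a α γ := symbolCoeff e₀.1 q e.1 j a α γ
  smooth e j a α γ := contDiffOn_symbolCoeff e₀.2 e.2 hq j a α γ
  coeff_off e j a α γ z hz := if_neg fun h => hz h.1
  symm e j a α γ π := by
    ext z
    simp only [symbolCoeff, chainCoeff_comp_perm]
  compat e e' x hx f hf a := by
    rw [localExpr_symbolCoeff e₀.2 e.2 hf hx.1, localExpr_symbolCoeff e₀.2 e'.2 hf hx.2]

variable {e₀ : atlas (EuclideanSpace ℝ (Fin n)) M} {T : Set (EuclideanSpace ℝ (Fin n))}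
  {q : SymbolIndex n m r → EuclideanSpace ℝ (Fin n) → ℝ} (hq : SymbolData e₀.1 T q)

theorem ofSymbol_coeff_last {e : atlas (EuclideanSpace ℝ (Fin n)) M} {x : M} (hx : x ∈ e.1.source)
    (hx₀ : x ∈ e₀.1.source) (a : Fin m) (α : Fin (m + 1)) (γ : Fin r → Fin n) :
    (ofSymbol e₀ hq).coeff e (Fin.last r) a α γ (e.1 x) = ∑ β : Fin r → Fin n,
      q (a, α, β) (e₀.1 x) * ∏ t, partialDeriv e₀.1 (fun y => e.1 y (γ t)) (β t) x := by
  have hmem : e.1 x ∈ e.1.target ∩ e.1.symm ⁻¹' e₀.1.source :=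
    ⟨e.1.map_source hx, by simpa [e.1.left_inv hx] using hx₀⟩
  have hmem0 : e₀.1 x ∈ e₀.1.target ∩ e₀.1.symm ⁻¹' e.1.source :=
    ⟨e₀.1.map_source hx₀, by simpa [e₀.1.left_inv hx₀] using hx⟩
  refine (symbolCoeff_of_mem hmem r a α γ).trans ?_
  rw [sum_mul_chainCoeff_self (fun β π => hq.comp_perm a α β π _), e.1.left_inv hx]
  refine Finset.sum_congr rfl fun β _ => ?_
  congr 1
  refine Finset.prod_congr rfl fun t _ => ?_
  have hd : DifferentiableAt ℝ (fun z => e.1 (e₀.1.symm z)) (e₀.1 x) :=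
    ((contDiffOn_transition e₀.2 e.2).contDiffAt
      ((isOpen_transition_domain e₀.1 e.1).mem_nhds hmem0)).differentiableAt (by simp)
  rw [partialDeriv]
  have := ((EuclideanSpace.proj (𝕜 := ℝ) (γ t)).hasFDerivAt.comp _ hd.hasFDerivAt).fderiv
  exact (DFunLike.congr_fun this _).symm

theorem ofSymbol_coeff_last_self {z : EuclideanSpace ℝ (Fin n)} (hz : z ∈ e₀.1.target)
    (a : Fin m) (α : Fin (m + 1)) (γ : Fin r → Fin n) :
    (ofSymbol e₀ hq).coeff e₀ (Fin.last r) a α γ z = q (a, α, γ) z := by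
  classical
  have hx := e₀.1.map_target hz
  have h := ofSymbol_coeff_last hq hx hx a α γ
  rw [e₀.1.right_inv hz] at h
  have hJ : ∀ k i : Fin n, partialDeriv e₀.1 (fun y => e₀.1 y k) i (e₀.1.symm z) =
      if k = i then 1 else 0 := by
    intro k i
    have h1 : (fun z => e₀.1 (e₀.1.symm z) k) =ᶠ[𝓝 (e₀.1 (e₀.1.symm z))]
        (EuclideanSpace.proj (𝕜 := ℝ) k : EuclideanSpace ℝ (Fin n) →L[ℝ] ℝ) := by
      rw [e₀.1.right_inv hz]
      filter_upwards [e₀.1.open_target.mem_nhds hz] with y hy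
      rw [e₀.1.right_inv hy]
      rfl
    rw [partialDeriv, h1.fderiv_eq, ContinuousLinearMap.fderiv]
    simp
  rw [h, Finset.sum_eq_single γ]
  · simp [hJ]
  · intro β _ hβ
    obtain ⟨t, ht⟩ := Function.ne_iff.1 hβ
    rw [Finset.prod_eq_zero (Finset.mem_univ t), mul_zero]
    rw [hJ, if_neg (Ne.symm ht)]
  · simp

end

end LinearPDO

/-! ### Upper total symmetry and bounds for operators given in one chart -/

namespace UTSJets

variable {n m r : ℕ}

/-- Upper total symmetry does not depend on the coordinates in an adapted atlas. -/
theorem UTS.sum_mul_prod {q : SymbolIndex n m r → ℝ} (hq : UTS q) {J : Fin n → Fin n → ℝ}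
    (hJ : ∀ k i : Fin n, (k : ℕ) < m + 1 → J k i = if k = i then 1 else 0) :
    UTS fun κ => ∑ β : Fin r → Fin n, q (κ.1, κ.2.1, β) * ∏ t, J (κ.2.2 t) (β t) := by
  have hqperm : ∀ (a : Fin m) (α : Fin (m + 1)) (β : Fin r → Fin n) (π : Equiv.Perm (Fin r)),
      q (a, α, β ∘ π) = q (a, α, β) := fun a α β π =>
    hq a α α (β ∘ π) β (List.Perm.cons _ (Equiv.Perm.ofFn_comp_perm π fun i => (β i : ℕ)))
  have hperm : ∀ (a : Fin m) (α : Fin (m + 1)) (γ : Fin r → Fin n) (π : Equiv.Perm (Fin r)),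
      ∑ β : Fin r → Fin n, q (a, α, β) * ∏ t, J ((γ ∘ π) t) (β t) =
        ∑ β : Fin r → Fin n, q (a, α, β) * ∏ t, J (γ t) (β t) := by
    intro a α γ π
    refine Fintype.sum_equiv (Equiv.arrowCongr π (Equiv.refl _)) _ _ fun β => ?_
    have e1 : (Equiv.arrowCongr π (Equiv.refl _)) β = β ∘ π.symm := rfl
    rw [e1, hqperm]
    congr 1
    exact Fintype.prod_equiv π _ _ fun t => by simp
  have hofFn : ∀ {k : ℕ} {γ γ' : Fin k → Fin n},
      (List.ofFn fun i => (γ i : ℕ)).Perm (List.ofFn fun i => (γ' i : ℕ)) →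
      ∃ σ : Equiv.Perm (Fin k), γ' ∘ σ = γ := by
    intro k γ γ' h
    obtain ⟨σ, hσ⟩ := exists_perm_of_ofFn_perm h
    exact ⟨σ, funext fun i => Fin.ext (congrFun hσ i)⟩
  intro a α α' γ γ' h
  by_cases hα : α = α'
  · subst hα
    obtain ⟨σ, rfl⟩ := hofFn ((List.perm_cons _).1 h)
    exact hperm a α γ' σ
  · have hα' : (α : ℕ) ≠ α' := fun h => hα (Fin.ext h)
    obtain ⟨t, ht⟩ : ∃ t, (γ t : ℕ) = α' := by
      have : (α' : ℕ) ∈ (α : ℕ) :: List.ofFn fun i => (γ i : ℕ) := h.symm.subset (by simp)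
      simpa [hα'.symm, List.mem_ofFn] using this
    obtain ⟨t', ht'⟩ : ∃ t, (γ' t : ℕ) = α := by
      have : (α : ℕ) ∈ (α' : ℕ) :: List.ofFn fun i => (γ' i : ℕ) := h.subset (by simp)
      simpa [hα', List.mem_ofFn] using this
    rcases r with _ | r
    · exact t.elim0
    simp only
    -- When `α ≠ α'`, the index `α'` occurs in `γ` and `α` occurs in `γ'`. Both are moved to the
    -- front, where they are to be exchanged.
    rw [← hperm a α γ (Equiv.swap 0 t), ← hperm a α' γ' (Equiv.swap 0 t')]
    -- For `k < m + 1` the row `k` of the Jacobian matrix is that of the identity, so the summation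
    -- index paired with `k` equals `k`. An index that may be exchanged with `α` is thus unaffected
    -- by the change of coordinates.
    have hcons : ∀ (α : Fin (m + 1)) (k : Fin n) (δ : Fin r → Fin n), (k : ℕ) < m + 1 →
        ∑ β : Fin (r + 1) → Fin n, q (a, α, β) *
            ∏ t, J ((Fin.cons k δ : Fin (r + 1) → Fin n) t) (β t) =
          ∑ β : Fin r → Fin n, q (a, α, Fin.cons k β) * ∏ t, J (δ t) (β t) := by
      intro α k δ hk
      rw [← (Fin.consEquiv fun _ => Fin n).sum_comp, Fintype.sum_prod_type]
      rw [Finset.sum_eq_single k]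
      · refine Finset.sum_congr rfl fun β _ => ?_
        simp [Fin.prod_univ_succ, hJ k k hk, Fin.consEquiv]
      · intro i _ hi
        refine Finset.sum_eq_zero fun β _ => ?_
        simp [Fin.prod_univ_succ, hJ k i hk, hi.symm]
      · simp
    obtain ⟨k, δ, hγ⟩ : ∃ k δ, γ ∘ Equiv.swap 0 t = (Fin.cons k δ : Fin (r + 1) → Fin n) :=
      ⟨_, _, (Fin.cons_self_tail _).symm⟩
    obtain ⟨k', δ', hγ'⟩ : ∃ k δ, γ' ∘ Equiv.swap 0 t' = (Fin.cons k δ : Fin (r + 1) → Fin n) :=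
      ⟨_, _, (Fin.cons_self_tail _).symm⟩
    have hk : (k : ℕ) = α' := by
      have := congrFun hγ 0
      simp only [Function.comp_apply, Equiv.swap_apply_left, Fin.cons_zero] at this
      rw [← this, ht]
    have hk' : (k' : ℕ) = α := by
      have := congrFun hγ' 0
      simp only [Function.comp_apply, Equiv.swap_apply_left, Fin.cons_zero] at this
      rw [← this, ht']
    have hlist : ∀ {γ : Fin (r + 1) → Fin n} {π : Equiv.Perm (Fin (r + 1))} {k : Fin n}
        {δ : Fin r → Fin n}, γ ∘ π = (Fin.cons k δ : Fin (r + 1) → Fin n) →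
        (List.ofFn fun i => (γ i : ℕ)).Perm ((k : ℕ) :: List.ofFn fun i => (δ i : ℕ)) := by
      intro γ π k δ h
      have h1 := Equiv.Perm.ofFn_comp_perm π fun i => (γ i : ℕ)
      have h2 : (fun i => (γ i : ℕ)) ∘ π = fun i => ((Fin.cons k δ : Fin (r + 1) → Fin n) i : ℕ) :=
        funext fun i => congrArg Fin.val (congrFun h i)
      rw [h2, List.ofFn_succ] at h1
      simpa using h1.symm
    have hδ : (List.ofFn fun i => (δ i : ℕ)).Perm (List.ofFn fun i => (δ' i : ℕ)) := by
      have h1 := ((hlist hγ).cons (α : ℕ)).symm.trans (h.trans ((hlist hγ').cons (α' : ℕ)))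
      rw [hk, hk'] at h1
      exact (List.perm_cons _).1 ((List.perm_cons _).1 (h1.trans (List.Perm.swap _ _ _)))
    obtain ⟨σ, rfl⟩ := hofFn hδ
    rw [hγ, hγ', hcons α k _ (by rw [hk]; exact α'.2), hcons α' k' _ (by rw [hk']; exact α.2)]
    refine Fintype.sum_equiv (Equiv.arrowCongr σ (Equiv.refl _)) _ _ fun β => ?_
    have e1 : (Equiv.arrowCongr σ (Equiv.refl _)) β = β ∘ σ.symm := rfl
    rw [e1]
    congr 1
    · refine hq a α α' _ _ ?_
      rw [List.ofFn_succ, List.ofFn_succ]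
      simp only [Fin.cons_zero, Fin.cons_succ, hk, hk']
      refine (List.Perm.swap _ _ _).trans (List.Perm.cons _ (List.Perm.cons _ ?_))
      exact (Equiv.Perm.ofFn_comp_perm σ.symm fun i => (β i : ℕ)).symm
    · exact Fintype.prod_equiv σ _ _ fun t => by simp

end UTSJets

namespace LinearPDO

open UTSJets

variable {n m r : ℕ} {M : Type*} [TopologicalSpace M] [ChartedSpace (EuclideanSpace ℝ (Fin n)) M]
  [IsManifold (𝓡 n) ∞ M] [T2Space M]
  {e₀ : atlas (EuclideanSpace ℝ (Fin n)) M} {T : Set (EuclideanSpace ℝ (Fin n))}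
  {q : SymbolIndex n m r → EuclideanSpace ℝ (Fin n) → ℝ}

theorem isUTS_ofSymbol (hM : AdaptedAtlas n (m + 1) M) (hq : SymbolData e₀.1 T q) :
    (ofSymbol e₀ hq).IsUTS := by
  intro e a α α' γ γ' h
  ext z
  by_cases hz : z ∈ e.1.target ∩ e.1.symm ⁻¹' e₀.1.source
  · have hx := e.1.map_target hz.1
    rw [← e.1.right_inv hz.1, ofSymbol_coeff_last hq hx hz.2, ofSymbol_coeff_last hq hx hz.2]
    exact (hq.uts (e₀.1 (e.1.symm z))).sum_mul_prod
      (J := fun k i => partialDeriv e₀.1 (fun y => e.1 y k) i (e.1.symm z))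
      (fun k i hk => hM e₀.1 e₀.2 e.1 e.2 _ ⟨hz.2, hx⟩ k i hk) a α α' γ γ' h
  · exact (if_neg hz).trans (if_neg hz).symm

/-- Bounds for the coefficients in other charts. -/
theorem exists_norm_iteratedFDeriv_ofSymbol_le (e₀ : atlas (EuclideanSpace ℝ (Fin n)) M)
    {T : Set (EuclideanSpace ℝ (Fin n))} (hT : IsCompact T) (hTe : T ⊆ e₀.1.target)
    (e : atlas (EuclideanSpace ℝ (Fin n)) M) {K : Set M} (hK : IsCompact K)
    (hKe : K ⊆ e.1.source) (s : ℕ) :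
    ∃ C : ℝ, 0 ≤ C ∧ ∀ (q : SymbolIndex n m r → EuclideanSpace ℝ (Fin n) → ℝ)
      (hq : SymbolData e₀.1 T q) (δ : ℝ), 0 ≤ δ →
      (∀ κ, ∀ l ≤ s, ∀ z, ‖iteratedFDeriv ℝ l (q κ) z‖ ≤ δ) →
      ∀ j a α γ, ∀ l ≤ s, ∀ x ∈ K,
        ‖iteratedFDeriv ℝ l ((ofSymbol e₀ hq).coeff e j a α γ) (e.1 x)‖ ≤ C * δ := by
  have hO := isOpen_transition_domain e.1 e₀.1
  have hT' : IsCompact (e₀.1.symm '' T) :=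
    hT.image_of_continuousOn (e₀.1.continuousOn_symm.mono hTe)
  have hK' : IsCompact (e.1 '' (K ∩ e₀.1.symm '' T)) :=
    (hK.inter_right hT'.isClosed).image_of_continuousOn
      (e.1.continuousOn.mono (inter_subset_left.trans hKe))
  have hK'O : e.1 '' (K ∩ e₀.1.symm '' T) ⊆ e.1.target ∩ e.1.symm ⁻¹' e₀.1.source := by
    rintro _ ⟨x, ⟨hxK, y, hy, rfl⟩, rfl⟩
    refine ⟨e.1.map_source (hKe hxK), ?_⟩
    rw [mem_preimage, e.1.left_inv (hKe hxK)]
    exact e₀.1.map_target (hTe hy)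
  have hb := fun (j : Fin (r + 1)) (γ : Fin j → Fin n) (β : Fin r → Fin n) =>
    exists_forall_norm_iteratedFDeriv_comp_mul_le hO (contDiffOn_transition e.2 e₀.2)
      (contDiffOn_chainCoeff_transition e₀.2 e.2 j γ β) hK' hK'O s
  choose C hC0 hC using hb
  refine ⟨∑ j, ∑ γ, ∑ β, C j γ β, Finset.sum_nonneg fun j _ => Finset.sum_nonneg fun γ _ =>
    Finset.sum_nonneg fun β _ => hC0 j γ β, fun q hq δ hδ0 hδ j a α γ l hl x hx => ?_⟩
  by_cases hxT : x ∈ e₀.1.symm '' T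
  · have hmem : e.1 x ∈ e.1 '' (K ∩ e₀.1.symm '' T) := mem_image_of_mem _ ⟨hx, hxT⟩
    have heq : (ofSymbol e₀ hq).coeff e j a α γ =ᶠ[𝓝 (e.1 x)] fun z => ∑ β : Fin r → Fin n,
        q (a, α, β) (e₀.1 (e.1.symm z)) *
          chainCoeff (fun z => e.1 (e₀.1.symm z)) j γ β (e₀.1 (e.1.symm z)) := by
      filter_upwards [hO.mem_nhds (hK'O hmem)] with z hz using symbolCoeff_of_mem hz j a α γ
    rw [(heq.iteratedFDeriv ℝ l).eq_of_nhds, iteratedFDeriv_fun_sum_apply]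
    · refine (norm_sum_le _ _).trans ?_
      calc _ ≤ ∑ β : Fin r → Fin n, C j γ β * δ :=
            Finset.sum_le_sum fun β _ => hC j γ β _ δ (hq.smooth _) (fun l hl z _ => hδ _ l hl _) l hl _ hmem
        _ = (∑ β : Fin r → Fin n, C j γ β) * δ := by rw [Finset.sum_mul]
        _ ≤ _ := by
          gcongr
          refine (Finset.single_le_sum (f := fun γ => ∑ β, C j γ β)
            (fun γ _ => Finset.sum_nonneg fun β _ => hC0 j γ β) (Finset.mem_univ γ)).trans ?_
          exact Finset.single_le_sum (f := fun j => ∑ γ, ∑ β, C j γ β)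
            (fun j _ => Finset.sum_nonneg fun γ _ => Finset.sum_nonneg fun β _ => hC0 j γ β)
            (Finset.mem_univ j)
    · intro β _
      have h1 : ContDiffOn ℝ ∞ (fun z => q (a, α, β) (e₀.1 (e.1.symm z)) *
          chainCoeff (fun z => e.1 (e₀.1.symm z)) j γ β (e₀.1 (e.1.symm z)))
          (e.1.target ∩ e.1.symm ⁻¹' e₀.1.source) :=
        ((hq.smooth _).comp_contDiffOn (contDiffOn_transition e.2 e₀.2)).mul
          (contDiffOn_chainCoeff_transition e₀.2 e.2 j γ β)
      exact (h1.contDiffAt (hO.mem_nhds (hK'O hmem))).of_le (by exact_mod_cast le_top)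
  · have h0 := symbolCoeff_eventuallyEq_zero (e := e.1) hq (hKe hx) hxT j a α γ
    have h1 : iteratedFDeriv ℝ l ((ofSymbol e₀ hq).coeff e j a α γ) (e.1 x) = 0 := by
      refine ((h0.iteratedFDeriv ℝ l).eq_of_nhds).trans ?_
      exact congrFun iteratedFDeriv_fun_zero _
    rw [h1, norm_zero]
    exact mul_nonneg (Finset.sum_nonneg fun j _ => Finset.sum_nonneg fun γ _ =>
      Finset.sum_nonneg fun β _ => hC0 j γ β) hδ0

end LinearPDO

/-! ### Sums and limits of operators -/

namespace LinearPDO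

section

variable {n r p q : ℕ} {M : Type*} [TopologicalSpace M] [ChartedSpace (EuclideanSpace ℝ (Fin n)) M]

instance : Add (LinearPDO n r p q M) where
  add L L' :=
    { coeff := fun e j a b β z => L.coeff e j a b β z + L'.coeff e j a b β z
      smooth := fun e j a b β => (L.smooth e j a b β).add (L'.smooth e j a b β)
      coeff_off := fun e j a b β z hz => by
        rw [L.coeff_off e j a b β z hz, L'.coeff_off e j a b β z hz, add_zero]
      symm := fun e j a b β π => by rw [L.symm, L'.symm]
      compat := fun e e' x hx f hf a => by
        have h := congrArg₂ (· + ·) (L.compat e e' x hx f hf a) (L'.compat e e' x hx f hf a)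
        simpa only [localExpr, add_mul, Finset.sum_add_distrib] using h }

theorem add_coeff (L L' : LinearPDO n r p q M) (e j a b β z) :
    (L + L').coeff e j a b β z = L.coeff e j a b β z + L'.coeff e j a b β z := rfl

theorem IsUTS.add {m : ℕ} {L L' : LinearPDO n r (m + 1) m M} (hL : L.IsUTS) (hL' : L'.IsUTS) :
    (L + L').IsUTS := by
  intro e a α α' β β' h
  ext z
  rw [add_coeff, add_coeff, hL e a α α' β β' h, hL' e a α α' β β' h]

/-- `L` is the limit of the sequence `u`, which is eventually constant near every point. -/
def IsLocalLimit (u : ℕ → LinearPDO n r p q M) (L : LinearPDO n r p q M) : Prop :=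
  ∀ x : M, ∃ (N : ℕ) (V : Set M), IsOpen V ∧ x ∈ V ∧ ∀ k ≥ N,
    ∀ (e : atlas (EuclideanSpace ℝ (Fin n)) M) (j a b β), ∀ y ∈ V ∩ e.1.source,
      (u k).coeff e j a b β (e.1 y) = L.coeff e j a b β (e.1 y)

/-- The coefficients at a point are taken from a stage after which they are stable near it.
Smoothness and compatibility are inherited since stages stable near a common point agree there. -/
theorem exists_isLocalLimit {u : ℕ → LinearPDO n r p q M}
    (h : ∀ x : M, ∃ (N : ℕ) (V : Set M), IsOpen V ∧ x ∈ V ∧ ∀ k ≥ N,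
      ∀ (e : atlas (EuclideanSpace ℝ (Fin n)) M) (j a b β), ∀ y ∈ V ∩ e.1.source,
        (u k).coeff e j a b β (e.1 y) = (u N).coeff e j a b β (e.1 y)) :
    ∃ L, IsLocalLimit u L := by
  choose N V hV hxV hN using h
  have key : ∀ (x : M) (e : atlas (EuclideanSpace ℝ (Fin n)) M) (j a b β), ∀ y ∈ V x ∩ e.1.source,
      (u (N y)).coeff e j a b β (e.1 y) = (u (N x)).coeff e j a b β (e.1 y) := by
    intro x e j a b β y hy
    rw [← hN x (max (N x) (N y)) (le_max_left _ _) e j a b β y hy,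
      ← hN y (max (N x) (N y)) (le_max_right _ _) e j a b β y ⟨hxV y, hy.2⟩]
  refine ⟨{ coeff := fun e j a b β z => (u (N (e.1.symm z))).coeff e j a b β z
            smooth := ?_, coeff_off := ?_, symm := ?_, compat := ?_ }, fun x => ?_⟩
  · intro e j a b β z hz
    refine ContDiffAt.contDiffWithinAt ?_
    have h1 := ((u (N (e.1.symm z))).smooth e j a b β).contDiffAt (e.1.open_target.mem_nhds hz)
    refine h1.congr_of_eventuallyEq ?_
    have hO : IsOpen (e.1.target ∩ e.1.symm ⁻¹' V (e.1.symm z)) :=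
      e.1.symm.isOpen_inter_preimage (hV _)
    filter_upwards [hO.mem_nhds ⟨hz, hxV _⟩] with y hy
    have := key (e.1.symm z) e j a b β (e.1.symm y) ⟨hy.2, e.1.map_target hy.1⟩
    rwa [e.1.right_inv hy.1] at this
  · exact fun e j a b β z hz => coeff_off _ e j a b β z hz
  · intro e j a b β π
    ext z
    rw [(u _).symm e j a b β π]
  · intro e e' x hx f hf a
    have h1 := (u (N x)).compat e e' x hx f hf a
    simpa only [localExpr, e.1.left_inv hx.1, e'.1.left_inv hx.2] using h1
  · refine ⟨N x, V x, hV x, hxV x, fun k hk e j a b β y hy => ?_⟩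
    simp only [e.1.left_inv hy.2]
    rw [key x e j a b β y hy]
    exact hN x k hk e j a b β y hy

theorem IsLocalLimit.isUTS {m : ℕ} {u : ℕ → LinearPDO n r (m + 1) m M}
    {L : LinearPDO n r (m + 1) m M} (h : IsLocalLimit u L) (hu : ∀ k, (u k).IsUTS) : L.IsUTS := by
  intro e a α α' β β' hp
  ext z
  by_cases hz : z ∈ e.1.target
  · obtain ⟨N, V, -, hxV, hN⟩ := h (e.1.symm z)
    have h1 := fun α β => hN N le_rfl e (Fin.last r) a α β (e.1.symm z) ⟨hxV, e.1.map_target hz⟩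
    simp only [e.1.right_inv hz] at h1
    rw [← h1, ← h1, hu N e a α α' β β' hp]
  · rw [L.coeff_off _ _ _ _ _ z hz, L.coeff_off _ _ _ _ _ z hz]

end

end LinearPDO

/-! ### The symbol does not depend on the chart -/

section PowComp

variable {E : Type*} [NormedAddCommGroup E] [NormedSpace ℝ E]

theorem iteratedFDeriv_pow_comp {r : ℕ} {φ : E → ℝ} {y : E} (hφ : ContDiffAt ℝ r φ y)
    (h0 : φ y = 0) (v : Fin r → E) :
    iteratedFDeriv ℝ r (fun z => φ z ^ r) y v = r.factorial * ∏ t, fderiv ℝ φ y (v t) := by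
  have h1 : ∀ j < r, iteratedFDeriv ℝ j (fun t : ℝ => t ^ r) (φ y) = 0 := by
    intro j hj
    ext
    rw [iteratedFDeriv_apply_eq_iteratedDeriv_mul_prod, iteratedDeriv_pow, h0, zero_pow (by omega)]
    simp
  have h2 := iteratedFDeriv_comp_apply_of_forall_lt (g := fun t : ℝ => t ^ r)
    (by fun_prop) hφ h1 v
  rw [iteratedFDeriv_apply_eq_iteratedDeriv_mul_prod, iteratedDeriv_pow, h0] at h2
  have h3 : (fun t : ℝ => t ^ r) ∘ φ = fun z => φ z ^ r := rfl
  rw [h3] at h2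
  rw [h2]
  simp [Nat.descFactorial_self, mul_comm]

theorem iteratedFDeriv_pow_comp_of_lt {j r : ℕ} (hj : j < r) {φ : E → ℝ} {y : E}
    (hφ : ContDiffAt ℝ j φ y) (h0 : φ y = 0) :
    iteratedFDeriv ℝ j (fun z => φ z ^ r) y = 0 := by
  ext v
  have h3 : (fun t : ℝ => t ^ r) ∘ φ = fun z => φ z ^ r := rfl
  rw [← h3, iteratedFDeriv_comp_apply (g := fun t : ℝ => t ^ r) (by fun_prop) hφ]
  refine Finset.sum_eq_zero fun c _ => ?_
  rw [iteratedFDeriv_apply_eq_iteratedDeriv_mul_prod, iteratedDeriv_pow, h0,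
    zero_pow (by have := c.length_le; omega)]
  simp

end PowComp

namespace LinearPDO

open UTSJets

section

variable {n r p q : ℕ} {M : Type*} [TopologicalSpace M] [ChartedSpace (EuclideanSpace ℝ (Fin n)) M]
  [IsManifold (𝓡 n) ∞ M] [T2Space M]

-- At `x` all derivatives of `(h - h x) ^ r` of order below `r` vanish, and those of order `r` are
-- `r!` times products of first derivatives. Applied to this function the operator thus displays its
-- symbol.
omit [T2Space M] in
theorem localExpr_single_eq_symbolMatrix (L : LinearPDO n r p q M)
    (e : atlas (EuclideanSpace ℝ (Fin n)) M) {x : M} (hx : x ∈ e.1.source) {h g : M → ℝ}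
    {U : Set M} (hU : IsOpen U) (hxU : x ∈ U) (hh : ContMDiffOn (𝓡 n) 𝓘(ℝ, ℝ) ∞ h U)
    (hg : ∀ᶠ y in 𝓝 x, g y = (h y - h x) ^ r) (i : Fin p) (a : Fin q) :
    localExpr r e.1 (L.coeff e) (fun y => Pi.single i (g y)) x a =
      r.factorial * L.symbolMatrix e h x a i := by
  classical
  have hφ : ContDiffAt ℝ ∞ (fun z => h (e.1.symm z) - h x) (e.1 x) := by
    refine ContDiffAt.sub ?_ contDiffAt_const
    refine (contDiffOn_comp_symm le_rfl e.2 hh).contDiffAt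
      ((e.1.symm.isOpen_inter_preimage hU).mem_nhds ⟨e.1.map_source hx, ?_⟩)
    simpa [e.1.left_inv hx] using hxU
  have hφ0 : h (e.1.symm (e.1 x)) - h x = 0 := by rw [e.1.left_inv hx, sub_self]
  have hgE : (fun z => g (e.1.symm z)) =ᶠ[𝓝 (e.1 x)] fun z => (h (e.1.symm z) - h x) ^ r := by
    have := e.1.continuousAt_symm (e.1.map_source hx)
    rw [ContinuousAt, e.1.left_inv hx] at this
    exact this.eventually hg
  have hzero : ∀ (j : ℕ) (i' : Fin p) (β : Fin j → Fin n), i' ≠ i →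
      coordDeriv e.1 (fun y => (Pi.single i (g y) : Fin p → ℝ) i') β x = 0 := by
    intro j i' β hi
    have : (fun z => (Pi.single i (g (e.1.symm z)) : Fin p → ℝ) i') = fun _ => 0 := by
      ext z
      simp [hi]
    rw [coordDeriv, this, iteratedFDeriv_fun_zero]
    rfl
  have hself : ∀ (j : ℕ) (β : Fin j → Fin n),
      coordDeriv e.1 (fun y => (Pi.single i (g y) : Fin p → ℝ) i) β x =
        iteratedFDeriv ℝ j (fun z => (h (e.1.symm z) - h x) ^ r) (e.1 x)
          fun t => EuclideanSpace.single (β t) (1 : ℝ) := by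
    intro j β
    simp only [coordDeriv, Pi.single_eq_same]
    rw [(hgE.iteratedFDeriv ℝ j).eq_of_nhds]
  rw [localExpr, Finset.sum_eq_single (Fin.last r), Finset.sum_eq_single i]
  · rw [symbolMatrix, Matrix.of_apply, Finset.mul_sum]
    refine Finset.sum_congr rfl fun β _ => ?_
    have h1 : coordDeriv e.1 (fun y => (Pi.single i (g y) : Fin p → ℝ) i) β x =
        r.factorial * ∏ t, partialDeriv e.1 h (β t) x := by
      refine (hself r β).trans ?_
      rw [iteratedFDeriv_pow_comp (hφ.of_le (by exact_mod_cast le_top)) hφ0]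
      simp only [partialDeriv]
      congr 1
      refine Finset.prod_congr rfl fun t _ => ?_
      rw [fderiv_sub_const]
    rw [h1]
    exact mul_left_comm _ _ _
  · intro i' _ hi
    refine Finset.sum_eq_zero fun β _ => ?_
    rw [hzero _ i' β hi, mul_zero]
  · simp
  · intro j _ hj
    have hjr : (j : ℕ) < r := lt_of_le_of_ne (Nat.lt_succ_iff.1 j.2) fun h => hj (Fin.ext h)
    refine Finset.sum_eq_zero fun i' _ => Finset.sum_eq_zero fun β _ => ?_
    by_cases hi : i' = i
    · subst hi
      rw [hself, iteratedFDeriv_pow_comp_of_lt hjr (hφ.of_le (by exact_mod_cast le_top)) hφ0]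
      simp
    · rw [hzero _ i' β hi, mul_zero]
  · simp

/-- The symbol is recovered from the action on test functions, on which the two local expressions
agree. A bump function makes the test function global. -/
theorem symbolMatrix_eq_symbolMatrix (L : LinearPDO n r p q M)
    (e e' : atlas (EuclideanSpace ℝ (Fin n)) M) {x : M} (hx : x ∈ e.1.source)
    (hx' : x ∈ e'.1.source) {h : M → ℝ} {U : Set M} (hU : IsOpen U) (hxU : x ∈ U)
    (hh : ContMDiffOn (𝓡 n) 𝓘(ℝ, ℝ) ∞ h U) :
    L.symbolMatrix e h x = L.symbolMatrix e' h x := by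
  obtain ⟨f, -, hf⟩ := (SmoothBumpFunction.nhds_basis_tsupport (I := 𝓡 n) x).mem_iff.1
    (hU.mem_nhds hxU)
  let g : M → ℝ := fun y => f y * (h y - h x) ^ r
  have hgf : Function.support g ⊆ Function.support f :=
    fun z hz hz0 => hz (show g z = 0 by simp [g, hz0])
  have hgs : ContMDiff (𝓡 n) 𝓘(ℝ, ℝ) ∞ g := by
    refine contMDiff_of_tsupport fun y hy => ?_
    have hyU : y ∈ U := hf (closure_mono hgf hy)
    have h1 : ContMDiffAt (𝓡 n) 𝓘(ℝ, ℝ) ∞ h y := hh.contMDiffAt (hU.mem_nhds hyU)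
    exact (f.contMDiff y).mul ((h1.sub contMDiffAt_const).pow r)
  have hg : ∀ᶠ y in 𝓝 x, g y = (h y - h x) ^ r := by
    filter_upwards [f.eventuallyEq_one] with y hy
    simp [g, hy]
  ext a i
  have hF : ContMDiff (𝓡 n) 𝓘(ℝ, Fin p → ℝ) r (fun y => (Pi.single i (g y) : Fin p → ℝ)) := by
    rw [contMDiff_pi_space]
    intro i'
    by_cases hi : i' = i
    · subst hi
      simpa using hgs.of_le (by exact_mod_cast le_top)
    · simpa [hi] using contMDiff_const
  have h1 := L.compat e e' x ⟨hx, hx'⟩ _ hF a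
  rw [L.localExpr_single_eq_symbolMatrix e hx hU hxU hh hg,
    L.localExpr_single_eq_symbolMatrix e' hx' hU hxU hh hg] at h1
  exact mul_left_cancel₀ (by positivity) h1

end

/-! ### Characteristic submanifolds and bad jets -/

section

variable {n m r : ℕ} {M : Type*} [TopologicalSpace M] [ChartedSpace (EuclideanSpace ℝ (Fin n)) M]

/-- The coefficients of highest order. -/
def topCoeff (L : LinearPDO n r (m + 1) m M) (e : atlas (EuclideanSpace ℝ (Fin n)) M)
    (κ : SymbolIndex n m r) : EuclideanSpace ℝ (Fin n) → ℝ :=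
  L.coeff e (Fin.last r) κ.1 κ.2.1 κ.2.2

theorem contDiffOn_topCoeff (L : LinearPDO n r (m + 1) m M)
    (e : atlas (EuclideanSpace ℝ (Fin n)) M) (κ : SymbolIndex n m r) :
    ContDiffOn ℝ ∞ (L.topCoeff e κ) e.1.target := L.smooth _ _ _ _ _

theorem IsUTS.uts_topCoeff {L : LinearPDO n r (m + 1) m M} (hL : L.IsUTS)
    (e : atlas (EuclideanSpace ℝ (Fin n)) M) (z : EuclideanSpace ℝ (Fin n)) :
    UTS fun κ => L.topCoeff e κ z := fun a α α' β β' h => by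
  simp only [topCoeff, hL e a α α' β β' h]

theorem isAdmissible_smoothJet_topCoeff {L : LinearPDO n r (m + 1) m M} (hL : L.IsUTS)
    (e : atlas (EuclideanSpace ℝ (Fin n)) M) {z : EuclideanSpace ℝ (Fin n)} (hz : z ∈ e.1.target) :
    IsAdmissible (smoothJet (L.topCoeff e) z) :=
  isAdmissible_smoothJet e.1.open_target (L.contDiffOn_topCoeff e) (hL.uts_topCoeff e) hz

theorem symbolMatrix_eq_map_ev (L : LinearPDO n r (m + 1) m M)
    (e : atlas (EuclideanSpace ℝ (Fin n)) M) {h : M → ℝ} {x : M} {ξ : Fin n → ℝ}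
    (hξ : ∀ i, partialDeriv e.1 h i x = ξ i) :
    L.symbolMatrix e h x = symb.map (ev (smoothJet (L.topCoeff e) (e.1 x)) ξ) := by
  ext a α
  simp [symbolMatrix, symb, ev, smoothJet, wderiv, topCoeff, hξ]

end

end LinearPDO

/-! ### Openness of maximal rank and changes of the local equation. -/

namespace UTSJets

variable {n m r k : ℕ}

theorem linearIndependent_row_of_rank_eq {T : Matrix (Fin m) (Fin (m + 1)) ℝ} (h : m ≤ T.rank) :
    LinearIndependent ℝ T.row := by
  rw [linearIndependent_iff_card_le_finrank_span, Fintype.card_fin, Set.finrank,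
    ← Matrix.rank_eq_finrank_span_row]
  exact h

/-- The linear map `v ↦ (μ ⬝ v) 1 + t v`. -/
noncomputable def shearMap (μ : Fin k → ℝ) (t : ℝ) : (Fin k → ℝ) →L[ℝ] (Fin k → ℝ) :=
  LinearMap.toContinuousLinearMap
    (LinearMap.pi fun l => (∑ i, μ i • LinearMap.proj i) + t • LinearMap.proj l)

theorem shearMap_apply (μ : Fin k → ℝ) (t : ℝ) (v : Fin k → ℝ) (l : Fin k) :
    shearMap μ t v l = ∑ i, (μ + t • Pi.single l 1 : Fin k → ℝ) i * v i := by
  simp [shearMap, add_mul, Finset.sum_add_distrib, Pi.single_apply]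

/-- Pairing the equations for a kernel vector `v` with `μ` gives `(∑ μ + t) (μ · v) = 0`. The two
excluded values of `t` then force `μ · v = 0` and `v = 0`. -/
theorem shearMap_injective {μ : Fin k → ℝ} {t : ℝ} (ht : t ≠ 0) (ht' : t ≠ - ∑ i, μ i) :
    Function.Injective (shearMap μ t) := by
  rw [injective_iff_map_eq_zero]
  intro v hv
  have h1 : ∀ l, ∑ i, μ i * v i + t * v l = 0 := by
    intro l
    have := congrFun hv l
    rw [shearMap_apply] at this
    simpa [add_mul, Finset.sum_add_distrib, Pi.single_apply] using this
  have h2 : (∑ i, μ i + t) * ∑ i, μ i * v i = 0 := by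
    have : ∑ l, μ l * (∑ i, μ i * v i + t * v l) = 0 :=
      Finset.sum_eq_zero fun l _ => by rw [h1, mul_zero]
    simp only [mul_add, Finset.sum_add_distrib, ← Finset.sum_mul] at this
    have h3 : ∑ l, μ l * (t * v l) = t * ∑ l, μ l * v l := by
      rw [Finset.mul_sum]
      exact Finset.sum_congr rfl fun _ _ => by ring
    rw [h3] at this
    linarith
  have h3 : ∑ i, μ i * v i = 0 := by
    rcases mul_eq_zero.1 h2 with h | h
    · exact absurd (by linarith) ht'
    · exact h
  ext l
  have := h1 l
  rw [h3, zero_add] at this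
  simpa [ht] using this

theorem eventually_surjective_fderiv {U : Set (EuclideanSpace ℝ (Fin n))} (hU : IsOpen U)
    {H : EuclideanSpace ℝ (Fin n) → Fin k → ℝ} (hH : ContDiffOn ℝ ∞ H U)
    {z : EuclideanSpace ℝ (Fin n)} (hz : z ∈ U) (hs : Function.Surjective (fderiv ℝ H z)) :
    ∀ᶠ y in 𝓝 z, Function.Surjective (fderiv ℝ H y) := by
  choose v hv using fun i : Fin k => hs (Pi.single i 1)
  have hc : ContinuousAt (fun y i => fderiv ℝ H y (v i)) z := by
    refine continuousAt_pi.2 fun i => ?_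
    exact ((hH.continuousOn_fderiv_of_isOpen hU (by simp)).continuousAt
      (hU.mem_nhds hz)).clm_apply continuousAt_const
  have hli : LinearIndependent ℝ fun i => fderiv ℝ H z (v i) := by
    simp only [hv]
    have := (Pi.basisFun ℝ (Fin k)).linearIndependent
    convert this with i
    simp
  have := hc.eventually (isOpen_setOfPred_linearIndependent.mem_nhds hli)
  filter_upwards [this] with y hy
  have hspan := LinearIndependent.span_eq_top_of_card_eq_finrank' hy (by simp)
  have : LinearMap.range (fderiv ℝ H y : EuclideanSpace ℝ (Fin n) →ₗ[ℝ] Fin k → ℝ) = ⊤ := by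
    rw [eq_top_iff, ← hspan, Submodule.span_le]
    rintro _ ⟨i, rfl⟩
    exact ⟨v i, rfl⟩
  exact LinearMap.range_eq_top.1 this

end UTSJets

namespace LinearPDO

open UTSJets

variable {n m r k : ℕ} {M : Type*} [TopologicalSpace M] [ChartedSpace (EuclideanSpace ℝ (Fin n)) M]
  [IsManifold (𝓡 n) ∞ M] [T2Space M]

/-- If the symbol has maximal rank at one conormal covector of `E₀`, then the operator is
transversal to `E₀`. -/
theorem isTransversalAt_of_rank_eq (L : LinearPDO n r (m + 1) m M)
    (e : atlas (EuclideanSpace ℝ (Fin n)) M) {x : M} (hx : x ∈ e.1.source) {E₀ : Set M}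
    {H : M → Fin k → ℝ} {U : Set M} (hU : IsOpen U) (hxU : x ∈ U)
    (hH : ContMDiffOn (𝓡 n) 𝓘(ℝ, Fin k → ℝ) ∞ H U) (hE : ∀ y ∈ U, y ∈ E₀ ↔ H y = 0)
    (hs : Function.Surjective (fderiv ℝ (fun z => H (e.1.symm z)) (e.1 x))) (μ : Fin k → ℝ)
    (hμ : m ≤ (symb.map (ev (smoothJet (L.topCoeff e) (e.1 x))
      (conormal (fun z => H (e.1.symm z)) (e.1 x, μ)))).rank) :
    L.IsTransversalAt k E₀ x := by
  set HE : EuclideanSpace ℝ (Fin n) → Fin k → ℝ := fun z => H (e.1.symm z) with hHE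
  have hO : IsOpen (e.1.target ∩ e.1.symm ⁻¹' U) := e.1.symm.isOpen_inter_preimage hU
  have hmem : e.1 x ∈ e.1.target ∩ e.1.symm ⁻¹' U :=
    ⟨e.1.map_source hx, by simpa [e.1.left_inv hx] using hxU⟩
  have hHEs : ContDiffOn ℝ ∞ HE (e.1.target ∩ e.1.symm ⁻¹' U) := contDiffOn_comp_symm le_rfl e.2 hH
  have hHEd : DifferentiableAt ℝ HE (e.1 x) :=
    (hHEs.contDiffAt (hO.mem_nhds hmem)).differentiableAt (by simp)
  -- At `t = 0` all the covectors `μ + t e_l` equal `μ`, where the rank is maximal; this persists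
  -- for small `t`. For `t` different from `0` and `-∑ μ` they are independent and are the
  -- differentials of the new equation `A ∘ H`.
  obtain ⟨t, ht0, ht1, ht⟩ : ∃ t : ℝ, t ≠ 0 ∧ t ≠ - ∑ i, μ i ∧ ∀ l : Fin k,
      LinearIndependent ℝ (symb.map (ev (smoothJet (L.topCoeff e) (e.1 x))
        (conormal HE (e.1 x, μ + t • Pi.single l 1)))).row := by
    have h1 : ∀ᶠ t in 𝓝[≠] (0 : ℝ), ∀ l : Fin k,
        LinearIndependent ℝ (symb.map (ev (smoothJet (L.topCoeff e) (e.1 x))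
        (conormal HE (e.1 x, μ + t • Pi.single l 1)))).row := by
      rw [eventually_all]
      intro l
      have hc : Continuous fun t : ℝ => (symb.map (ev (smoothJet (L.topCoeff e) (e.1 x))
          (conormal HE (e.1 x, μ + t • Pi.single l 1)))).row := by
        refine continuous_pi fun a => continuous_pi fun α => ?_
        simp only [Matrix.row, Matrix.map_apply, symb, Matrix.of_apply, ev, map_sum, map_mul,
          MvPolynomial.aeval_X, Sum.elim_inl, Sum.elim_inr, map_prod, conormal]
        fun_prop
      refine (hc.continuousAt.eventually (isOpen_setOfPred_linearIndependent.mem_nhds ?_)).filter_mono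
        nhdsWithin_le_nhds
      simpa using linearIndependent_row_of_rank_eq hμ
    have h2 : ∀ᶠ t in 𝓝[≠] (0 : ℝ), t ≠ - ∑ i, μ i := by
      rcases eq_or_ne (0 : ℝ) (- ∑ i, μ i) with h | h
      · rw [← h]
        exact self_mem_nhdsWithin
      · exact (eventually_ne_nhds h).filter_mono nhdsWithin_le_nhds
    obtain ⟨t, ⟨h3, h4⟩, h5⟩ := ((h1.and h2).and self_mem_nhdsWithin).exists
    exact ⟨t, h5, h4, h3⟩
  let A := shearMap μ t
  have hAinj : Function.Injective A := shearMap_injective ht0 ht1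
  have hAsurj : Function.Surjective A :=
    (LinearMap.injective_iff_surjective (f := (A : (Fin k → ℝ) →ₗ[ℝ] (Fin k → ℝ)))).1 hAinj
  have hAH : ContMDiffOn (𝓡 n) 𝓘(ℝ, Fin k → ℝ) ∞ (fun y => A (H y)) U :=
    A.contDiff.contMDiff.comp_contMDiffOn hH
  refine ⟨fun y => A (H y), ⟨⟨U, hU, hxU, hAH, fun y hy => ?_⟩, ?_⟩, fun l => ?_⟩
  · rw [hE y hy]
    exact ⟨fun h => (congrArg A h).trans (map_zero A), fun h => hAinj (h.trans (map_zero A).symm)⟩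
  · have h1 : fderiv ℝ (fun z => A (H (e.1.symm z))) (e.1 x) = A ∘L fderiv ℝ HE (e.1 x) :=
      (A.hasFDerivAt.comp _ hHEd.hasFDerivAt).fderiv
    have h2 : Function.Surjective (fderiv ℝ (fun z => A (H (e.1.symm z))) (e.1 x)) := by
      rw [h1]
      exact hAsurj.comp hs
    have h3 : MDifferentiableAt (𝓡 n) 𝓘(ℝ, Fin k → ℝ) (fun y => A (H y)) (e.1.symm (e.1 x)) := by
      rw [e.1.left_inv hx]
      exact (hAH.contMDiffAt (hU.mem_nhds hxU)).mdifferentiableAt (by simp)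
    have h4 : MDifferentiableAt (𝓡 n) (𝓡 n) e.1.symm (e.1 x) :=
      ((contMDiffOn_symm_of_mem_maximalAtlas (I := 𝓡 n) (n := ∞)
        (IsManifold.subset_maximalAtlas e.2)).contMDiffAt
        (e.1.open_target.mem_nhds (e.1.map_source hx))).mdifferentiableAt (by simp)
    have h5 := mfderiv_comp (e.1 x) h3 h4
    rw [mfderiv_eq_fderiv] at h5
    have h6 : Function.Surjective (mfderiv (𝓡 n) 𝓘(ℝ, Fin k → ℝ) (fun y => A (H y))
        (e.1.symm (e.1 x))) := by
      intro w
      obtain ⟨v, hv⟩ := h2 w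
      refine ⟨mfderiv (𝓡 n) (𝓡 n) e.1.symm (e.1 x) v, ?_⟩
      exact (DFunLike.congr_fun h5 v).symm.trans hv
    rwa [e.1.left_inv hx] at h6
  · have hAHl : ContMDiffOn (𝓡 n) 𝓘(ℝ, ℝ) ∞ (fun y => A (H y) l) U :=
      contMDiffOn_pi_space.1 hAH l
    rw [L.symbolMatrix_eq_symbolMatrix _ e (mem_chart_source _ x) hx hU hxU hAHl]
    have hξ : ∀ i, partialDeriv e.1 (fun y => A (H y) l) i x =
        conormal HE (e.1 x, μ + t • Pi.single l 1) i := by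
      intro i
      have h1 : (fun z => A (H (e.1.symm z)) l) =
          fun z => ∑ i, (μ + t • Pi.single l 1 : Fin k → ℝ) i * HE z i := by
        ext z
        exact shearMap_apply μ t _ l
      rw [partialDeriv, h1, fderiv_fun_sum fun j _ =>
        (differentiableAt_pi.1 hHEd j).const_mul _, sum_apply, conormal]
      refine Finset.sum_congr rfl fun j _ => ?_
      rw [fderiv_const_mul (differentiableAt_pi.1 hHEd j)]
      rfl
    rw [L.symbolMatrix_eq_map_ev e hξ, (ht l).rank_matrix, Fintype.card_fin]

/-- Near any point of a characteristic submanifold there are bad jets. -/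
theorem IsCharacteristicSubmanifold.exists_isBad {L : LinearPDO n r (m + 1) m M} {E₀ : Set M}
    (h : L.IsCharacteristicSubmanifold k E₀) (hk : 1 ≤ k) {x : M} (hxE : x ∈ E₀)
    (e : atlas (EuclideanSpace ℝ (Fin n)) M) (hx : x ∈ e.1.source)
    {V : Set (EuclideanSpace ℝ (Fin n))} (hV : V ∈ 𝓝 (e.1 x)) :
    ∃ z ∈ V, z ∈ e.1.target ∧ IsBad (smoothJet (L.topCoeff e) z) := by
  obtain ⟨-, hsub, hnt⟩ := h
  obtain ⟨H, ⟨U, hU, hxU, hH, hE⟩, hs⟩ := hsub x hxE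
  set HE : EuclideanSpace ℝ (Fin n) → Fin k → ℝ := fun z => H (e.1.symm z) with hHE
  have hO : IsOpen (e.1.target ∩ e.1.symm ⁻¹' U) := e.1.symm.isOpen_inter_preimage hU
  have hmem : e.1 x ∈ e.1.target ∩ e.1.symm ⁻¹' U :=
    ⟨e.1.map_source hx, by simpa [e.1.left_inv hx] using hxU⟩
  have hHEs : ContDiffOn ℝ ∞ HE (e.1.target ∩ e.1.symm ⁻¹' U) := contDiffOn_comp_symm le_rfl e.2 hH
  have hHEd : DifferentiableAt ℝ HE (e.1 x) :=
    (hHEs.contDiffAt (hO.mem_nhds hmem)).differentiableAt (by simp)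
  have hsE : Function.Surjective (fderiv ℝ HE (e.1 x)) := by
    have h1 : H =ᶠ[𝓝 x] HE ∘ e.1 := by
      filter_upwards [e.1.open_source.mem_nhds hx] with y hy
      simp [hHE, e.1.left_inv hy]
    have h3 : MDifferentiableAt 𝓘(ℝ, EuclideanSpace ℝ (Fin n)) 𝓘(ℝ, Fin k → ℝ) HE (e.1 x) :=
      hHEd.mdifferentiableAt
    have h4 : MDifferentiableAt (𝓡 n) (𝓡 n) e.1 x :=
      ((contMDiffOn_of_mem_maximalAtlas (I := 𝓡 n) (n := ∞)
        (IsManifold.subset_maximalAtlas e.2)).contMDiffAt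
        (e.1.open_source.mem_nhds hx)).mdifferentiableAt (by simp)
    have h5 := mfderiv_comp x h3 h4
    rw [← h1.mfderiv_eq, mfderiv_eq_fderiv] at h5
    intro w
    obtain ⟨v, hv⟩ := hs w
    exact ⟨mfderiv (𝓡 n) (𝓡 n) e.1 x v, (DFunLike.congr_fun h5 v).symm.trans hv⟩
  -- Shrinking the neighbourhood keeps `H` a submersion everywhere, although it is assumed to be one
  -- only at `x`.
  obtain ⟨W, hWsub, hWo, hxW⟩ := mem_nhds_iff.1 (inter_mem (inter_mem hV (hO.mem_nhds hmem))
    (eventually_surjective_fderiv hO hHEs hmem hsE))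
  have hWO : W ⊆ e.1.target ∩ e.1.symm ⁻¹' U := fun z hz => (hWsub hz).1.2
  obtain ⟨z, hzW, -, hbad⟩ := exists_isBad_of_rank_lt (m := m) (r := r) e.1.open_target
    (L.contDiffOn_topCoeff e) hWo (hHEs.mono hWO) (fun z hz => (hWO hz).1)
    (fun z hz => (hWsub hz).2) hk hxW
    (by simpa [hHE, e.1.left_inv hx] using (hE x hxU).1 hxE) (by
      intro u hu hu0
      by_contra hlt
      have hut := (hWO hu).1
      have huU : e.1.symm u.1 ∈ U := (hWO hu).2
      refine hnt (e.1.symm u.1) ((hE _ huU).2 hu0)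
        (L.isTransversalAt_of_rank_eq e (e.1.map_target hut) hU huU hH hE ?_ u.2 ?_)
      · rw [e.1.right_inv hut]
        exact (hWsub hu).2
      · rw [e.1.right_inv hut]
        exact not_lt.1 hlt)
  exact ⟨z, (hWsub hzW).1.1, (hWO hzW).1, hbad⟩

end LinearPDO

/-! ### Operators with good jets -/

namespace UTSJets

variable {n m r : ℕ}

theorem IsGoodWith.mono {ε ε' : ℝ} (hε : ε' ≤ ε) {y : Jet n m r} (h : IsGoodWith ε y) :
    IsGoodWith ε' y :=
  fun y' hy' hc => h y' hy' fun κ w hw => (hc κ w hw).trans_le hε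

theorem IsGoodWith.of_near {ε : ℝ} {y y' : Jet n m r} (h : IsGoodWith ε y)
    (hc : ∀ κ w, List.length w ≤ 2 * n → |y' κ w - y κ w| < ε / 2) : IsGoodWith (ε / 2) y' := by
  intro z hz hcz
  refine h z hz fun κ w hw => ?_
  have h1 := abs_sub_le (z κ w) (y' κ w) (y κ w)
  linarith [hc κ w hw, hcz κ w hw]

theorem eventually_abs_smoothJet_sub_lt {Ω : Set (EuclideanSpace ℝ (Fin n))} (hΩ : IsOpen Ω)
    {c : SymbolIndex n m r → EuclideanSpace ℝ (Fin n) → ℝ} (hc : ∀ κ, ContDiffOn ℝ ∞ (c κ) Ω)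
    {z : EuclideanSpace ℝ (Fin n)} (hz : z ∈ Ω) (s : ℕ) {ε : ℝ} (hε : 0 < ε) :
    ∀ᶠ y in 𝓝 z, ∀ κ w, List.length w ≤ s → |smoothJet c y κ w - smoothJet c z κ w| < ε := by
  rw [eventually_all]
  intro κ
  have h1 : ∀ᶠ y in 𝓝 z, ∀ w ∈ {w : List (Fin n) | w.length ≤ s},
      |smoothJet c y κ w - smoothJet c z κ w| < ε := by
    rw [eventually_all_finite (List.finite_length_le (Fin n) s)]
    intro w _
    have h2 : ContinuousAt (wderiv w (c κ)) z :=
      (ContDiffOn.wderiv hΩ (hc κ) w).continuousOn.continuousAt (hΩ.mem_nhds hz)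
    filter_upwards [Metric.continuousAt_iff'.1 h2 ε hε] with y hy
    simpa [Real.dist_eq, smoothJet] using hy
  exact h1

end UTSJets

namespace LinearPDO

open UTSJets

section

variable {n m r : ℕ} {M : Type*} [TopologicalSpace M] [ChartedSpace (EuclideanSpace ℝ (Fin n)) M]
  (L : LinearPDO n r (m + 1) m M) (e : atlas (EuclideanSpace ℝ (Fin n)) M)

/-- All jets of the operator at points of `C` are good, uniformly. -/
def IsGoodOn (C : Set M) : Prop :=
  ∃ ε > 0, ∀ x ∈ C, IsGoodWith ε (smoothJet (L.topCoeff e) (e.1 x))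

variable {L e}

/-- The `2n`-jet is continuous, so half of the tolerance at a point is still valid nearby;
compactness makes it uniform. -/
theorem isGoodOn_of_forall {C : Set M} (hC : IsCompact C) (hCe : C ⊆ e.1.source)
    (h : ∀ x ∈ C, ∃ ε > 0, IsGoodWith ε (smoothJet (L.topCoeff e) (e.1 x))) : L.IsGoodOn e C := by
  have key : ∃ ε > 0, ∀ x ∈ C, x ∈ e.1.source →
      IsGoodWith ε (smoothJet (L.topCoeff e) (e.1 x)) := by
    refine hC.induction_on (p := fun S => ∃ ε > 0, ∀ x ∈ S, x ∈ e.1.source →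
      IsGoodWith ε (smoothJet (L.topCoeff e) (e.1 x))) ⟨1, one_pos, by simp⟩ ?_ ?_ ?_
    · rintro S S' hS ⟨ε, hε, h'⟩
      exact ⟨ε, hε, fun x hx => h' x (hS hx)⟩
    · rintro S S' ⟨ε, hε, h1⟩ ⟨ε', hε', h2⟩
      refine ⟨min ε ε', lt_min hε hε', ?_⟩
      rintro x (hx | hx) hxe
      · exact (h1 x hx hxe).mono (min_le_left _ _)
      · exact (h2 x hx hxe).mono (min_le_right _ _)
    · intro x hx
      obtain ⟨ε, hε, hg⟩ := h x hx
      have h1 := eventually_abs_smoothJet_sub_lt e.1.open_target (L.contDiffOn_topCoeff e)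
        (e.1.map_source (hCe hx)) (2 * n) (half_pos hε)
      refine ⟨_, mem_nhdsWithin_of_mem_nhds ((e.1.continuousAt (hCe hx)).eventually h1), ε / 2,
        half_pos hε, fun y hy _ => hg.of_near hy⟩
  obtain ⟨ε, hε, hg⟩ := key
  exact ⟨ε, hε, fun x hx => hg x hx (hCe hx)⟩

theorem contDiffAt_coeff (L : LinearPDO n r (m + 1) m M) (j a b β) {x : M}
    (hx : x ∈ e.1.source) : ContDiffAt ℝ ∞ (L.coeff e j a b β) (e.1 x) :=
  (L.smooth e j a b β).contDiffAt (e.1.open_target.mem_nhds (e.1.map_source hx))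

theorem abs_smoothJet_topCoeff_sub_le (L L' : LinearPDO n r (m + 1) m M) {x : M}
    (hx : x ∈ e.1.source) (κ : SymbolIndex n m r) (w : List (Fin n)) :
    |smoothJet (L'.topCoeff e) (e.1 x) κ w - smoothJet (L.topCoeff e) (e.1 x) κ w| ≤
      ‖iteratedFDeriv ℝ w.length (fun z => L'.coeff e (Fin.last r) κ.1 κ.2.1 κ.2.2 z -
        L.coeff e (Fin.last r) κ.1 κ.2.1 κ.2.2 z) (e.1 x)‖ := by
  have h := wderiv_sub e.1.open_target (L'.contDiffOn_topCoeff e κ) (L.contDiffOn_topCoeff e κ) w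
    (e.1.map_source hx)
  rw [smoothJet, smoothJet, ← h]
  exact abs_wderiv_le e.1.open_target
    ((L'.contDiffOn_topCoeff e κ).sub (L.contDiffOn_topCoeff e κ)) w (e.1.map_source hx)

theorem isGoodOn_of_near {C : Set M} (hCe : C ⊆ e.1.source) {L' : LinearPDO n r (m + 1) m M}
    {ε : ℝ} (hε : 0 < ε)
    (h : ∀ x ∈ C, IsGoodWith ε (smoothJet (L.topCoeff e) (e.1 x)))
    (hL' : ∀ x ∈ C, ∀ j a b β, ∀ l ≤ 2 * n,
      ‖iteratedFDeriv ℝ l (fun z => L'.coeff e j a b β z - L.coeff e j a b β z) (e.1 x)‖ < ε / 2) :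
    L'.IsGoodOn e C :=
  ⟨ε / 2, half_pos hε, fun x hx => (h x hx).of_near fun κ w hw =>
    (abs_smoothJet_topCoeff_sub_le L L' (hCe hx) κ w).trans_lt (hL' x hx _ _ _ _ _ hw)⟩

end

/-! ### Coverings by compact subsets of charts, with cutoff functions -/

section

variable {n : ℕ} {M : Type*} [TopologicalSpace M]

/-- `C` is a compact set in the domain of the chart `e`, with cutoff functions `χ` equal to one near
`C` and vanishing outside of the compact set `T`, and `ψ` equal to one on `T`. -/
structure IsCutoff (e : OpenPartialHomeomorph M (EuclideanSpace ℝ (Fin n))) (C : Set M)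
    (T : Set (EuclideanSpace ℝ (Fin n))) (χ ψ : EuclideanSpace ℝ (Fin n) → ℝ) : Prop where
  isCompact : IsCompact C
  subset_source : C ⊆ e.source
  isCompact_image : IsCompact T
  subset_target : T ⊆ e.target
  contDiff : ContDiff ℝ ∞ χ
  eq_zero : ∀ z ∉ T, χ z = 0
  eventually_eq_one : ∀ x ∈ C, ∀ᶠ z in 𝓝 (e x), χ z = 1
  contDiff' : ContDiff ℝ ∞ ψ
  hasCompactSupport : HasCompactSupport ψ
  tsupport_subset : tsupport ψ ⊆ e.target
  eq_one : ∀ z ∈ T, ψ z = 1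

variable {e : OpenPartialHomeomorph M (EuclideanSpace ℝ (Fin n))} {C : Set M}
  {T : Set (EuclideanSpace ℝ (Fin n))} {χ ψ : EuclideanSpace ℝ (Fin n) → ℝ}

theorem isCutoff_empty (e : OpenPartialHomeomorph M (EuclideanSpace ℝ (Fin n))) :
    IsCutoff e ∅ ∅ (fun _ => 0) (fun _ => 0) where
  isCompact := isCompact_empty
  subset_source := empty_subset _
  isCompact_image := isCompact_empty
  subset_target := empty_subset _
  contDiff := contDiff_const
  eq_zero _ _ := rfl
  eventually_eq_one := by simp
  contDiff' := contDiff_const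
  hasCompactSupport := HasCompactSupport.zero
  tsupport_subset := by simp [tsupport, Function.support]
  eq_one := by simp

theorem IsCutoff.subset_image (h : IsCutoff e C T χ ψ) : C ⊆ e.symm '' T := by
  intro x hx
  refine ⟨e x, ?_, e.left_inv (h.subset_source hx)⟩
  by_contra hT
  exact one_ne_zero ((h.eventually_eq_one x hx).self_of_nhds.symm.trans (h.eq_zero _ hT))

/-- All data are level sets of one bump: `χ` is `1` for `φ ≥ 3/4` and `0` for `φ ≤ 1/2`, while `ψ`
is `1` for `φ ≥ 1/4` and supported in the closed ball. -/
theorem isCutoff_of_contDiffBump {c : EuclideanSpace ℝ (Fin n)} (φ : ContDiffBump c)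
    (hφ : Metric.closedBall c φ.rOut ⊆ e.target) :
    IsCutoff e (e.symm '' {z | 1 ≤ φ z}) {z | 1 / 2 ≤ φ z}
      (fun z => Real.smoothTransition (4 * φ z - 2)) (fun z => Real.smoothTransition (4 * φ z)) := by
  have hpos : ∀ t > 0, {z | t ≤ φ z} ⊆ Metric.closedBall c φ.rOut := fun t ht z hz => by
    refine Metric.ball_subset_closedBall ?_
    rw [← φ.support_eq]
    exact (ht.trans_le hz).ne'
  have hcpt : ∀ t > 0, IsCompact {z | t ≤ φ z} := fun t ht =>
    (isCompact_closedBall c φ.rOut).of_isClosed_subset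
      (isClosed_le continuous_const φ.continuous) (hpos t ht)
  have hsupp : Function.support (fun z => Real.smoothTransition (4 * φ z)) ⊆
      Metric.closedBall c φ.rOut := by
    refine Subset.trans ?_ (φ.support_eq.subset.trans Metric.ball_subset_closedBall)
    intro z hz hz0
    simp [hz0] at hz
  exact
  { isCompact := (hcpt 1 one_pos).image_of_continuousOn
      (e.continuousOn_symm.mono ((hpos 1 one_pos).trans hφ))
    subset_source := by
      rintro _ ⟨z, hz, rfl⟩
      exact e.map_target (hφ (hpos 1 one_pos hz))
    isCompact_image := hcpt _ (by norm_num)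
    subset_target := (hpos _ (by norm_num)).trans hφ
    contDiff := Real.smoothTransition.contDiff.comp ((contDiff_const.mul φ.contDiff).sub
      contDiff_const)
    eq_zero := fun z hz => Real.smoothTransition.zero_of_nonpos (by
      simp only [mem_ofPred_eq, not_le] at hz; linarith)
    eventually_eq_one := by
      rintro _ ⟨z, hz, rfl⟩
      rw [e.right_inv (hφ (hpos 1 one_pos hz))]
      have h1 : ∀ᶠ y in 𝓝 z, 3 / 4 < φ y :=
        φ.continuous.continuousAt.eventually (lt_mem_nhds (by
          simp only [mem_ofPred_eq] at hz; linarith))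
      filter_upwards [h1] with y hy
      exact Real.smoothTransition.one_of_one_le (by linarith)
    contDiff' := Real.smoothTransition.contDiff.comp (contDiff_const.mul φ.contDiff)
    hasCompactSupport := HasCompactSupport.of_support_subset_isCompact
      (isCompact_closedBall c φ.rOut) hsupp
    tsupport_subset := (closure_minimal hsupp Metric.isClosed_closedBall).trans hφ
    eq_one := fun z hz => Real.smoothTransition.one_of_one_le (by
      simp only [mem_ofPred_eq] at hz; linarith) }

-- Derived from a locally finite smooth bump covering, countable by second countability. Reindexing
-- by `Encodable.decode₂`, which attains each index exactly once, preserves local finiteness; the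
-- unused numbers receive empty sets.
variable (n M) in
theorem exists_isCutoff_cover [ChartedSpace (EuclideanSpace ℝ (Fin n)) M] [T2Space M]
    [SecondCountableTopology M] [Nonempty M] :
    ∃ (e : ℕ → atlas (EuclideanSpace ℝ (Fin n)) M) (C : ℕ → Set M)
      (T : ℕ → Set (EuclideanSpace ℝ (Fin n))) (χ ψ : ℕ → EuclideanSpace ℝ (Fin n) → ℝ),
      (∀ i, IsCutoff (e i).1 (C i) (T i) (χ i) (ψ i)) ∧ (∀ x, ∃ i, x ∈ C i) ∧
        LocallyFinite fun i => (e i).1.symm '' T i := by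
  have : LocallyCompactSpace M := ChartedSpace.locallyCompactSpace (EuclideanSpace ℝ (Fin n)) M
  obtain ⟨ι, f, -⟩ := SmoothBumpCovering.exists_isSubordinate (𝓡 n) (M := M) isClosed_univ
    (U := fun _ => univ) fun _ _ => univ_mem
  have hι : Countable ι := by
    rw [← countable_univ_iff]
    exact f.locallyFinite.countable_univ fun i => (f i).nonempty_support
  have := Encodable.ofCountable ι
  let e : Option ι → atlas (EuclideanSpace ℝ (Fin n)) M := fun o =>
    ⟨chartAt _ (o.elim (Classical.arbitrary M) f.c), chart_mem_atlas _ _⟩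
  have hball : ∀ i, Metric.closedBall (extChartAt (𝓡 n) (f.c i) (f.c i)) (f i).rOut ⊆
      (chartAt (EuclideanSpace ℝ (Fin n)) (f.c i)).target := fun i => by
    have := (f i).closedBall_subset
    simpa using this
  let C : Option ι → Set M := fun o => o.elim ∅ fun i =>
    (e (some i)).1.symm '' {z | 1 ≤ (f i).toContDiffBump z}
  let T : Option ι → Set (EuclideanSpace ℝ (Fin n)) := fun o => o.elim ∅ fun i =>
    {z | 1 / 2 ≤ (f i).toContDiffBump z}
  let χ : Option ι → EuclideanSpace ℝ (Fin n) → ℝ := fun o => o.elim (fun _ => 0) fun i z =>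
    Real.smoothTransition (4 * (f i).toContDiffBump z - 2)
  let ψ : Option ι → EuclideanSpace ℝ (Fin n) → ℝ := fun o => o.elim (fun _ => 0) fun i z =>
    Real.smoothTransition (4 * (f i).toContDiffBump z)
  have hcut : ∀ o, IsCutoff (e o).1 (C o) (T o) (χ o) (ψ o) := by
    rintro (_ | i)
    · exact isCutoff_empty _
    · exact isCutoff_of_contDiffBump (f i).toContDiffBump (hball i)
  have hTf : ∀ i, (e (some i)).1.symm '' T (some i) ⊆ Function.support (f i) := by
    rintro i _ ⟨z, hz, rfl⟩
    have hzt : z ∈ (chartAt (EuclideanSpace ℝ (Fin n)) (f.c i)).target :=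
      (hcut (some i)).subset_target hz
    rw [Function.mem_support, (f i).eqOn_source ((e (some i)).1.map_target hzt)]
    have h1 : extChartAt (𝓡 n) (f.c i) ((e (some i)).1.symm z) = z := by
      simpa [e] using (e (some i)).1.right_inv hzt
    rw [Function.comp_apply, h1]
    exact (lt_of_lt_of_le (by norm_num) hz : (0 : ℝ) < (f i).toContDiffBump z).ne'
  refine ⟨fun k => e (Encodable.decode₂ ι k), fun k => C (Encodable.decode₂ ι k),
    fun k => T (Encodable.decode₂ ι k), fun k => χ (Encodable.decode₂ ι k),
    fun k => ψ (Encodable.decode₂ ι k), fun k => hcut _, fun x => ?_, fun x => ?_⟩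
  · obtain ⟨i, hi⟩ := f.eventuallyEq_one' x (mem_univ x)
    have h1 : f i x = 1 := hi.self_of_nhds
    have hx : x ∈ (chartAt (EuclideanSpace ℝ (Fin n)) (f.c i)).source :=
      (f i).support_subset_source (by rw [Function.mem_support, h1]; exact one_ne_zero)
    refine ⟨Encodable.encode i, ?_⟩
    simp only [Encodable.encodek₂]
    refine ⟨e (some i) |>.1 x, ?_, (e (some i)).1.left_inv hx⟩
    have h2 := (f i).eqOn_source hx
    rw [h1] at h2
    have h3 : (1 : ℝ) ≤ (f i).toContDiffBump ((e (some i)).1 x) := by simpa [e] using h2.le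
    exact h3
  · obtain ⟨V, hV, hfin⟩ := f.locallyFinite x
    refine ⟨V, hV, (hfin.image Encodable.encode).subset ?_⟩
    rintro k ⟨y, hy, hyV⟩
    rcases ho : Encodable.decode₂ ι k with _ | i
    · simp [ho, T] at hy
    · simp only [ho] at hy
      exact ⟨i, ⟨y, hTf i hy, hyV⟩, Encodable.mem_decode₂.1 ho⟩

end

end LinearPDO

/-! ### Perturbations -/

namespace UTSJets

open MvPolynomial

variable {n m r : ℕ}

theorem contDiff_of_tsupport_subset {Ω : Set (EuclideanSpace ℝ (Fin n))} (hΩ : IsOpen Ω)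
    {ψ f : EuclideanSpace ℝ (Fin n) → ℝ} (hψ : ContDiff ℝ ∞ ψ) (hψΩ : tsupport ψ ⊆ Ω)
    (hf : ContDiffOn ℝ ∞ f Ω) : ContDiff ℝ ∞ fun z => ψ z * f z := by
  rw [contDiff_iff_contDiffAt]
  intro z
  by_cases hz : z ∈ tsupport ψ
  · exact hψ.contDiffAt.mul (hf.contDiffAt (hΩ.mem_nhds (hψΩ hz)))
  · refine contDiffAt_const (c := (0 : ℝ)).congr_of_eventuallyEq ?_
    filter_upwards [(isClosed_tsupport ψ).isOpen_compl.mem_nhds hz] with y hy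
    simp [image_eq_zero_of_notMem_tsupport hy]

theorem smoothJet_congr_of_eventuallyEq {c c' : SymbolIndex n m r → EuclideanSpace ℝ (Fin n) → ℝ}
    {z : EuclideanSpace ℝ (Fin n)} (h : ∀ κ, c κ =ᶠ[𝓝 z] c' κ) : smoothJet c z = smoothJet c' z := by
  funext κ w
  obtain ⟨U, hU, hUo, hz⟩ := eventually_nhds_iff.1 (h κ)
  exact wderiv_congr_of_eqOn hUo hU w hz

/-- Smooth upper totally symmetric symbols with compact support are approximated by polynomial
symbols with good jets. -/
theorem exists_polyUTS_near (hr : 1 ≤ r)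
    {f : SymbolIndex n m r → EuclideanSpace ℝ (Fin n) → ℝ} (hf : ∀ κ, ContDiff ℝ ∞ (f κ))
    (hfc : ∀ κ, HasCompactSupport (f κ))
    (hfu : ∀ a (α α' : Fin (m + 1)) (β β' : Fin r → Fin n), List.Perm ((α : ℕ) :: List.ofFn fun i => (β i : ℕ))
      ((α' : ℕ) :: List.ofFn fun i => (β' i : ℕ)) → f (a, α, β) = f (a, α', β'))
    (s : ℕ) {K : Set (EuclideanSpace ℝ (Fin n))} (hK : IsCompact K) {ε : ℝ} (hε : 0 < ε) :
    ∃ P : PolySymbol n m r, PolyUTS P ∧ (∀ x, ∃ ε' > 0, IsGoodWith ε' (polyJet P x)) ∧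
      ∀ κ, ∀ l ≤ s, ∀ z ∈ K, ‖iteratedFDeriv ℝ l (fun z => polyFun (P κ) z - f κ z) z‖ ≤ ε := by
  have h1 : ∀ g : EuclideanSpace ℝ (Fin n) → ℝ, ∃ P : MvPolynomial (Fin n) ℝ,
      ContDiff ℝ ∞ g → HasCompactSupport g → ∀ l ≤ s, ∀ z ∈ K,
        ‖iteratedFDeriv ℝ l (fun z => g z - polyFun P z) z‖ < ε / 2 := by
    intro g
    by_cases hg : ContDiff ℝ ∞ g ∧ HasCompactSupport g
    · obtain ⟨P, hP⟩ := exists_polyFun_iteratedFDeriv_near hg.1 hg.2 s hK (half_pos hε)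
      exact ⟨P, fun _ _ => hP⟩
    · exact ⟨0, fun h h' => absurd ⟨h, h'⟩ hg⟩
  choose A hA using h1
  -- The approximation `A` is a function of the coefficient function, not of its index. Equal
  -- coefficients get equal polynomials, so upper total symmetry survives.
  let P₀ : PolySymbol n m r := fun κ => A (f κ)
  have hP₀ : PolyUTS P₀ := fun a α α' β β' h => by simp only [P₀, hfu a α α' β β' h]
  let B := Module.finBasis ℝ (utsPoly n m r (2 * n))
  let b : Fin _ → PolySymbol n m r := fun i => (B i : PolySymbol n m r)
  have hbli : LinearIndependent ℝ b :=
    B.linearIndependent.map' (utsPoly n m r (2 * n)).subtype (Submodule.ker_subtype _)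
  have hb : ∀ P ∈ utsPoly n m r (2 * n), ∃ d : Fin _ → ℝ, ∑ i, d i • b i = P := by
    intro P hP
    refine ⟨fun i => B.repr ⟨P, hP⟩ i, ?_⟩
    have h2 := congrArg (utsPoly n m r (2 * n)).subtype (B.sum_repr ⟨P, hP⟩)
    rw [map_sum] at h2
    exact h2
  have hD := fun (i : Fin (Module.finrank ℝ (utsPoly n m r (2 * n)))) (κ : SymbolIndex n m r) =>
    exists_forall_norm_iteratedFDeriv_le isOpen_univ (contDiff_polyFun (b i κ)).contDiffOn hK
      (subset_univ _) s
  choose D hD1 hD using hD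
  have hD0 : ∀ i κ, 0 ≤ D i κ := fun i κ => zero_le_one.trans (hD1 i κ)
  -- Dominates the derivatives of all basis polynomials on `K`, so that parameters below `ε / 2 / S`
  -- change the approximation by at most `ε / 2`.
  let S : ℝ := 1 + ∑ i, ∑ κ, D i κ
  have hS : 0 < S := by
    have := Finset.sum_nonneg fun i (_ : i ∈ Finset.univ) =>
      Finset.sum_nonneg fun κ (_ : κ ∈ Finset.univ) => hD0 i κ
    simp only [S]
    linarith
  obtain ⟨p, hp, hgood⟩ := exists_good_perturbation hr (fun i => (B i).2) hbli hb hP₀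
    (ε := ε / 2 / S) (by positivity)
  refine ⟨P₀ + ∑ i, p i • b i, fun a α α' β β' h => ?_, hgood, fun κ l hl z hz => ?_⟩
  · have h2 := (sum_smul_mem_utsPoly (fun i => (B i).2) p).1 a α α' β β' h
    exact congrArg₂ (· + ·) (hP₀ a α α' β β' h) h2
  · have h2 : (fun z => polyFun ((P₀ + ∑ i, p i • b i) κ) z - f κ z) =
        fun z => -(f κ z - polyFun (A (f κ)) z) + ∑ i, p i • polyFun (b i κ) z := by
      ext z
      simp only [polyFun, P₀, Pi.add_apply, Finset.sum_apply, Pi.smul_apply, map_add, map_sum,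
        smul_eval, smul_eq_mul]
      ring
    have hc1 : ContDiff ℝ ∞ fun z => -(f κ z - polyFun (A (f κ)) z) :=
      ((hf κ).sub (contDiff_polyFun _)).neg
    have hc2 : ∀ i, ContDiff ℝ ∞ fun z => p i • polyFun (b i κ) z := fun i =>
      (contDiff_polyFun _).const_smul (p i)
    have hc3 : ContDiff ℝ ∞ fun z => ∑ i, p i • polyFun (b i κ) z := ContDiff.sum fun i _ => hc2 i
    have hl' : (l : WithTop ℕ∞) ≤ ∞ := by exact_mod_cast le_top
    rw [h2, fun_iteratedFDeriv_add_apply (hc1.contDiffAt.of_le hl') (hc3.contDiffAt.of_le hl'),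
      iteratedFDeriv_fun_sum_apply fun i _ => (hc2 i).contDiffAt.of_le hl']
    refine (norm_add_le _ _).trans ?_
    have h3 : ‖iteratedFDeriv ℝ l (fun z => -(f κ z - polyFun (A (f κ)) z)) z‖ ≤ ε / 2 := by
      have h4 : iteratedFDeriv ℝ l (fun z => -(f κ z - polyFun (A (f κ)) z)) z =
          -iteratedFDeriv ℝ l (fun z => f κ z - polyFun (A (f κ)) z) z := iteratedFDeriv_neg_apply
      rw [h4, norm_neg]
      exact (hA _ (hf κ) (hfc κ) l hl z hz).le
    have h4 : ∀ i, ‖iteratedFDeriv ℝ l (fun z => p i • polyFun (b i κ) z) z‖ ≤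
        ε / 2 / S * ∑ κ, D i κ := by
      intro i
      change ‖iteratedFDeriv ℝ l (p i • polyFun (b i κ)) z‖ ≤ _
      rw [iteratedFDeriv_const_smul_apply ((contDiff_polyFun _).contDiffAt.of_le hl'), norm_smul]
      refine mul_le_mul (hp i).le ((hD i κ l hl z hz).trans ?_) (norm_nonneg _) (by positivity)
      exact Finset.single_le_sum (f := fun κ => D i κ) (fun κ _ => hD0 i κ) (Finset.mem_univ κ)
    have h5 : ‖∑ i, iteratedFDeriv ℝ l (fun z => p i • polyFun (b i κ) z) z‖ ≤ ε / 2 := by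
      refine (norm_sum_le _ _).trans ((Finset.sum_le_sum fun i _ => h4 i).trans ?_)
      rw [← Finset.mul_sum, div_mul_eq_mul_div, div_le_iff₀ hS]
      refine mul_le_mul_of_nonneg_left ?_ (half_pos hε).le
      simp only [S]
      linarith
    linarith

end UTSJets

namespace LinearPDO

open UTSJets

variable {n m r : ℕ} {M : Type*} [TopologicalSpace M] [ChartedSpace (EuclideanSpace ℝ (Fin n)) M]
  [IsManifold (𝓡 n) ∞ M] [T2Space M]

/-- Small perturbations, supported in a compact subset of a chart, with good jets on a smaller
compact set. -/
theorem exists_isGoodOn_mem_whitneyBall (hM : AdaptedAtlas n (m + 1) M) (hr : 1 ≤ r)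
    {e₀ : atlas (EuclideanSpace ℝ (Fin n)) M} {C : Set M} {T : Set (EuclideanSpace ℝ (Fin n))}
    {χ ψ : EuclideanSpace ℝ (Fin n) → ℝ} (hc : IsCutoff e₀.1 C T χ ψ)
    {L : LinearPDO n r (m + 1) m M} (hL : L.IsUTS) (s : ℕ) {J : Type}
    {e : J → atlas (EuclideanSpace ℝ (Fin n)) M} {K : J → Set M} (hK : LocallyFinite K)
    (hKc : ∀ j, IsCompact (K j)) (hKe : ∀ j, K j ⊆ (e j).1.source) {η : J → ℝ}
    (hη : ∀ j, 0 < η j) :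
    ∃ L' : LinearPDO n r (m + 1) m M, L'.IsUTS ∧ L'.IsGoodOn e₀ C ∧ L' ∈ whitneyBall L s e K η ∧
      ∀ (e : atlas (EuclideanSpace ℝ (Fin n)) M) (j a b β), ∀ x ∈ e.1.source,
        x ∉ e₀.1.symm '' T → L'.coeff e j a b β (e.1 x) = L.coeff e j a b β (e.1 x) := by
  have hT : IsCompact (e₀.1.symm '' T) :=
    hc.isCompact_image.image_of_continuousOn (e₀.1.continuousOn_symm.mono hc.subset_target)
  -- Only finitely many of the `K j` meet the support of the perturbation, so one bound `δ` serves
  -- for all.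
  have hfin := hK.finite_nonempty_inter_compact hT
  choose A hA0 hA using fun j => exists_norm_iteratedFDeriv_ofSymbol_le (m := m) (r := r) e₀
    hc.isCompact_image hc.subset_target (e j) (hKc j) (hKe j) s
  obtain ⟨D, hD0, hD⟩ := exists_forall_norm_iteratedFDeriv_comp_mul_le isOpen_univ
    (contDiff_id (𝕜 := ℝ) (E := EuclideanSpace ℝ (Fin n))).contDiffOn
    hc.contDiff.contDiffOn hc.isCompact_image (subset_univ _) s
  obtain ⟨δ, hδ, hδ0⟩ : ∃ δ : ℝ, (∀ j ∈ {j | (K j ∩ e₀.1.symm '' T).Nonempty},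
      A j * (D * δ) < η j) ∧ 0 < δ := by
    have h1 : ∀ᶠ δ in 𝓝[>] (0 : ℝ), ∀ j ∈ {j | (K j ∩ e₀.1.symm '' T).Nonempty},
        A j * (D * δ) < η j := by
      rw [eventually_all_finite hfin]
      intro j _
      have h2 : Continuous fun δ : ℝ => A j * (D * δ) := by fun_prop
      exact (h2.continuousAt.eventually (gt_mem_nhds (by simpa using hη j))).filter_mono
        nhdsWithin_le_nhds
    exact (h1.and self_mem_nhdsWithin).exists
  -- The cutoff `ψ` extends the coefficients smoothly to the whole space without changing them on
  -- `T`.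
  let f : SymbolIndex n m r → EuclideanSpace ℝ (Fin n) → ℝ := fun κ z => ψ z * L.topCoeff e₀ κ z
  have hf : ∀ κ, ContDiff ℝ ∞ (f κ) := fun κ =>
    contDiff_of_tsupport_subset e₀.1.open_target hc.contDiff' hc.tsupport_subset
      (L.contDiffOn_topCoeff e₀ κ)
  have hfc : ∀ κ, HasCompactSupport (f κ) := fun κ => hc.hasCompactSupport.mul_right
  have hfu : ∀ a (α α' : Fin (m + 1)) (β β' : Fin r → Fin n), List.Perm ((α : ℕ) :: List.ofFn fun i => (β i : ℕ))
      ((α' : ℕ) :: List.ofFn fun i => (β' i : ℕ)) → f (a, α, β) = f (a, α', β') :=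
    fun a α α' β β' h => by
      ext z
      exact congrArg (ψ z * ·) (hL.uts_topCoeff e₀ z a α α' β β' h)
  obtain ⟨P, hPu, hPg, hP⟩ := exists_polyUTS_near hr hf hfc hfu s hc.isCompact_image hδ0
  -- Near `C`, where `χ = 1`, adding `q` replaces the highest order coefficients by the polynomials
  -- `P`, whose jets are good.
  let q : SymbolIndex n m r → EuclideanSpace ℝ (Fin n) → ℝ := fun κ z =>
    (polyFun (P κ) z - f κ z) * χ z
  have hPf : ∀ κ, ContDiff ℝ ∞ fun z => polyFun (P κ) z - f κ z := fun κ =>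
    (contDiff_polyFun _).sub (hf κ)
  have hq : SymbolData e₀.1 T q :=
  { isCompact := hc.isCompact_image
    subset := hc.subset_target
    smooth := fun κ => (hPf κ).mul hc.contDiff
    eq_zero := fun κ z hz => by simp only [q, hc.eq_zero z hz, mul_zero]
    uts := fun z a α α' β β' h => by
      simp only [q, hPu a α α' β β' h, hfu a α α' β β' h] }
  have hqb : ∀ κ, ∀ l ≤ s, ∀ z, ‖iteratedFDeriv ℝ l (q κ) z‖ ≤ D * δ := by
    intro κ l hl z
    by_cases hz : z ∈ T
    · exact hD _ δ (hPf κ) (fun l hl z hz => hP κ l hl z hz) l hl z hz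
    · have h1 : q κ =ᶠ[𝓝 z] fun _ => 0 := by
        filter_upwards [hc.isCompact_image.isClosed.isOpen_compl.mem_nhds hz] with y hy
        exact hq.eq_zero κ y hy
      rw [(h1.iteratedFDeriv ℝ l).eq_of_nhds, iteratedFDeriv_fun_zero, Pi.zero_apply, norm_zero]
      positivity
  refine ⟨L + ofSymbol e₀ hq, hL.add (isUTS_ofSymbol hM hq),
    isGoodOn_of_forall hc.isCompact hc.subset_source fun x hx => ?_, fun i x hx j a b β l hl => ?_,
    fun e j a b β x hx hxT => ?_⟩
  · have h1 : smoothJet ((L + ofSymbol e₀ hq).topCoeff e₀) (e₀.1 x) =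
        polyJet P (e₀.1 x).ofLp := by
      rw [← smoothJet_polyFun]
      refine smoothJet_congr_of_eventuallyEq fun κ => ?_
      filter_upwards [hc.eventually_eq_one x hx] with z hz
      have hzT : z ∈ T := by
        by_contra hzT
        exact one_ne_zero (hz.symm.trans (hc.eq_zero z hzT))
      rw [topCoeff, add_coeff, ofSymbol_coeff_last_self hq (hc.subset_target hzT)]
      simp only [q, f, hz, hc.eq_one z hzT, topCoeff]
      ring
    rw [h1]
    exact hPg _
  · have h1 : (fun z => (L + ofSymbol e₀ hq).coeff (e i) j a b β z - L.coeff (e i) j a b β z) =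
        (ofSymbol e₀ hq).coeff (e i) j a b β := by
      ext z
      rw [add_coeff, add_sub_cancel_left]
    rw [h1]
    by_cases hi : (K i ∩ e₀.1.symm '' T).Nonempty
    · exact (hA i q hq _ (by positivity) hqb j a b β l hl x hx).trans_lt (hδ i hi)
    · have h2 : x ∉ e₀.1.symm '' T := fun h => hi ⟨x, hx, h⟩
      have h3 := symbolCoeff_eventuallyEq_zero (e := (e i).1) hq (hKe i hx) h2 j a b β
      have h4 : (ofSymbol e₀ hq).coeff (e i) j a b β =ᶠ[𝓝 ((e i).1 x)] fun _ => 0 := h3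
      rw [(h4.iteratedFDeriv ℝ l).eq_of_nhds, iteratedFDeriv_fun_zero, Pi.zero_apply, norm_zero]
      exact hη i
  · rw [add_coeff]
    have h1 : (ofSymbol e₀ hq).coeff e j a b β (e.1 x) = 0 :=
      symbolCoeff_eq_zero hq (by rwa [e.1.left_inv hx]) j a b β
    rw [h1, add_zero]

end LinearPDO

/-! ### Genericity -/

namespace LinearPDO

open UTSJets

variable {n m r : ℕ} {M : Type*} [TopologicalSpace M] [ChartedSpace (EuclideanSpace ℝ (Fin n)) M]

theorem norm_iteratedFDeriv_coeff_sub_le (L L' L'' : LinearPDO n r (m + 1) m M)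
    {e : atlas (EuclideanSpace ℝ (Fin n)) M} {x : M} (hx : x ∈ e.1.source) (j a b β) (l : ℕ) :
    ‖iteratedFDeriv ℝ l (fun z => L''.coeff e j a b β z - L.coeff e j a b β z) (e.1 x)‖ ≤
      ‖iteratedFDeriv ℝ l (fun z => L''.coeff e j a b β z - L'.coeff e j a b β z) (e.1 x)‖ +
      ‖iteratedFDeriv ℝ l (fun z => L'.coeff e j a b β z - L.coeff e j a b β z) (e.1 x)‖ := by
  have h1 : (fun z => L''.coeff e j a b β z - L.coeff e j a b β z) = fun z =>
      (L''.coeff e j a b β z - L'.coeff e j a b β z) +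
        (L'.coeff e j a b β z - L.coeff e j a b β z) := by
    ext z
    ring
  have hl : (l : WithTop ℕ∞) ≤ ∞ := by exact_mod_cast le_top
  have hc := fun (L : LinearPDO n r (m + 1) m M) =>
    (L.contDiffAt_coeff j a b β hx).of_le hl
  rw [h1, fun_iteratedFDeriv_add_apply ((hc L'').sub (hc L')) ((hc L').sub (hc L))]
  exact norm_add_le _ _

theorem iteratedFDeriv_coeff_congr {L L' : LinearPDO n r (m + 1) m M}
    {e : atlas (EuclideanSpace ℝ (Fin n)) M} {x : M} (hx : x ∈ e.1.source) {V : Set M}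
    (hV : IsOpen V) (hxV : x ∈ V) {j a b β}
    (h : ∀ y ∈ V ∩ e.1.source, L.coeff e j a b β (e.1 y) = L'.coeff e j a b β (e.1 y)) :
    L.coeff e j a b β =ᶠ[𝓝 (e.1 x)] L'.coeff e j a b β := by
  have hO : IsOpen (e.1.target ∩ e.1.symm ⁻¹' V) := e.1.symm.isOpen_inter_preimage hV
  filter_upwards [hO.mem_nhds ⟨e.1.map_source hx, by simpa [e.1.left_inv hx] using hxV⟩] with z hz
  have := h (e.1.symm z) ⟨hz.2, e.1.map_target hz.1⟩
  rwa [e.1.right_inv hz.1] at this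

variable [IsManifold (𝓡 n) ∞ M] [T2Space M]

/-- Operators with good jets on all sets of a locally finite covering are dense. -/
theorem exists_forall_isGoodOn_mem_whitneyBall (hM : AdaptedAtlas n (m + 1) M) (hr : 1 ≤ r)
    {e : ℕ → atlas (EuclideanSpace ℝ (Fin n)) M} {C : ℕ → Set M}
    {T : ℕ → Set (EuclideanSpace ℝ (Fin n))} {χ ψ : ℕ → EuclideanSpace ℝ (Fin n) → ℝ}
    (hc : ∀ i, IsCutoff (e i).1 (C i) (T i) (χ i) (ψ i))
    (hfin : LocallyFinite fun i => (e i).1.symm '' T i)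
    {L : LinearPDO n r (m + 1) m M} (hL : L.IsUTS) (s : ℕ) {ι : Type}
    {eK : ι → atlas (EuclideanSpace ℝ (Fin n)) M} {K : ι → Set M} (hK : LocallyFinite K)
    (hKc : ∀ j, IsCompact (K j)) (hKe : ∀ j, K j ⊆ (eK j).1.source) {ε : ι → ℝ}
    (hε : ∀ j, 0 < ε j) :
    ∃ L' : LinearPDO n r (m + 1) m M, L'.IsUTS ∧ (∀ i, L'.IsGoodOn (e i) (C i)) ∧
      L' ∈ whitneyBall L s eK K ε := by
  classical
  let eJ : ι ⊕ ℕ → atlas (EuclideanSpace ℝ (Fin n)) M := Sum.elim eK e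
  -- The sets `C i` are controlled together with the given `K j`, so that later steps cannot destroy
  -- goodness on earlier `C i`.
  let KJ : ι ⊕ ℕ → Set M := Sum.elim K C
  have hKJ : LocallyFinite KJ := hK.sumElim (hfin.subset fun i => (hc i).subset_image)
  have hKJc : ∀ j, IsCompact (KJ j) := by
    rintro (j | i)
    · exact hKc j
    · exact (hc i).isCompact
  have hKJe : ∀ j, KJ j ⊆ (eJ j).1.source := by
    rintro (j | i)
    · exact hKe j
    · exact (hc i).subset_source
  let s' := max s (2 * n)
  -- A state is an operator with the tolerance that remains for all later changes on each controlled
  -- set. A step may spend no more than the decrease of the tolerance.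
  let S := {u : LinearPDO n r (m + 1) m M × (ι ⊕ ℕ → ℝ) // u.1.IsUTS ∧ ∀ j, 0 < u.2 j}
  have hstep : ∀ (i : ℕ) (u : S), ∃ v : S,
      v.1.1 ∈ whitneyBall u.1.1 s' eJ KJ (fun j => u.1.2 j - v.1.2 j) ∧
      (∀ x ∈ C i, IsGoodWith (2 * v.1.2 (Sum.inr i)) (smoothJet (v.1.1.topCoeff (e i)) ((e i).1 x))) ∧
      ∀ (e' : atlas (EuclideanSpace ℝ (Fin n)) M) (j a b β), ∀ x ∈ e'.1.source,
        x ∉ (e i).1.symm '' T i →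
          v.1.1.coeff e' j a b β (e'.1 x) = u.1.1.coeff e' j a b β (e'.1 x) := by
    rintro i ⟨⟨L, η⟩, hL, hη⟩
    obtain ⟨L', hL', ⟨δ, hδ, hgood⟩, hball, hoff⟩ := exists_isGoodOn_mem_whitneyBall hM hr (hc i) hL s' hKJ
      hKJc hKJe (η := fun j => η j / 2) fun j => half_pos (hη j)
    -- The bound `η j / 2` pays for the present step; the bound `δ / 2` keeps all later changes
    -- within half of the goodness radius just obtained.
    refine ⟨⟨⟨L', fun j => min (η j / 2) (δ / 2)⟩, hL', fun j =>
      lt_min (half_pos (hη j)) (half_pos hδ)⟩, ?_, ?_, hoff⟩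
    · intro j x hx k a b β l hl
      refine (hball j x hx k a b β l hl).trans_le ?_
      have := min_le_left (η j / 2) (δ / 2)
      dsimp only
      linarith
    · intro x hx
      refine (hgood x hx).mono ?_
      have := min_le_right (η (Sum.inr i) / 2) (δ / 2)
      dsimp only
      linarith
  choose next hball hgood hoff using hstep
  let u : ℕ → S := fun k => Nat.rec (motive := fun _ => S)
    ⟨⟨L, Sum.elim ε fun _ => 1⟩, hL, by rintro (j | i); exacts [hε j, one_pos]⟩ next k
  have hu : ∀ k, u (k + 1) = next k (u k) := fun _ => rfl
  have htel : ∀ i k, i ≤ k → ∀ J, ∀ x ∈ KJ J, ∀ j a b β, ∀ l ≤ s',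
      ‖iteratedFDeriv ℝ l (fun z => (u k).1.1.coeff (eJ J) j a b β z -
        (u i).1.1.coeff (eJ J) j a b β z) ((eJ J).1 x)‖ ≤ (u i).1.2 J - (u k).1.2 J := by
    intro i k hik
    induction k, hik using Nat.le_induction with
    | base =>
      intro J x hx j a b β l hl
      simp [iteratedFDeriv_fun_zero]
    | succ k hik ih =>
      intro J x hx j a b β l hl
      have h1 := norm_iteratedFDeriv_coeff_sub_le (u i).1.1 (u k).1.1 (u (k + 1)).1.1 (hKJe J hx)
        j a b β l
      have h2 := hball k (u k) J x hx j a b β l hl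
      rw [← hu] at h2
      linarith [ih J x hx j a b β l hl]
  -- By local finiteness only finitely many steps alter the operator near a given point.
  have hloc : ∀ x : M, ∃ (N : ℕ) (V : Set M), IsOpen V ∧ x ∈ V ∧ ∀ k ≥ N,
      ∀ (e : atlas (EuclideanSpace ℝ (Fin n)) M) (j a b β), ∀ y ∈ V ∩ e.1.source,
        (u k).1.1.coeff e j a b β (e.1 y) = (u N).1.1.coeff e j a b β (e.1 y) := by
    intro x
    obtain ⟨V, hV, hVfin⟩ := hfin x
    obtain ⟨W, hWV, hW, hxW⟩ := mem_nhds_iff.1 hV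
    obtain ⟨N, hN⟩ := hVfin.bddAbove
    refine ⟨N + 1, W, hW, hxW, fun k hk => ?_⟩
    induction k, hk using Nat.le_induction with
    | base => exact fun _ _ _ _ _ _ _ => rfl
    | succ k hk ih =>
      intro e' j a b β y hy
      rw [← ih e' j a b β y hy, hu]
      refine hoff k (u k) e' j a b β y hy.2 fun hyT => ?_
      have := hN ⟨y, hyT, hWV hy.1⟩
      omega
  obtain ⟨L', hL'⟩ := exists_isLocalLimit (u := fun k => (u k).1.1) hloc
  have hlim : ∀ i J, ∀ x ∈ KJ J, ∀ j a b β, ∀ l ≤ s',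
      ‖iteratedFDeriv ℝ l (fun z => L'.coeff (eJ J) j a b β z -
        (u i).1.1.coeff (eJ J) j a b β z) ((eJ J).1 x)‖ < (u i).1.2 J := by
    intro i J x hx j a b β l hl
    obtain ⟨N, V, hV, hxV, hN⟩ := hL' x
    have h1 := iteratedFDeriv_coeff_congr (hKJe J hx) hV hxV
      (hN (max i N) (le_max_right _ _) (eJ J) j a b β)
    have h2 : (fun z => L'.coeff (eJ J) j a b β z - (u i).1.1.coeff (eJ J) j a b β z)
        =ᶠ[𝓝 ((eJ J).1 x)] fun z => (u (max i N)).1.1.coeff (eJ J) j a b β z -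
          (u i).1.1.coeff (eJ J) j a b β z := by
      filter_upwards [h1] with z hz
      rw [hz]
    rw [(h2.iteratedFDeriv ℝ l).eq_of_nhds]
    have h3 := htel i (max i N) (le_max_left _ _) J x hx j a b β l hl
    linarith [(u (max i N)).2.2 J]
  refine ⟨L', hL'.isUTS fun k => (u k).2.1, fun i => ?_, fun J x hx j a b β l hl =>
    hlim 0 (Sum.inl J) x hx j a b β l (hl.trans (le_max_left _ _))⟩
  have h1 := (u (i + 1)).2.2 (Sum.inr i)
  refine isGoodOn_of_near (ε := 2 * (u (i + 1)).1.2 (Sum.inr i)) (hc i).subset_source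
    (by positivity) (hgood i (u i)) fun x hx j a b β l hl => ?_
  have h2 := hlim (i + 1) (Sum.inr i) x hx j a b β l (hl.trans (le_max_right _ _))
  rwa [mul_div_cancel_left₀ _ (two_ne_zero' ℝ)]

omit [IsManifold (𝓡 n) ∞ M] [T2Space M] in
theorem isOpen_setOf_forall_isGoodOn {e : ℕ → atlas (EuclideanSpace ℝ (Fin n)) M} {C : ℕ → Set M}
    (hC : ∀ i, IsCompact (C i)) (hCe : ∀ i, C i ⊆ (e i).1.source) (hfin : LocallyFinite C) :
    IsOpen {L : LinearPDO n r (m + 1) m M | ∀ i, L.IsGoodOn (e i) (C i)} := by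
  intro L hL
  choose ε hε hg using hL
  exact ⟨2 * n, ℕ, e, C, fun i => ε i / 2, hfin, fun i => ⟨hC i, hCe i, half_pos (hε i)⟩,
    fun L' hL' i => isGoodOn_of_near (hCe i) (hε i) (hg i) (hL' i)⟩

theorem IsGoodOn.not_isCharacteristicSubmanifold {L : LinearPDO n r (m + 1) m M} (hL : L.IsUTS)
    {e : atlas (EuclideanSpace ℝ (Fin n)) M} {C : Set M} (h : L.IsGoodOn e C) {x : M} (hx : x ∈ C)
    (hxe : x ∈ e.1.source) {k : ℕ} (hk : 1 ≤ k) {E₀ : Set M} (hxE : x ∈ E₀) :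
    ¬ L.IsCharacteristicSubmanifold k E₀ := by
  intro hE
  obtain ⟨ε, hε, hg⟩ := h
  obtain ⟨z, hz, hzt, hbad⟩ := hE.exists_isBad hk hxE e hxe
    (eventually_abs_smoothJet_sub_lt e.1.open_target (L.contDiffOn_topCoeff e)
      (e.1.map_source hxe) (2 * n) hε)
  exact hg x hx _ (isAdmissible_smoothJet_topCoeff hL e hzt) hz hbad

end LinearPDO

theorem mainTheorem9 (n m r : ℕ) (hr : 1 ≤ r) {M : Type*} [TopologicalSpace M]
    [ChartedSpace (EuclideanSpace ℝ (Fin n)) M] [IsManifold (𝓡 n) ∞ M]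
    [T2Space M] [SecondCountableTopology M] (hM : AdaptedAtlas n (m + 1) M) :
    ∃ 𝒢 : Set {L : LinearPDO n r (m + 1) m M // L.IsUTS},
      IsOpen 𝒢 ∧ Dense 𝒢 ∧
        ∀ L ∈ 𝒢, ∀ k : ℕ, 1 ≤ k → ∀ E₀ : Set M,
          ¬ L.1.IsCharacteristicSubmanifold k E₀ := by

  -- Over the empty manifold a characteristic submanifold is excluded by its being nonempty; the
  -- cover uses a point of `M` for its default chart.
  rcases isEmpty_or_nonempty M with hE | hE
  · exact ⟨univ, isOpen_univ, dense_univ, fun L _ k _ E₀ h => hE.elim h.1.some⟩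
  obtain ⟨e, C, T, χ, ψ, hc, hcover, hfin⟩ := LinearPDO.exists_isCutoff_cover n M
  refine ⟨{L | ∀ i, L.1.IsGoodOn (e i) (C i)}, ?_, ?_, ?_⟩
  · exact (LinearPDO.isOpen_setOf_forall_isGoodOn (fun i => (hc i).isCompact)
      (fun i => (hc i).subset_source)
      (hfin.subset fun i => (hc i).subset_image)).preimage continuous_subtype_val
  · rw [dense_iff_inter_open]
    rintro U hU ⟨⟨L, hL⟩, hLU⟩
    obtain ⟨W, hW, rfl⟩ := isOpen_induced_iff.1 hU
    obtain ⟨s, ι, eK, K, ε, hK, h, hball⟩ := hW L hLU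
    obtain ⟨L', hL', hgood, hmem⟩ := LinearPDO.exists_forall_isGoodOn_mem_whitneyBall hM hr hc hfin
      hL s hK (fun j => (h j).1) (fun j => (h j).2.1) fun j => (h j).2.2
    exact ⟨⟨L', hL'⟩, hball hmem, hgood⟩
  · intro L hL k hk E₀ hE
    obtain ⟨x, hx⟩ := hE.1
    obtain ⟨i, hi⟩ := hcover x
    exact (hL i).not_isCharacteristicSubmanifold L.2 hi ((hc i).subset_source hi) hk hx hE
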